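/- Fix $N\in\mathbb N$ and a real $2N\times 2N$ matrix $J$ with $J^T=J^{-1}=-J$. Let $L^2=L^2(\mathbb R,\mathbb R^{2N})$ and $H^1=H^1(\mathbb R,\mathbb R^{2N})$, the latter with norm $(\|x\|_2^2+\|x'\|_2^2)^{1/2}$. A continuous map $f(t,\xi)$ on $\mathbb R\times\mathbb R^M$ with values in a finite-dimensional space is called a *$C^0_\xi$-bundle map* if the family $\{f(t,\cdot)\}_{t\in\mathbb R}$ is equicontinuous at every point, and a *$C^1_\xi$-bundle map* if in addition $D_\xi f$ exists and is a $C^0_\xi$-bundle map. Let $H:\mathbb R\times\mathbb R^{2N}\times\mathbb R\to\mathbb R$, $(t,\xi,\lambda)\mapsto H(t,\xi,\lambda)$, satisfy: - (H1) $H$ is continuous, $H(t,\cdot,\lambda)\in C^2(\mathbb R^{2N})$ and $D_\xi H(t,0,\lambda)=0$ for all $t,\lambda\in\mathbb R$. - (H2) $D_\xi H$, $D_\xi^2H$, $D_\lambda D_\xi H$, $D_\lambda D_\xi^2H$ and $D_\xi D_\lambda D_\xi H$ exist and are continuous on $\mathbb R\times\mathbb R^{2N}\times\mathbb R$. - (H3)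 For each $\lambda$, $D_\xi H(\cdot,\cdot,\lambda)$ is a $C^1_\xi$-bundle map, and $D_\lambda D_\xi^2H$ is a $C^0_{(\xi,\lambda)}$-bundle map. - (H4) $D_\xi^2H(\cdot,0,0)$ and $D_\lambda D_\xi^2H(\cdot,0,0)$ belong to $L^\infty(\mathbb R)$. - (H$^\infty$) For every $\lambda\in\mathbb R$ there are $C^1_\xi$-bundle maps $g^{\pm}(\cdot,\cdot,\lambda):\mathbb R\times\mathbb R^{2N}\to\mathbb R^{2N}$ and periods $T^{\pm}=T^\pm(\lambda)>0$ with $g^\pm(t,0,\lambda)=0$ and $g^\pm(t+T^\pm,\xi,\lambda)=g^\pm(t,\xi,\lambda)$ for all $t,\xi$, and $D_\xi^2H(t,\xi,\lambda)-D_\xi g^\pm(t,\xi,\lambda)\to0$ as $t\to\pm\infty$, uniformly for $\xi$ in bounded sets. Put $F(\lambda,x)=Jx'-D_\xi H(\cdot,x(\cdot),\lambda)$ for $(\lambda,x)\in\mathbb R\times H^1$, and $A^\pm_\lambda(t)=D_\xi g^\pm(t,0,\lambda)$. Let $\Lambda\subset\mathbb R$ be an open interval such that, for every $\lambda\in\Lambda$: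 1. the $T^\pm$-periodic linear systems $Jx'-A^+_\lambda(t)x=0$ and $Jx'-A^-_\lambda(t)x=0$ have no characteristic multipliers (eigenvalues of the monodromy matrix) on the unit circle; 2. each of $g=g^+(\cdot,\cdot,\lambda)$ and $g=g^-(\cdot,\cdot,\lambda)$ satisfies at least one of the following conditions (not necessarily the same one): - (a) there is a real symmetric $2N\times2N$ matrix $C$ with $\langle g(t,\xi),JC\xi\rangle>0$ for all $t\in\mathbb R$ and $\xi\in\mathbb R^{2N}\setminus\{0\}$; - (b) $g(t,\xi)=D_\xi g(t,0)\,\xi$ for all $(t,\xi)$; - (c) $g$ is independent of $t$, and $0$ is an isolated zero of a function $G:\mathbb R^{2N}\to\mathbb R$ with gradient $D_\xi G=g$ (in particular $G(0)=0$). Then $D_\xi H(\cdot,x(\cdot),\lambda)\in L^2$ for all $(\lambda,x)\in\mathbb R\times H^1$, so that $F$ maps $\mathbb R\times H^1$ into $L^2$, and $\Lambda$ is admissible for $F$, that is: $F\in C^1(\Lambda\times H^1,L^2)$; for all $(\lambda,x)\in\Lambda\times H^1$ the operator $D_xF(\lambda,x):H^1\to L^2$ is Fredholm of index zero; and for every compact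 $K\subset L^2$ and every closed bounded $W\subset\mathbb R\times H^1$ with $\inf\Lambda<\inf PW\le\sup PW<\sup\Lambda$, where $P(\lambda,x)=\lambda$, the set $F^{-1}(K)\cap W$ is a compact subset of $\mathbb R\times H^1$. -/

import Mathlib

open MeasureTheory Filter Topology Set
open scoped ContDiff

noncomputable section

namespace HamiltonianHomoclinic

/-! ## The spaces `ℝ^{2N}`, `L²(ℝ, ℝ^{2N})` and `H¹(ℝ, ℝ^{2N})` -/

/-- `ℝ^{2N}` with its Euclidean norm and scalar product. -/
abbrev PhaseSpace (N : ℕ) : Type := EuclideanSpace ℝ (Fin (2 * N))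

/-- Real `2N × 2N` matrices. -/
abbrev Mat (N : ℕ) : Type := Matrix (Fin (2 * N)) (Fin (2 * N)) ℝ

/-- The linear operator `ξ ↦ M ξ` of `ℝ^{2N}` given by a matrix `M`. -/
def matOp {N : ℕ} (M : Mat N) : PhaseSpace N →L[ℝ] PhaseSpace N :=
  Matrix.toEuclideanCLM (𝕜 := ℝ) M

/-- `L² = L²(ℝ, ℝ^{2N})`. -/
abbrev L2 (N : ℕ) : Type := Lp (PhaseSpace N) 2 (volume : Measure ℝ)

/-- `v` is the weak derivative of `u` on `ℝ`: `∫ φ' u = - ∫ φ v` for every real test function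
`φ ∈ C_c^∞(ℝ)`. -/
def IsWeakDeriv {N : ℕ} (u v : L2 N) : Prop :=
  ∀ φ : ℝ → ℝ, ContDiff ℝ ∞ φ → HasCompactSupport φ →
    ∫ t, deriv φ t • u t = - ∫ t, φ t • v t

lemma integrable_test_smul {N : ℕ} (u : L2 N) {φ : ℝ → ℝ} (hφ : Continuous φ)
    (hc : HasCompactSupport φ) : Integrable (fun t => φ t • u t) :=
  ((Lp.memLp u).locallyIntegrable (by norm_num)).integrable_smul_left_of_hasCompactSupport hφ hc

/-- The pairs `(u, u')` with `u ∈ L²` and weak derivative `u' ∈ L²`, as a subspace of the Hilbert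
sum `L² ⊕ L²`. -/
def sobolevSubmodule (N : ℕ) : Submodule ℝ (WithLp 2 (L2 N × L2 N)) where
  carrier := {p | IsWeakDeriv p.fst p.snd}
  zero_mem' := by
    intro φ _ _
    have h : ((0 : L2 N) : ℝ → PhaseSpace N) =ᵐ[volume] 0 := Lp.coeFn_zero _ _ _
    have h1 : ∫ t, deriv φ t • (0 : L2 N) t = 0 :=
      integral_eq_zero_of_ae (by filter_upwards [h] with t ht; rw [ht]; simp)
    have h2 : ∫ t, φ t • (0 : L2 N) t = 0 :=
      integral_eq_zero_of_ae (by filter_upwards [h] with t ht; rw [ht]; simp)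
    change ∫ t, deriv φ t • (0 : L2 N) t = - ∫ t, φ t • (0 : L2 N) t
    rw [h1, h2, neg_zero]
  add_mem' := by
    intro p q hp hq φ hφ hc
    have hd : Continuous (deriv φ) := hφ.continuous_deriv (by simp)
    have h1 : ∫ t, deriv φ t • (p.fst + q.fst : L2 N) t
        = (∫ t, deriv φ t • p.fst t) + ∫ t, deriv φ t • q.fst t := by
      rw [← integral_add (integrable_test_smul _ hd hc.deriv)
        (integrable_test_smul _ hd hc.deriv)]
      refine integral_congr_ae ?_
      filter_upwards [Lp.coeFn_add p.fst q.fst] with t ht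
      rw [ht, Pi.add_apply, smul_add]
    have h2 : ∫ t, φ t • (p.snd + q.snd : L2 N) t
        = (∫ t, φ t • p.snd t) + ∫ t, φ t • q.snd t := by
      rw [← integral_add (integrable_test_smul _ hφ.continuous hc)
        (integrable_test_smul _ hφ.continuous hc)]
      refine integral_congr_ae ?_
      filter_upwards [Lp.coeFn_add p.snd q.snd] with t ht
      rw [ht, Pi.add_apply, smul_add]
    change ∫ t, deriv φ t • (p.fst + q.fst : L2 N) t = - ∫ t, φ t • (p.snd + q.snd : L2 N) t
    rw [h1, h2, hp φ hφ hc, hq φ hφ hc, neg_add]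
  smul_mem' := by
    intro c p hp φ hφ hc
    have h1 : ∫ t, deriv φ t • (c • p.fst : L2 N) t = c • ∫ t, deriv φ t • p.fst t := by
      rw [← integral_smul]
      refine integral_congr_ae ?_
      filter_upwards [Lp.coeFn_smul c p.fst] with t ht
      rw [ht, Pi.smul_apply, smul_comm]
    have h2 : ∫ t, φ t • (c • p.snd : L2 N) t = c • ∫ t, φ t • p.snd t := by
      rw [← integral_smul]
      refine integral_congr_ae ?_
      filter_upwards [Lp.coeFn_smul c p.snd] with t ht
      rw [ht, Pi.smul_apply, smul_comm]
    change ∫ t, deriv φ t • (c • p.fst : L2 N) t = - ∫ t, φ t • (c • p.snd : L2 N) t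
    rw [h1, h2, hp φ hφ hc, smul_neg]

/-- `H¹ = H¹(ℝ, ℝ^{2N})`, with the norm `(‖x‖₂² + ‖x'‖₂²)^{1/2}`. -/
abbrev H1 (N : ℕ) : Type := ↥(sobolevSubmodule N)

/-- The `L²` class of an element of `H¹`. -/
def H1.toL2 {N : ℕ} (x : H1 N) : L2 N := x.1.fst

/-- The weak derivative `x'` of `x ∈ H¹`. -/
def H1.weakDeriv {N : ℕ} (x : H1 N) : L2 N := x.1.snd

/-! ## Fredholm operators of index zero and admissible intervals -/

/-- `L ∈ Φ₀(X, Y)`: `L` is Fredholm and `dim ker L = codim range L`. -/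
def IsFredholmIndexZero {X Y : Type*} [NormedAddCommGroup X] [NormedSpace ℝ X]
    [NormedAddCommGroup Y] [NormedSpace ℝ Y] (L : X →L[ℝ] Y) : Prop :=
  L.IsFredholm ∧ Module.finrank ℝ L.ker = Module.finrank ℝ (Y ⧸ L.range)

/-- The (open) interval `I` is admissible for `F`, where `F` is of class `C¹` on `I × X`:
all partial derivatives `D_x F(l, x)`, `l ∈ I`, are Fredholm of index zero, and `F⁻¹(K) ∩ W` is
compact whenever `K` is compact and `W` is closed and bounded with
`inf I < inf P W ≤ sup P W < sup I`, `P(l, x) = l`. Infima and suprema are taken in `[-∞, ∞]`. -/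
structure IsAdmissible {X Y : Type*} [NormedAddCommGroup X] [NormedSpace ℝ X]
    [NormedAddCommGroup Y] [NormedSpace ℝ Y] (F : ℝ × X → Y) (I : Set ℝ) : Prop where
  contDiffOn : ContDiffOn ℝ 1 F (I ×ˢ univ)
  fredholm : ∀ l ∈ I, ∀ x : X, IsFredholmIndexZero (fderiv ℝ (fun y => F (l, y)) x)
  proper : ∀ K : Set Y, IsCompact K → ∀ W : Set (ℝ × X), IsClosed W → Bornology.IsBounded W →
    sInf ((fun l : ℝ => (l : EReal)) '' I) < sInf ((fun p : ℝ × X => (p.1 : EReal)) '' W) →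
    sInf ((fun p : ℝ × X => (p.1 : EReal)) '' W) ≤ sSup ((fun p : ℝ × X => (p.1 : EReal)) '' W) →
    sSup ((fun p : ℝ × X => (p.1 : EReal)) '' W) < sSup ((fun l : ℝ => (l : EReal)) '' I) →
    IsCompact (F ⁻¹' K ∩ W)

/-! ## Equicontinuous bundle maps -/

/-- `f(t, ξ)` is an equicontinuous `C⁰_ξ`-bundle map: it is continuous in `(t, ξ)` and the family
`{f(t, ·)}_t` is equicontinuous at every point. -/
def IsBundleMap₀ {V W : Type*} [NormedAddCommGroup V] [NormedAddCommGroup W]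
    (f : ℝ → V → W) : Prop :=
  Continuous (fun p : ℝ × V => f p.1 p.2) ∧ Equicontinuous f

/-- `f(t, ξ)` is an equicontinuous `C¹_ξ`-bundle map: `f` and its derivative in `ξ` are
equicontinuous `C⁰_ξ`-bundle maps. -/
def IsBundleMap₁ {V W : Type*} [NormedAddCommGroup V] [NormedSpace ℝ V]
    [NormedAddCommGroup W] [NormedSpace ℝ W] (f : ℝ → V → W) : Prop :=
  IsBundleMap₀ f ∧ (∀ t, Differentiable ℝ (f t)) ∧ IsBundleMap₀ (fun t ξ => fderiv ℝ (f t) ξ)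

/-! ## The Hamiltonian `H(t, ξ, l)` and the hypotheses on it -/

section Hamiltonian

variable {N : ℕ}

/-- `D_ξ H(t, ξ, l)`, as a vector of `ℝ^{2N}`. -/
def DxH (H : ℝ → PhaseSpace N → ℝ → ℝ) (t : ℝ) (ξ : PhaseSpace N) (l : ℝ) : PhaseSpace N :=
  gradient (fun η => H t η l) ξ

/-- `D_ξ² H(t, ξ, l)`, as a linear operator of `ℝ^{2N}`. -/
def DxxH (H : ℝ → PhaseSpace N → ℝ → ℝ) (t : ℝ) (ξ : PhaseSpace N) (l : ℝ) :
    PhaseSpace N →L[ℝ] PhaseSpace N :=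
  fderiv ℝ (fun η => DxH H t η l) ξ

/-- `D_l D_ξ H(t, ξ, l)`. -/
def DlDxH (H : ℝ → PhaseSpace N → ℝ → ℝ) (t : ℝ) (ξ : PhaseSpace N) (l : ℝ) : PhaseSpace N :=
  deriv (fun m => DxH H t ξ m) l

/-- `D_l D_ξ² H(t, ξ, l)`. -/
def DlDxxH (H : ℝ → PhaseSpace N → ℝ → ℝ) (t : ℝ) (ξ : PhaseSpace N) (l : ℝ) :
    PhaseSpace N →L[ℝ] PhaseSpace N :=
  deriv (fun m => DxxH H t ξ m) l

/-- `D_ξ D_l D_ξ H(t, ξ, l)`. -/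
def DxDlDxH (H : ℝ → PhaseSpace N → ℝ → ℝ) (t : ℝ) (ξ : PhaseSpace N) (l : ℝ) :
    PhaseSpace N →L[ℝ] PhaseSpace N :=
  fderiv ℝ (fun η => DlDxH H t η l) ξ

/-- The standing hypotheses on the Hamiltonian. -/
structure HamiltonianHyp (H : ℝ → PhaseSpace N → ℝ → ℝ) : Prop where
  /-- `H` is continuous, `C²` in `ξ`, and `ξ = 0` is an equilibrium. -/
  continuous : Continuous (fun p : ℝ × PhaseSpace N × ℝ => H p.1 p.2.1 p.2.2)
  contDiff : ∀ t l, ContDiff ℝ 2 (fun ξ => H t ξ l)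
  DxH_zero : ∀ t l, DxH H t 0 l = 0
  /-- The partial derivatives below exist (`D_ξ H` and `D_ξ² H` do by `contDiff`) and are
  continuous in `(t, ξ, l)`. -/
  exists_DlDxH : ∀ t ξ l, DifferentiableAt ℝ (fun m => DxH H t ξ m) l
  exists_DlDxxH : ∀ t ξ l, DifferentiableAt ℝ (fun m => DxxH H t ξ m) l
  exists_DxDlDxH : ∀ t ξ l, DifferentiableAt ℝ (fun η => DlDxH H t η l) ξ
  continuous_DxH : Continuous (fun p : ℝ × PhaseSpace N × ℝ => DxH H p.1 p.2.1 p.2.2)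
  continuous_DxxH : Continuous (fun p : ℝ × PhaseSpace N × ℝ => DxxH H p.1 p.2.1 p.2.2)
  continuous_DlDxH : Continuous (fun p : ℝ × PhaseSpace N × ℝ => DlDxH H p.1 p.2.1 p.2.2)
  continuous_DlDxxH : Continuous (fun p : ℝ × PhaseSpace N × ℝ => DlDxxH H p.1 p.2.1 p.2.2)
  continuous_DxDlDxH : Continuous (fun p : ℝ × PhaseSpace N × ℝ => DxDlDxH H p.1 p.2.1 p.2.2)
  /-- Equicontinuity in `t`. -/
  bundle_DxH : ∀ l, IsBundleMap₁ (fun t ξ => DxH H t ξ l)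
  bundle_DlDxxH : IsBundleMap₀ (fun (t : ℝ) (q : PhaseSpace N × ℝ) => DlDxxH H t q.1 q.2)
  /-- Boundedness in `t` at `(0, 0)`. -/
  bounded_DxxH : MemLp (fun t => DxxH H t 0 0) ⊤ volume
  bounded_DlDxxH : MemLp (fun t => DlDxxH H t 0 0) ⊤ volume

/-- Asymptotic periodicity at one end (`e = atTop` for `t → ∞`, `e = atBot` for `t → -∞`):
`g(t, ξ, l)` is the asymptotic limit of `D_ξ H`, and is `T l`-periodic in `t`. -/
structure AsymptoticLimit (H : ℝ → PhaseSpace N → ℝ → ℝ) (e : Filter ℝ)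
    (g : ℝ → PhaseSpace N → ℝ → PhaseSpace N) (T : ℝ → ℝ) : Prop where
  bundle : ∀ l, IsBundleMap₁ (fun t ξ => g t ξ l)
  zero : ∀ t l, g t 0 l = 0
  limit : ∀ l, ∀ B : Set (PhaseSpace N), Bornology.IsBounded B →
    TendstoUniformlyOn (fun t ξ => DxxH H t ξ l - fderiv ℝ (fun η => g t η l) ξ) 0 e B
  period_pos : ∀ l, 0 < T l
  periodic : ∀ l t ξ, g (t + T l) ξ l = g t ξ l

open Classical in
/-- The Nemytskii operator `x ↦ f(·, x(·))` with values in `L²`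
(it takes the value `0` at those `x` for which `f(·, x(·))` is not in `L²`). -/
def nemytskii (f : ℝ → PhaseSpace N → PhaseSpace N) (x : L2 N) : L2 N :=
  if hf : MemLp (fun t => f t (x t)) 2 (volume : Measure ℝ) then hf.toLp _ else 0

/-- `F(l, x) = J x' - D_ξ H(·, x(·), l)`, as a map `ℝ × H¹ → L²`. -/
def hamiltonianMap (J : Mat N) (H : ℝ → PhaseSpace N → ℝ → ℝ) (p : ℝ × H1 N) : L2 N :=
  (matOp J).compLp p.2.weakDeriv - nemytskii (fun t ξ => DxH H t ξ p.1) p.2.toL2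

/-! ## The two conditions on the limiting systems -/

/-- `ρ ∈ ℂ` is a characteristic multiplier of the `T`-periodic linear system `J x' - A(t) x = 0`:
a complex eigenvalue of the monodromy operator `Φ(T)`, where `Φ` is the fundamental solution
normalized by `Φ(0) = 1`. -/
def IsCharacteristicMultiplier (J : Mat N) (A : ℝ → PhaseSpace N →L[ℝ] PhaseSpace N) (T : ℝ)
    (ρ : ℂ) : Prop :=
  ∃ Φ : ℝ → PhaseSpace N →L[ℝ] PhaseSpace N,
    Φ 0 = ContinuousLinearMap.id ℝ (PhaseSpace N) ∧
    (∀ t, DifferentiableAt ℝ Φ t ∧ (matOp J).comp (deriv Φ t) - (A t).comp (Φ t) = 0) ∧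
    ((Φ T : PhaseSpace N →ₗ[ℝ] PhaseSpace N).charpoly.map (algebraMap ℝ ℂ)).IsRoot ρ

/-- (a) `⟨g(t, ξ), J C ξ⟩ > 0` for `ξ ≠ 0` and some real symmetric matrix `C`. -/
def ConditionA (J : Mat N) (g : ℝ → PhaseSpace N → PhaseSpace N) : Prop :=
  ∃ C : Mat N, C.IsSymm ∧ ∀ t ξ, ξ ≠ 0 → 0 < inner ℝ (g t ξ) (matOp (J * C) ξ)

/-- (b) `g(t, ·)` is linear: `g(t, ξ) = D_ξ g(t, 0) ξ`. -/
def ConditionB (g : ℝ → PhaseSpace N → PhaseSpace N) : Prop :=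
  ∀ t ξ, g t ξ = fderiv ℝ (g t) 0 ξ

/-- (c) `g` is independent of `t` and `0` is an isolated zero of a potential `G` of `g`. -/
def ConditionC (g : ℝ → PhaseSpace N → PhaseSpace N) : Prop :=
  (∀ s t ξ, g s ξ = g t ξ) ∧
  ∃ G : PhaseSpace N → ℝ, (∀ t ξ, HasGradientAt G (g t ξ) ξ) ∧
    G 0 = 0 ∧ ∀ᶠ ξ in 𝓝[≠] (0 : PhaseSpace N), G ξ ≠ 0

end Hamiltonian

end HamiltonianHomoclinic

end

open HamiltonianHomoclinic

noncomputable section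

namespace HamiltonianHomoclinic

/-! ## Real-valued `L²` norms -/

section LpNorm

variable {α E F : Type*} [MeasurableSpace α] {μ : Measure α} [NormedAddCommGroup E]
  [NormedAddCommGroup F]

/-! Since J² = -1, the equation F(l, x) = y reads x' = -J (D_ξ H(t, x, l) + y). Everything rests on
one compactness statement, `exists_subseq_tendsto_of_isHyperbolicEnd`: a bounded sequence in H¹
along which x' - F(t, x) converges in L² has a subsequence converging in H¹.

By Arzelà–Ascoli a subsequence converges locally uniformly, so compactness can only fail at t = ±∞.
If values of size δ escaped to infinity, translating back by multiples of the period would produce,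
in the limit, a nonzero homoclinic solution of the periodic system z' = -J g(t, z)
(`eventually_norm_le_of_isHyperbolicEnd`). Conditions (a), (b), (c) exclude it: in (a) the quadratic
form ⟨z, C z⟩ is strictly monotone where z ≠ 0, yet vanishes at both ends; in (c) G is conserved and
0 is isolated in its zero set; in (b) the system is linear and the coercivity below applies. Hence
the sequence is uniformly small near ±∞, where the equation is a small perturbation of its
linearization at 0; coercivity of that linearization absorbs the error and yields L² convergence
(`exists_cutoff_tendsto_lpNorm`). The derivatives then converge by the equation.

Coercivity of w ↦ w' - B w for periodic B (`exists_coercive_of_monodromy`) is obtained by sampling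
at the multiples of the period: w(kT) solves u_{k+1} = M u_k up to an ℓ² error controlled by w' - B
w, where M is the monodromy operator. The shift S is an isometry of ℓ²(ℤ), so S - r is bounded below
when |r| ≠ 1; the adjugate identity transfers this to S - M through the characteristic polynomial of
M.

The same compactness applied to the linear equation J w' - D_ξ² H(t, x(t), l) w = y gives a
finite-dimensional kernel and a closed range. The index is zero because J d/dt - a is self-adjoint
in L² with domain H¹, so that the orthogonal complement of the range is the kernel
(`isFredholmIndexZero_of_isHyperbolicEnd`). For properness the parameter also varies: its limit
stays in Λ, and F(l, x_n) - F(l_n, x_n) → 0 since F is Lipschitz in l on bounded sets.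

For the C¹ property, equicontinuity together with boundedness at the single point (0, 0) makes the
second derivatives bounded and uniformly continuous on bounded sets, uniformly in t (`IsTame`). As
H¹ embeds in the bounded continuous functions, pointwise Taylor estimates pass to L², and both
partial derivatives are continuous (`IsSmoothField.contDiff_toL2`). -/

lemma lpNorm_mono_ae {p : ENNReal} {f : α → E} {g : α → F} (hg : MemLp g p μ)
    (h : ∀ᵐ t ∂μ, ‖f t‖ ≤ ‖g t‖) : lpNorm f p μ ≤ lpNorm g p μ := by
  by_cases hf : AEStronglyMeasurable f μ
  · rw [← toReal_eLpNorm hf, ← toReal_eLpNorm hg.aestronglyMeasurable]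
    exact ENNReal.toReal_mono hg.eLpNorm_ne_top (eLpNorm_mono_ae h)
  -- `lpNorm` is 0 on functions that are not measurable, so no measurability of f is required.
  · rw [lpNorm_of_not_aestronglyMeasurable hf]; exact lpNorm_nonneg

lemma lpNorm_congr_ae {p : ENNReal} {f g : α → E} (h : f =ᵐ[μ] g) :
    lpNorm f p μ = lpNorm g p μ := by
  by_cases hf : AEStronglyMeasurable f μ
  · rw [← toReal_eLpNorm hf, ← toReal_eLpNorm (hf.congr h), eLpNorm_congr_ae h]
  · rw [lpNorm_of_not_aestronglyMeasurable hf,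
      lpNorm_of_not_aestronglyMeasurable fun hg => hf (hg.congr h.symm)]

lemma lpNorm_two_sq {f : α → E} (hf : MemLp f 2 μ) :
    lpNorm f 2 μ ^ 2 = ∫ t, ‖f t‖ ^ 2 ∂μ := by
  rw [lpNorm_eq_integral_norm_rpow_toReal (by norm_num) (by norm_num) hf.aestronglyMeasurable]
  have h0 : 0 ≤ ∫ t, ‖f t‖ ^ 2 ∂μ := integral_nonneg fun t => by positivity
  simp only [ENNReal.toReal_ofNat, Real.rpow_ofNat]
  rw [← Real.rpow_natCast, ← Real.rpow_mul h0]
  norm_num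

lemma lp_norm_eq_lpNorm {p : ENNReal} (f : Lp E p μ) : ‖f‖ = lpNorm f p μ := by
  rw [Lp.norm_def, toReal_eLpNorm (Lp.aestronglyMeasurable f)]

end LpNorm

/-! ### Integrals over bounded windows and over periods -/

section IntervalBounds

variable {E : Type*} [NormedAddCommGroup E]

lemma integrable_sq_norm {f : ℝ → E} (hf : MemLp f 2 volume) :
    Integrable (fun t => ‖f t‖ ^ 2) :=
  (memLp_two_iff_integrable_sq_norm hf.aestronglyMeasurable).1 hf

lemma intervalIntegrable_of_locallyIntegrable {f : ℝ → E} (hf : LocallyIntegrable f) (a b : ℝ) :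
    IntervalIntegrable f volume a b :=
  intervalIntegrable_iff.mpr <|
    (hf.integrableOn_isCompact isCompact_uIcc).mono_set uIoc_subset_uIcc

lemma intervalIntegrable_of_memLp_two {f : ℝ → E} (hf : MemLp f 2 volume) (a b : ℝ) :
    IntervalIntegrable f volume a b :=
  intervalIntegrable_of_locallyIntegrable (hf.locallyIntegrable (by norm_num)) a b

/-- The Cauchy–Schwarz inequality on an interval. -/
lemma sq_integral_norm_le {f : ℝ → E} (hf : MemLp f 2 volume) {a b : ℝ} (hab : a ≤ b) :
    (∫ t in a..b, ‖f t‖) ^ 2 ≤ (b - a) * ∫ t in a..b, ‖f t‖ ^ 2 := by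
  rcases hab.eq_or_lt with rfl | hlt
  · simp
  have h1 : IntervalIntegrable (fun t => ‖f t‖) volume a b := (intervalIntegrable_of_memLp_two hf a b).norm
  have h2 : IntervalIntegrable (fun t => ‖f t‖ ^ 2) volume a b :=
    (integrable_sq_norm hf).intervalIntegrable
  set A := ∫ t in a..b, ‖f t‖
  set Q := ∫ t in a..b, ‖f t‖ ^ 2
  -- This is a multiple of the variance of ‖f‖ over [a, b]; its nonnegativity is the inequality.
  have h3 : 0 ≤ ∫ t in a..b, ((b - a) * ‖f t‖ - A) ^ 2 :=
    intervalIntegral.integral_nonneg hab fun t _ => by positivity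
  have h4 : ∫ t in a..b, ((b - a) * ‖f t‖ - A) ^ 2
      = (b - a) ^ 2 * Q - (2 * (b - a) * A) * A + (b - a) * A ^ 2 := by
    have : ∀ t, ((b - a) * ‖f t‖ - A) ^ 2
        = (b - a) ^ 2 * ‖f t‖ ^ 2 - (2 * (b - a) * A) * ‖f t‖ + A ^ 2 := fun t => by ring
    simp_rw [this]
    rw [intervalIntegral.integral_add ((h2.const_mul _).sub (h1.const_mul _)) (by simp),
      intervalIntegral.integral_sub (h2.const_mul _) (h1.const_mul _),
      intervalIntegral.integral_const_mul, intervalIntegral.integral_const_mul]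
    simp
    ring
  rw [h4] at h3
  have h5 : 0 ≤ (b - a) * ((b - a) * Q - A ^ 2) := by nlinarith
  have := nonneg_of_mul_nonneg_right h5 (by linarith)
  linarith

lemma integral_sq_norm_le {f : ℝ → E} (hf : MemLp f 2 volume) {a b : ℝ} (hab : a ≤ b) :
    ∫ t in a..b, ‖f t‖ ^ 2 ≤ lpNorm f 2 volume ^ 2 := by
  rw [lpNorm_two_sq hf, intervalIntegral.integral_of_le hab]
  exact setIntegral_le_integral (integrable_sq_norm hf) (.of_forall fun t => by positivity)

lemma integral_norm_le_sqrt_mul_lpNorm {f : ℝ → E} (hf : MemLp f 2 volume) {a b : ℝ}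
    (hab : a ≤ b) : ∫ t in a..b, ‖f t‖ ≤ √(b - a) * lpNorm f 2 volume := by
  have h0 : 0 ≤ lpNorm f 2 volume := lpNorm_nonneg
  refine le_of_sq_le_sq ?_ (by positivity)
  rw [mul_pow, Real.sq_sqrt (by linarith)]
  exact (sq_integral_norm_le hf hab).trans
    (mul_le_mul_of_nonneg_left (integral_sq_norm_le hf hab) (by linarith))

/-- The integral over `ℝ` is the sum of the integrals over the periods `[kT, (k+1)T]`. -/
lemma hasSum_integral_periods {g : ℝ → ℝ} (hg : Integrable g) {T : ℝ} (hT : 0 < T) :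
    HasSum (fun k : ℤ => ∫ t in (k * T)..(k * T + T), g t) (∫ t, g t) := by
  have h := hasSum_integral_iUnion (μ := volume) (f := g)
    (s := fun n : ℤ => Ioc (n • T) ((n + 1) • T)) (fun _ => measurableSet_Ioc)
    (pairwise_disjoint_Ioc_zsmul T) hg.integrableOn
  rw [iUnion_Ioc_zsmul hT, setIntegral_univ] at h
  have e : (fun k : ℤ => ∫ t in (k * T)..(k * T + T), g t)
      = fun k : ℤ => ∫ t in Ioc (k • T) ((k + 1) • T), g t := by
    ext k
    rw [intervalIntegral.integral_of_le (by linarith)]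
    simp [add_mul]
  rwa [e]

/-- Integrals over windows of fixed length tend to zero at infinity. -/
lemma tendsto_integral_window {g : ℝ → ℝ} (hg : Integrable g) (T : ℝ) {e : Filter ℝ}
    (he : e = atTop ∨ e = atBot) : Tendsto (fun t => ∫ s in t..(t + T), g s) e (𝓝 0) := by
  have hsplit : ∀ t, ∫ s in t..(t + T), g s = (∫ s in (0:ℝ)..(t + T), g s) - ∫ s in (0:ℝ)..t, g s :=
    fun t => (intervalIntegral.integral_interval_sub_left hg.intervalIntegrable
      hg.intervalIntegrable).symm
  simp_rw [hsplit]
  rcases he with rfl | rfl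
  · have h1 := intervalIntegral_tendsto_integral_Ioi (μ := volume) (0:ℝ) hg.integrableOn tendsto_id
    have h2 := intervalIntegral_tendsto_integral_Ioi (μ := volume) (0:ℝ) hg.integrableOn
      (tendsto_atTop_add_const_right atTop T tendsto_id)
    simpa using h2.sub h1
  · have h1 := intervalIntegral_tendsto_integral_Iic (μ := volume) (0:ℝ) hg.integrableOn tendsto_id
    have h2 := intervalIntegral_tendsto_integral_Iic (μ := volume) (0:ℝ) hg.integrableOn
      (tendsto_atBot_add_const_right atBot T tendsto_id)
    have h3 := h1.sub h2
    simp only [sub_self] at h3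
    refine h3.congr fun t => ?_
    simp only [id_eq]
    rw [intervalIntegral.integral_symm 0 t, intervalIntegral.integral_symm 0 (t + T)]
    ring

end IntervalBounds

/-! ## Functions with a square integrable derivative -/

/-- `x ∈ L²(ℝ, V)` is a primitive of `v ∈ L²(ℝ, V)`. -/
structure IsSobolevPair {V : Type*} [NormedAddCommGroup V] [NormedSpace ℝ V] (x v : ℝ → V) :
    Prop where
  memLp : MemLp x 2 volume
  memLp_deriv : MemLp v 2 volume
  sub_eq : ∀ a b, x b - x a = ∫ t in a..b, v t

namespace IsSobolevPair

variable {V : Type*} [NormedAddCommGroup V] [NormedSpace ℝ V] {x v y w : ℝ → V}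

lemma intervalIntegrable (h : IsSobolevPair x v) (a b : ℝ) : IntervalIntegrable v volume a b :=
  intervalIntegrable_of_memLp_two h.memLp_deriv a b

lemma continuous (h : IsSobolevPair x v) [CompleteSpace V] : Continuous x := by
  have : x = fun b => x 0 + ∫ t in (0:ℝ)..b, v t := by
    ext b; rw [← h.sub_eq]; abel
  rw [this]
  exact continuous_const.add (intervalIntegral.continuous_primitive h.intervalIntegrable 0)

lemma sub (h : IsSobolevPair x v) (h' : IsSobolevPair y w) : IsSobolevPair (x - y) (v - w) where
  memLp := h.memLp.sub h'.memLp
  memLp_deriv := h.memLp_deriv.sub h'.memLp_deriv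
  sub_eq a b := by
    simp only [Pi.sub_apply]
    rw [intervalIntegral.integral_sub (h.intervalIntegrable a b) (h'.intervalIntegrable a b),
      ← h.sub_eq, ← h'.sub_eq]
    abel

lemma translate (h : IsSobolevPair x v) (c : ℝ) :
    IsSobolevPair (fun t => x (t + c)) (fun t => v (t + c)) where
  memLp := h.memLp.comp_measurePreserving (measurePreserving_add_right volume c)
  memLp_deriv := h.memLp_deriv.comp_measurePreserving (measurePreserving_add_right volume c)
  sub_eq a b := by
    rw [h.sub_eq, intervalIntegral.integral_comp_add_right]

lemma norm_sub_le (h : IsSobolevPair x v) {a b : ℝ} (hab : a ≤ b) :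
    ‖x b - x a‖ ≤ √(b - a) * lpNorm v 2 volume := by
  rw [h.sub_eq]
  exact (intervalIntegral.norm_integral_le_integral_norm hab).trans
    (integral_norm_le_sqrt_mul_lpNorm h.memLp_deriv hab)

lemma dist_le (h : IsSobolevPair x v) (a b : ℝ) :
    dist (x a) (x b) ≤ √|a - b| * lpNorm v 2 volume := by
  rcases le_total a b with hab | hab
  · rw [dist_comm, dist_eq_norm, abs_sub_comm, abs_of_nonneg (by linarith)]
    exact h.norm_sub_le hab
  · rw [dist_eq_norm, abs_of_nonneg (by linarith)]
    exact h.norm_sub_le hab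

/-- Pointwise bound by the averages over a window. -/
lemma norm_sq_le_window (h : IsSobolevPair x v) [CompleteSpace V] {T : ℝ} (hT : 0 < T) (t : ℝ) :
    ‖x t‖ ^ 2 ≤ 2 / T * (∫ s in t..(t + T), ‖x s‖ ^ 2)
      + 2 * T * ∫ s in t..(t + T), ‖v s‖ ^ 2 := by
  have htT : t ≤ t + T := by linarith
  set P := ∫ s in t..(t + T), ‖x s‖
  set Q := ∫ s in t..(t + T), ‖v s‖
  have hP : P ^ 2 ≤ T * ∫ s in t..(t + T), ‖x s‖ ^ 2 := by
    simpa using sq_integral_norm_le h.memLp htT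
  have hQ : Q ^ 2 ≤ T * ∫ s in t..(t + T), ‖v s‖ ^ 2 := by
    simpa using sq_integral_norm_le h.memLp_deriv htT
  have hxi : IntervalIntegrable (fun s => ‖x s‖) volume t (t + T) :=
    (intervalIntegrable_of_memLp_two h.memLp _ _).norm
  -- Averaging this comparison over s in the window replaces the value at s by a mean, which
  -- Cauchy–Schwarz bounds.
  have h1 : ∀ s ∈ Icc t (t + T), ‖x t‖ ≤ ‖x s‖ + Q := by
    intro s hs
    have h2 : ‖x s - x t‖ ≤ Q := by
      rw [h.sub_eq]
      refine (intervalIntegral.norm_integral_le_integral_norm hs.1).trans ?_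
      exact intervalIntegral.integral_mono_interval le_rfl hs.1 hs.2
        (.of_forall fun t => norm_nonneg _) (h.intervalIntegrable _ _).norm
    have := norm_sub_norm_le (x t) (x s)
    rw [norm_sub_rev] at this
    linarith
  have h3 : T * ‖x t‖ ≤ P + T * Q := by
    have := intervalIntegral.integral_mono_on htT (by simp)
      (hxi.add (by simp : IntervalIntegrable (fun _ => Q) volume t (t + T))) h1
    rw [intervalIntegral.integral_add hxi (by simp)] at this
    simpa using this
  have h4 : (T * ‖x t‖) ^ 2 ≤ 2 * P ^ 2 + 2 * T ^ 2 * Q ^ 2 := by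
    have h5 : (T * ‖x t‖) ^ 2 ≤ (P + T * Q) ^ 2 := by
      gcongr
    nlinarith [sq_nonneg (P - T * Q)]
  have h6 : T ^ 2 * ‖x t‖ ^ 2 ≤ T ^ 2 * (2 / T * (∫ s in t..(t + T), ‖x s‖ ^ 2)
      + 2 * T * ∫ s in t..(t + T), ‖v s‖ ^ 2) := by
    have e : T ^ 2 * (2 / T * (∫ s in t..(t + T), ‖x s‖ ^ 2)
      + 2 * T * ∫ s in t..(t + T), ‖v s‖ ^ 2) = 2 * (T * ∫ s in t..(t + T), ‖x s‖ ^ 2)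
      + 2 * T ^ 2 * (T * ∫ s in t..(t + T), ‖v s‖ ^ 2) := by
      field_simp
    rw [e]
    have : 2 * T ^ 2 * Q ^ 2 ≤ 2 * T ^ 2 * (T * ∫ s in t..(t + T), ‖v s‖ ^ 2) := by gcongr
    linarith
  exact le_of_mul_le_mul_left h6 (by positivity)

/-- The sup-norm embedding: the window bound with T = 1, and 2a² + 2b² ≤ 4(a + b)² for a, b ≥ 0. -/
lemma norm_le (h : IsSobolevPair x v) [CompleteSpace V] (t : ℝ) :
    ‖x t‖ ≤ 2 * (lpNorm x 2 volume + lpNorm v 2 volume) := by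
  have h0 : 0 ≤ lpNorm x 2 volume := lpNorm_nonneg
  have h1 : 0 ≤ lpNorm v 2 volume := lpNorm_nonneg
  have h2 := h.norm_sq_le_window one_pos t
  have h3 := integral_sq_norm_le h.memLp (by linarith : t ≤ t + 1)
  have h4 := integral_sq_norm_le h.memLp_deriv (by linarith : t ≤ t + 1)
  refine le_of_sq_le_sq ?_ (by positivity)
  nlinarith [mul_nonneg h0 h1]

/-- The window bound controls x t by integrals of integrable functions over [t, t + 1], which vanish
at infinity. -/
lemma tendsto_zero (h : IsSobolevPair x v) [CompleteSpace V] {e : Filter ℝ}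
    (he : e = atTop ∨ e = atBot) : Tendsto x e (𝓝 0) := by
  have h1 := (tendsto_integral_window (integrable_sq_norm h.memLp) 1 he).const_mul 2
  have h2 := (tendsto_integral_window (integrable_sq_norm h.memLp_deriv) 1 he).const_mul 2
  have h3 := h1.add h2
  simp only [mul_zero, add_zero] at h3
  have h4 : Tendsto (fun t => ‖x t‖ ^ 2) e (𝓝 0) :=
    squeeze_zero (fun t => by positivity)
      (fun t => by simpa using h.norm_sq_le_window one_pos t) h3
  have h5 := (Real.continuous_sqrt.tendsto 0).comp h4
  rw [tendsto_zero_iff_norm_tendsto_zero]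
  simpa [Function.comp_def] using h5

end IsSobolevPair

/-! ## Products of primitives -/

lemma absolutelyContinuousOnInterval_of_primitive {f f' : ℝ → ℝ} (hf' : LocallyIntegrable f')
    (hf : ∀ a b, f b - f a = ∫ t in a..b, f' t) (a b : ℝ) :
    AbsolutelyContinuousOnInterval f a b := by
  have h1 := (intervalIntegrable_of_locallyIntegrable hf' a b)
    |>.absolutelyContinuousOnInterval_intervalIntegral (c := a) (by simp)
  have h2 : AbsolutelyContinuousOnInterval (fun _ : ℝ => f a) a b :=
    ((LipschitzWith.const (f a)).lipschitzOnWith (s := uIcc a b)).absolutelyContinuousOnInterval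
  have h3 := h2.add h1
  have e : f = (fun _ => f a) + fun t => ∫ s in a..t, f' s := by
    ext t
    rw [Pi.add_apply, ← hf a t]
    ring
  rwa [e]

lemma ae_hasDerivAt_of_primitive {f f' : ℝ → ℝ} (hf' : LocallyIntegrable f')
    (hf : ∀ a b, f b - f a = ∫ t in a..b, f' t) : ∀ᵐ t, HasDerivAt f (f' t) t := by
  filter_upwards [_root_.LocallyIntegrable.ae_hasDerivAt_integral hf'] with t ht
  have h := (ht 0).const_add (f 0)
  have e : f = fun s => f 0 + ∫ r in (0:ℝ)..s, f' r := by
    ext s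
    rw [← hf 0 s]
    ring
  rwa [e]

/-- Primitives of locally integrable functions are absolutely continuous with the expected
derivative almost everywhere, so the product rule integrates without any continuity of f' or g'. -/
lemma mul_sub_mul_eq_integral {f f' g g' : ℝ → ℝ} (hf' : LocallyIntegrable f')
    (hf : ∀ a b, f b - f a = ∫ t in a..b, f' t) (hg' : LocallyIntegrable g')
    (hg : ∀ a b, g b - g a = ∫ t in a..b, g' t) (a b : ℝ) :
    f b * g b - f a * g a = ∫ t in a..b, f' t * g t + f t * g' t := by
  rw [← (absolutelyContinuousOnInterval_of_primitive hf' hf a b).integral_deriv_mul_eq_sub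
    (absolutelyContinuousOnInterval_of_primitive hg' hg a b)]
  refine intervalIntegral.integral_congr_ae ?_
  filter_upwards [ae_hasDerivAt_of_primitive hf' hf, ae_hasDerivAt_of_primitive hg' hg]
    with t h1 h2 _
  rw [h1.deriv, h2.deriv]

section Product

variable {V : Type*} [NormedAddCommGroup V] [InnerProductSpace ℝ V]

lemma locallyIntegrable_inner {v : ℝ → V} (hv : LocallyIntegrable v) (c : V) :
    LocallyIntegrable fun t => inner ℝ c (v t) := by
  intro t
  obtain ⟨s, hs, h⟩ := hv t
  exact ⟨s, hs, (innerSL ℝ c).integrable_comp h⟩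

lemma continuous_of_primitive {x v : ℝ → V} (hv : LocallyIntegrable v)
    (hx : ∀ a b, x b - x a = ∫ t in a..b, v t) : Continuous x := by
  have : x = fun b => x 0 + ∫ t in (0:ℝ)..b, v t := by
    ext b; rw [← hx]; abel
  rw [this]
  exact continuous_const.add (intervalIntegral.continuous_primitive
    (intervalIntegrable_of_locallyIntegrable hv) 0)

variable [FiniteDimensional ℝ V]

lemma inner_sub_eq_integral {x v : ℝ → V} (hv : LocallyIntegrable v)
    (hx : ∀ a b, x b - x a = ∫ t in a..b, v t) (c : V) (a b : ℝ) :
    inner ℝ c (x b) - inner ℝ c (x a) = ∫ t in a..b, inner ℝ c (v t) := by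
  rw [← inner_sub_right, hx]
  exact (((innerSL ℝ c).intervalIntegral_comp_comm
    (intervalIntegrable_of_locallyIntegrable hv a b))).symm

lemma smul_sub_smul_eq_integral {φ φ' : ℝ → ℝ} (hφ' : LocallyIntegrable φ')
    (hφ : ∀ a b, φ b - φ a = ∫ t in a..b, φ' t) {x v : ℝ → V} (hv : LocallyIntegrable v)
    (hx : ∀ a b, x b - x a = ∫ t in a..b, v t) (a b : ℝ) :
    φ b • x b - φ a • x a = ∫ t in a..b, φ' t • x t + φ t • v t := by
  have hxc := continuous_of_primitive hv hx
  have hφc := continuous_of_primitive hφ' hφ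
  have hi : IntervalIntegrable (fun t => φ' t • x t + φ t • v t) volume a b :=
    ((intervalIntegrable_of_locallyIntegrable hφ' a b).smul_continuousOn hxc.continuousOn).add
      ((intervalIntegrable_of_locallyIntegrable hv a b).continuousOn_smul hφc.continuousOn)
  -- Pairing with a fixed vector c reduces the claim to the scalar product rule.
  refine ext_inner_left ℝ fun c => ?_
  have h := mul_sub_mul_eq_integral hφ' hφ (locallyIntegrable_inner hv c)
    (inner_sub_eq_integral hv hx c) a b
  have h2 := (innerSL ℝ c).intervalIntegral_comp_comm hi
  simp only [innerSL_apply_apply] at h2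
  rw [← h2, inner_sub_right, inner_smul_right, inner_smul_right, h]
  simp_rw [inner_add_right, inner_smul_right]

lemma inner_sub_inner_eq_integral {x v y w : ℝ → V} (hv : LocallyIntegrable v)
    (hx : ∀ a b, x b - x a = ∫ t in a..b, v t) (hw : LocallyIntegrable w)
    (hy : ∀ a b, y b - y a = ∫ t in a..b, w t) (a b : ℝ) :
    inner ℝ (x b) (y b) - inner ℝ (x a) (y a)
      = ∫ t in a..b, inner ℝ (v t) (y t) + inner ℝ (x t) (w t) := by
  have hxc := continuous_of_primitive hv hx
  have hyc := continuous_of_primitive hw hy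
  set e := stdOrthonormalBasis ℝ V
  have hsum : ∀ p q : V, inner ℝ p q = ∑ i, inner ℝ (e i) p * inner ℝ (e i) q := fun p q => by
    rw [← e.sum_inner_mul_inner p q]
    exact Finset.sum_congr rfl fun i _ => by rw [real_inner_comm]
  have hi : ∀ i, IntervalIntegrable (fun t => inner ℝ (e i) (v t) * inner ℝ (e i) (y t)
      + inner ℝ (e i) (x t) * inner ℝ (e i) (w t)) volume a b := fun i =>
    ((intervalIntegrable_of_locallyIntegrable (locallyIntegrable_inner hv (e i)) a b).mul_continuousOn
      (by fun_prop)).add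
    ((intervalIntegrable_of_locallyIntegrable (locallyIntegrable_inner hw (e i)) a b).continuousOn_mul
      (by fun_prop))
  have hint : ∀ t, inner ℝ (v t) (y t) + inner ℝ (x t) (w t)
      = ∑ i, (inner ℝ (e i) (v t) * inner ℝ (e i) (y t)
        + inner ℝ (e i) (x t) * inner ℝ (e i) (w t)) := fun t => by
    rw [hsum (v t), hsum (x t), Finset.sum_add_distrib]
  rw [hsum (x b), hsum (x a), ← Finset.sum_sub_distrib, intervalIntegral.integral_congr
    (fun t _ => hint t), intervalIntegral.integral_finsetSum fun i _ => hi i]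
  exact Finset.sum_congr rfl fun i _ =>
    mul_sub_mul_eq_integral (locallyIntegrable_inner hv _) (inner_sub_eq_integral hv hx _)
      (locallyIntegrable_inner hw _) (inner_sub_eq_integral hw hy _) a b

end Product

/-! ## Elements of `H¹` are primitives of their weak derivatives -/

section DuBoisReymond

variable {V : Type*} [NormedAddCommGroup V] [InnerProductSpace ℝ V] [FiniteDimensional ℝ V]

lemma exists_support_subset_Ioc {φ : ℝ → ℝ} (hc : HasCompactSupport φ) :
    ∃ R : ℝ, 0 < R ∧ tsupport φ ⊆ Ioo (-R) R := by
  obtain ⟨R, hR⟩ := hc.isCompact.isBounded.subset_ball (0 : ℝ)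
  refine ⟨max R 1, by positivity, hR.trans ?_⟩
  rw [Real.ball_eq_Ioo]
  intro t ht
  simp only [zero_sub, zero_add, mem_Ioo] at ht
  exact ⟨by have := le_max_left R 1; linarith, ht.2.trans_le (le_max_left _ _)⟩

/-- Integration by parts against a test function. -/
lemma integral_deriv_smul_eq_neg {x v : ℝ → V} (hv : LocallyIntegrable v)
    (hx : ∀ a b, x b - x a = ∫ t in a..b, v t) {φ : ℝ → ℝ} (hφ : ContDiff ℝ ∞ φ)
    (hc : HasCompactSupport φ) : ∫ t, deriv φ t • x t = - ∫ t, φ t • v t := by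
  have hxc := continuous_of_primitive hv hx
  have hd : Continuous (deriv φ) := hφ.continuous_deriv (by simp)
  obtain ⟨R, hR, hsupp⟩ := exists_support_subset_Ioc hc
  have hφd : ∀ a b, φ b - φ a = ∫ t in a..b, deriv φ t := fun a b =>
    (intervalIntegral.integral_deriv_eq_sub
      (fun t _ => (hφ.differentiable (by simp)) t) (hd.intervalIntegrable _ _)).symm
  have h := smul_sub_smul_eq_integral hd.locallyIntegrable hφd hv hx (-R) R
  have hz : ∀ t, t ∉ Ioo (-R) R → φ t = 0 := fun t ht =>
    image_eq_zero_of_notMem_tsupport fun h => ht (hsupp h)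
  have hz' : ∀ t, t ∉ Ioo (-R) R → deriv φ t = 0 := fun t ht =>
    image_eq_zero_of_notMem_tsupport fun h => ht (hsupp (tsupport_deriv_subset h))
  rw [hz R (by simp), hz (-R) (by simp), intervalIntegral.integral_eq_integral_of_support_subset]
    at h
  · have h1 : Integrable fun t => deriv φ t • x t :=
      (hd.smul hxc).integrable_of_hasCompactSupport (hc.deriv.smul_right)
    have h2 : Integrable fun t => φ t • v t :=
      hv.integrable_smul_left_of_hasCompactSupport hφ.continuous hc
    rw [integral_add h1 h2] at h
    simp only [zero_smul, sub_self] at h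
    exact eq_neg_of_add_eq_zero_left h.symm
  · intro t ht
    by_contra hne
    have hne' : t ∉ Ioo (-R) R := fun h' => hne ⟨h'.1, h'.2.le⟩
    simp [hz t hne', hz' t hne'] at ht

lemma exists_test_function_integral_one :
    ∃ ψ : ℝ → ℝ, ContDiff ℝ ∞ ψ ∧ HasCompactSupport ψ ∧ ∫ t, ψ t = 1 := by
  let f : ContDiffBump (0 : ℝ) := ⟨1, 2, one_pos, one_lt_two⟩
  exact ⟨f.normed volume, f.contDiff_normed, f.hasCompactSupport_normed, f.integral_normed⟩

/-- A test function with vanishing integral is the derivative of a test function. -/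
lemma exists_deriv_eq_of_integral_eq_zero {η : ℝ → ℝ} (hη : ContDiff ℝ ∞ η)
    (hc : HasCompactSupport η) (h0 : ∫ t, η t = 0) :
    ∃ φ : ℝ → ℝ, ContDiff ℝ ∞ φ ∧ HasCompactSupport φ ∧ deriv φ = η := by
  obtain ⟨R, hR, hsupp⟩ := exists_support_subset_Ioc hc
  have hz : ∀ t, t ∉ Ioo (-R) R → η t = 0 := fun t ht =>
    image_eq_zero_of_notMem_tsupport fun h => ht (hsupp h)
  set φ : ℝ → ℝ := fun t => ∫ s in (-R)..t, η s
  have hder : ∀ t, HasDerivAt φ (η t) t := fun t =>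
    intervalIntegral.integral_hasDerivAt_right (hη.continuous.intervalIntegrable _ _)
      (hη.continuous.stronglyMeasurableAtFilter _ _) hη.continuous.continuousAt
  have hdφ : deriv φ = η := funext fun t => (hder t).deriv
  refine ⟨φ, ?_, ?_, hdφ⟩
  · rw [contDiff_infty_iff_deriv, hdφ]
    exact ⟨fun t => (hder t).differentiableAt, hη⟩
  · refine HasCompactSupport.intro (isCompact_Icc (a := -R) (b := R)) fun t ht => ?_
    rcases lt_or_ge t (-R) with h | h
    · refine (intervalIntegral.integral_congr (g := fun _ => (0:ℝ)) fun s hs => ?_).trans (by simp)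
      rw [uIcc_of_ge h.le] at hs
      exact hz s fun h' => not_lt.2 hs.2 h'.1
    · have hRt : R < t := by
        by_contra h'
        exact ht ⟨h, not_lt.1 h'⟩
      change ∫ s in (-R)..t, η s = 0
      rw [intervalIntegral.integral_eq_integral_of_support_subset, h0]
      intro s hs
      by_contra hne
      refine hs (hz s fun h' => hne ⟨h'.1, (h'.2.trans hRt).le⟩)

/-- The lemma of du Bois-Reymond. -/
lemma exists_primitive_of_weakDeriv {u v : ℝ → V} (hu : LocallyIntegrable u)
    (hv : LocallyIntegrable v)
    (h : ∀ φ : ℝ → ℝ, ContDiff ℝ ∞ φ → HasCompactSupport φ →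
      ∫ t, deriv φ t • u t = - ∫ t, φ t • v t) :
    ∃ x : ℝ → V, (∀ a b, x b - x a = ∫ t in a..b, v t) ∧ u =ᵐ[volume] x := by
  set w : ℝ → V := fun t => ∫ s in (0:ℝ)..t, v s
  have hw : ∀ a b, w b - w a = ∫ t in a..b, v t := fun a b =>
    intervalIntegral.integral_interval_sub_left (intervalIntegrable_of_locallyIntegrable hv _ _)
      (intervalIntegrable_of_locallyIntegrable hv _ _)
  have hwl : LocallyIntegrable w := (continuous_of_primitive hv hw).locallyIntegrable
  have hd : LocallyIntegrable (u - w) := hu.sub hwl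
  have hint : ∀ {z : ℝ → V}, LocallyIntegrable z → ∀ {φ : ℝ → ℝ}, ContDiff ℝ ∞ φ →
      HasCompactSupport φ → Integrable fun t => φ t • z t := fun hz _ hφ hc =>
    hz.integrable_smul_left_of_hasCompactSupport hφ.continuous hc
  -- The difference u - w has weak derivative 0, so it remains to see that it is almost everywhere
  -- constant.
  have hzero : ∀ φ : ℝ → ℝ, ContDiff ℝ ∞ φ → HasCompactSupport φ →
      ∫ t, deriv φ t • (u - w) t = 0 := by
    intro φ hφ hc
    have hφ' : ContDiff ℝ ∞ (deriv φ) := (contDiff_infty_iff_deriv.1 hφ).2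
    simp only [Pi.sub_apply, smul_sub]
    rw [integral_sub (hint hu hφ' hc.deriv) (hint hwl hφ' hc.deriv), h φ hφ hc,
      integral_deriv_smul_eq_neg hv hw hφ hc, sub_self]
  obtain ⟨ψ, hψ, hψc, hψ1⟩ := exists_test_function_integral_one
  set c : V := ∫ t, ψ t • (u - w) t
  have hconst : ∀ᵐ t, (u - w) t = c := by
    refine ae_eq_of_integral_contDiff_smul_eq hd (locallyIntegrable_const c) fun φ hφ hc => ?_
    have hφi : Integrable φ := hφ.continuous.integrable_of_hasCompactSupport hc
    have hψi : Integrable ψ := hψ.continuous.integrable_of_hasCompactSupport hψc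
    -- Subtracting (∫ φ) ψ makes the integral vanish; the corrected test function is a derivative,
    -- on which u - w integrates to 0.
    obtain ⟨Φ, hΦ, hΦc, hΦd⟩ := exists_deriv_eq_of_integral_eq_zero
      (η := fun t => φ t - (∫ s, φ s) * ψ t) (hφ.sub (contDiff_const.mul hψ))
      (hc.sub hψc.mul_left) (by
        rw [integral_sub hφi (hψi.const_mul _), integral_const_mul, hψ1]; ring)
    have h1 := hzero Φ hΦ hΦc
    rw [hΦd] at h1
    simp only [sub_smul, mul_smul] at h1
    have h2 : Integrable fun t => (∫ s, φ s) • ψ t • (u - w) t := (hint hd hψ hψc).smul _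
    rw [integral_sub (hint hd hφ hc) h2, integral_smul] at h1
    rw [integral_smul_const]
    exact sub_eq_zero.1 h1
  refine ⟨fun t => w t + c, fun a b => by rw [← hw a b, add_sub_add_right_eq_sub], ?_⟩
  filter_upwards [hconst] with t ht
  rw [← ht]
  simp

end DuBoisReymond

/-! ### Translation between `H1` and pairs of functions -/

section Bridge

variable {N : ℕ}

lemma H1.exists_pair (u : H1 N) :
    ∃ x : ℝ → PhaseSpace N, IsSobolevPair x u.weakDeriv ∧ u.toL2 =ᵐ[volume] x := by
  have h1 := Lp.memLp u.toL2
  have h2 := Lp.memLp u.weakDeriv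
  obtain ⟨x, hx, hux⟩ := exists_primitive_of_weakDeriv (h1.locallyIntegrable (by norm_num))
    (h2.locallyIntegrable (by norm_num)) u.2
  exact ⟨x, ⟨h1.ae_eq hux, h2, hx⟩, hux⟩

lemma IsSobolevPair.exists_H1 {x v : ℝ → PhaseSpace N} (h : IsSobolevPair x v) :
    ∃ u : H1 N, u.toL2 = h.memLp.toLp x ∧ u.weakDeriv = h.memLp_deriv.toLp v := by
  refine ⟨⟨WithLp.toLp 2 (h.memLp.toLp x, h.memLp_deriv.toLp v), fun φ hφ hc => ?_⟩, rfl, rfl⟩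
  have h1 : ∫ t, deriv φ t • (h.memLp.toLp x) t = ∫ t, deriv φ t • x t :=
    integral_congr_ae (by filter_upwards [h.memLp.coeFn_toLp] with t ht; rw [ht])
  have h2 : ∫ t, φ t • (h.memLp_deriv.toLp v) t = ∫ t, φ t • v t :=
    integral_congr_ae (by filter_upwards [h.memLp_deriv.coeFn_toLp] with t ht; rw [ht])
  change ∫ t, deriv φ t • (h.memLp.toLp x) t = -∫ t, φ t • (h.memLp_deriv.toLp v) t
  rw [h1, h2]
  exact integral_deriv_smul_eq_neg (h.memLp_deriv.locallyIntegrable (by norm_num)) h.sub_eq hφ hc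

/-- The continuous representative of an element of `H¹`. -/
def H1.rep (u : H1 N) : ℝ → PhaseSpace N := u.exists_pair.choose

lemma H1.isSobolevPair (u : H1 N) : IsSobolevPair u.rep u.weakDeriv :=
  u.exists_pair.choose_spec.1

lemma H1.toL2_ae_eq (u : H1 N) : u.toL2 =ᵐ[volume] u.rep :=
  u.exists_pair.choose_spec.2

lemma H1.norm_sq (u : H1 N) : ‖u‖ ^ 2 = ‖u.toL2‖ ^ 2 + ‖u.weakDeriv‖ ^ 2 := by
  exact WithLp.prod_norm_sq_eq_of_L2 u.1

/-- The embedding `H¹ → L²`. -/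
def H1.toL2L (N : ℕ) : H1 N →L[ℝ] L2 N :=
  (WithLp.fstL 2 ℝ (L2 N) (L2 N)).comp (sobolevSubmodule N).subtypeL

/-- Weak differentiation as a bounded operator `H¹ → L²`. -/
def H1.derivL (N : ℕ) : H1 N →L[ℝ] L2 N :=
  (WithLp.sndL 2 ℝ (L2 N) (L2 N)).comp (sobolevSubmodule N).subtypeL

end Bridge

/-! ## Global solutions of linear differential equations with bounded coefficients -/

section LinearODE

variable {E : Type*} [NormedAddCommGroup E] [NormedSpace ℝ E] [CompleteSpace E]

/-- Picard iteration on the whole line at once. With y = ρ z and the weight ρ(t) = cosh(2Kt), the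
integral equation becomes a fixed point problem for bounded continuous z, and its right-hand side is
a contraction of constant 1/2. The weight grows in both time directions and has an explicit
primitive. -/
lemma exists_forall_hasDerivAt_linear {C : ℝ → E →L[ℝ] E} (hC : Continuous C) {K : ℝ}
    (hK : 0 < K) (hCK : ∀ t, ‖C t‖ ≤ K) (x₀ : E) :
    ∃ y : ℝ → E, y 0 = x₀ ∧ ∀ t, HasDerivAt y (C t (y t)) t := by
  -- The contraction constant will be K / L = 1/2.
  set L := 2 * K
  set ρ : ℝ → ℝ := fun t => Real.cosh (L * t)
  have hρ : ∀ t, 0 < ρ t := fun t => Real.cosh_pos _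
  have hρc : Continuous ρ := Real.continuous_cosh.comp (by fun_prop)
  have hρint : ∀ t, ∫ s in (0:ℝ)..t, ρ s = Real.sinh (L * t) / L := by
    intro t
    have h := intervalIntegral.integral_eq_sub_of_hasDerivAt (a := 0) (b := t)
      (f := fun s => Real.sinh (L * s) / L) (f' := ρ) (fun s _ => by
        have := ((hasDerivAt_id s).const_mul L).sinh.div_const L
        refine this.congr_deriv ?_
        simp only [ρ, id]
        field_simp
        exact div_self (by positivity)) (hρc.intervalIntegrable _ _)
    rw [h]; simp
  set g : (ℝ → E) → ℝ → E := fun z t => x₀ + ∫ s in (0:ℝ)..t, C s (ρ s • z s)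
  have hgc : ∀ {z : ℝ → E}, Continuous z → Continuous fun s => C s (ρ s • z s) := fun hz =>
    hC.clm_apply (hρc.smul hz)
  have hgd : ∀ {z : ℝ → E}, Continuous z → ∀ t, HasDerivAt (g z) (C t (ρ t • z t)) t :=
    fun hz t => (intervalIntegral.integral_hasDerivAt_right ((hgc hz).intervalIntegrable _ _)
      ((hgc hz).stronglyMeasurableAtFilter _ _) (hgc hz).continuousAt).const_add _
  have hbound : ∀ {z : ℝ → E} {R : ℝ}, 0 ≤ R → (∀ t, ‖z t‖ ≤ R) → ∀ t,
      ‖∫ s in (0:ℝ)..t, C s (ρ s • z s)‖ ≤ ρ t * (R / 2) := by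
    intro z R hR hz t
    have h1 : ‖∫ s in (0:ℝ)..t, C s (ρ s • z s)‖ ≤ |∫ s in (0:ℝ)..t, (K * R) * ρ s| := by
      refine intervalIntegral.norm_integral_le_abs_of_norm_le (.of_forall fun s => ?_)
        ((hρc.const_smul (K * R)).intervalIntegrable _ _)
      calc ‖C s (ρ s • z s)‖ ≤ K * (ρ s * R) := by
            refine (C s).le_of_opNorm_le_of_le (hCK s) ?_
            rw [norm_smul, Real.norm_of_nonneg (hρ s).le]
            exact mul_le_mul_of_nonneg_left (hz s) (hρ s).le
        _ = K * R * ρ s := by ring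
    refine h1.trans ?_
    rw [intervalIntegral.integral_const_mul, hρint, abs_mul, abs_of_nonneg (by positivity),
      abs_div, abs_of_pos (by positivity : 0 < L)]
    have h2 : |Real.sinh (L * t)| ≤ ρ t := by
      rw [Real.abs_sinh]
      exact (Real.sinh_lt_cosh _).le.trans_eq (Real.cosh_abs _)
    calc K * R * (|Real.sinh (L * t)| / L) ≤ K * R * (ρ t / L) := by gcongr
      _ = ρ t * (R / 2) := by simp only [L]; field_simp
  let U : BoundedContinuousFunction ℝ E → BoundedContinuousFunction ℝ E := fun z =>
    BoundedContinuousFunction.ofNormedAddCommGroup (fun t => (ρ t)⁻¹ • g z t)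
      ((hρc.inv₀ fun t => (hρ t).ne').smul
        (continuous_iff_continuousAt.2 fun t => (hgd z.continuous t).continuousAt))
      (‖x₀‖ + ‖z‖ / 2) (fun t => by
        rw [norm_smul, norm_inv, Real.norm_of_nonneg (hρ t).le, inv_mul_le_iff₀ (hρ t), mul_add]
        refine (norm_add_le _ _).trans (add_le_add ?_
          (hbound (norm_nonneg z) z.norm_coe_le_norm t))
        exact le_mul_of_one_le_left (norm_nonneg _) (Real.one_le_cosh _))
  have hU : ContractingWith (1 / 2) U := by
    refine ⟨by norm_num, LipschitzWith.of_dist_le_mul fun z w => ?_⟩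
    rw [BoundedContinuousFunction.dist_le (by positivity)]
    intro t
    have h1 : U z t - U w t = (ρ t)⁻¹ • ∫ s in (0:ℝ)..t, C s (ρ s • (z - w) s) := by
      change (ρ t)⁻¹ • g z t - (ρ t)⁻¹ • g w t = _
      rw [← smul_sub]
      simp only [g, add_sub_add_left_eq_sub]
      rw [← intervalIntegral.integral_sub ((hgc z.continuous).intervalIntegrable _ _)
        ((hgc w.continuous).intervalIntegrable _ _)]
      simp [smul_sub]
    rw [dist_eq_norm, h1, norm_smul, norm_inv, Real.norm_of_nonneg (hρ t).le,
      inv_mul_le_iff₀ (hρ t), dist_eq_norm]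
    refine (hbound (norm_nonneg (z - w)) (z - w).norm_coe_le_norm t).trans (le_of_eq ?_)
    rw [NNReal.coe_div]
    simp only [NNReal.coe_one, NNReal.coe_ofNat]
    ring
  set z := hU.fixedPoint U
  have hz : U z = z := hU.fixedPoint_isFixedPt
  have hzg : ∀ t, ρ t • z t = g z t := fun t => by
    conv_lhs => rw [← hz]
    exact smul_inv_smul₀ (hρ t).ne' _
  refine ⟨g z, by simp [g], fun t => ?_⟩
  rw [← hzg t]
  exact hgd z.continuous t

/-- Gronwall's inequality in integral form. -/
lemma le_mul_exp_of_le_add_integral {f : ℝ → ℝ} (hf : Continuous f) {c K T : ℝ}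
    (hK : 0 ≤ K) (hf0 : ∀ s, 0 ≤ f s)
    (h : ∀ s ∈ Icc 0 T, f s ≤ c + K * ∫ r in (0:ℝ)..s, f r) :
    ∀ s ∈ Icc 0 T, f s ≤ c * Real.exp (K * s) := by
  intro s hs
  have hc : 0 ≤ c := by
    have := h 0 ⟨le_rfl, hs.1.trans hs.2⟩
    simp at this
    exact (hf0 0).trans this
  -- The majorant D is differentiable although f need not be, and D' = K f ≤ K D, so the
  -- differential Gronwall bound applies to D.
  set D : ℝ → ℝ := fun s => c + K * ∫ r in (0:ℝ)..s, f r
  have hD : ∀ s, HasDerivAt D (K * f s) s := fun s =>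
    ((intervalIntegral.integral_hasDerivAt_right (hf.intervalIntegrable _ _)
      (hf.stronglyMeasurableAtFilter _ _) hf.continuousAt).const_mul K).const_add c
  have h1 := norm_le_gronwallBound_of_norm_deriv_right_le (f := D) (f' := fun s => K * f s)
    (δ := c) (K := K) (ε := 0) (a := 0) (b := T)
    (fun s _ => (hD s).continuousAt.continuousWithinAt) (fun s _ => (hD s).hasDerivWithinAt)
    (by simp [D, abs_of_nonneg hc]) (fun s hs => by
      rw [Real.norm_of_nonneg (mul_nonneg hK (hf0 s)), add_zero]
      exact mul_le_mul_of_nonneg_left ((h s ⟨hs.1, hs.2.le⟩).trans (le_abs_self _)) hK) s hs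
  rw [gronwallBound_ε0, sub_zero] at h1
  exact (h s hs).trans ((le_abs_self _).trans h1)

end LinearODE

/-! ## The shift on `ℓ²(ℤ)` -/

section Shift

open Polynomial

variable {X : Type*} [NormedAddCommGroup X] [NormedSpace ℂ X]

/-- For an isometry ‖S y - r y‖ ≥ |1 - ‖r‖| ‖y‖, and lower bounds multiply under composition. -/
lemma exists_pos_mul_norm_le_aeval_prod {S : X →L[ℂ] X} (hS : ∀ x, ‖S x‖ = ‖x‖)
    (s : Multiset ℂ) (hs : ∀ r ∈ s, ‖r‖ ≠ 1) :
    ∃ c : ℝ, 0 < c ∧ ∀ x, c * ‖x‖ ≤ ‖aeval S (s.map fun r => (Polynomial.X - C r)).prod x‖ := by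
  induction s using Multiset.induction_on with
  | empty => exact ⟨1, one_pos, fun x => by simp⟩
  | cons r s ih =>
    obtain ⟨c, hc, h⟩ := ih fun q hq => hs q (Multiset.mem_cons_of_mem hq)
    have hr : 0 < |1 - ‖r‖| :=
      abs_pos.2 (sub_ne_zero.2 (hs r (Multiset.mem_cons_self r s)).symm)
    refine ⟨|1 - ‖r‖| * c, by positivity, fun x => ?_⟩
    rw [Multiset.map_cons, Multiset.prod_cons, map_mul]
    set y := aeval S (s.map fun r => (Polynomial.X - C r)).prod x
    have h1 : |1 - ‖r‖| * ‖y‖ ≤ ‖S y - r • y‖ := by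
      have := abs_norm_sub_norm_le (S y) (r • y)
      rw [hS, norm_smul] at this
      calc |1 - ‖r‖| * ‖y‖ = |‖y‖ - ‖r‖ * ‖y‖| := by
            rw [← abs_of_nonneg (norm_nonneg y), ← abs_mul, abs_of_nonneg (norm_nonneg y)]
            ring_nf
        _ ≤ _ := this
    calc |1 - ‖r‖| * c * ‖x‖ ≤ |1 - ‖r‖| * ‖y‖ := by
          rw [mul_assoc]; exact mul_le_mul_of_nonneg_left (h x) (abs_nonneg _)
      _ ≤ ‖S y - r • y‖ := h1
      _ = _ := by simp [y, Algebra.algebraMap_eq_smul_one]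

/-- `S - M` is bounded below on `Xⁿ` if `S` is an isometry and `M` is a matrix without eigenvalues
on the unit circle. -/
lemma exists_norm_le_mul_sum_norm_sub {n : Type*} [Fintype n] [DecidableEq n] {S : X →L[ℂ] X}
    (hS : ∀ x, ‖S x‖ = ‖x‖) (M : Matrix n n ℂ) (hM : ∀ r, M.charpoly.IsRoot r → ‖r‖ ≠ 1) :
    ∃ c : ℝ, 0 ≤ c ∧ ∀ (v : n → X) (i : n), ‖v i‖ ≤ c * ∑ j, ‖S (v j) - ∑ k, M j k • v k‖ := by
  obtain ⟨c, hc, h⟩ := exists_pos_mul_norm_le_aeval_prod hS M.charpoly.roots fun r hr =>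
    hM r (isRoot_of_mem_roots hr)
  have hprod : (M.charpoly.roots.map fun r => (Polynomial.X - C r)).prod = M.charpoly :=
    (IsAlgClosed.splits M.charpoly).eq_prod_roots_of_monic (Matrix.charpoly_monic M) |>.symm
  rw [hprod] at h
  set A := M.charmatrix.adjugate
  set c' : ℝ := ∑ i, ∑ j, ‖aeval S (A i j)‖
  have hc' : ∀ i j, ‖aeval S (A i j)‖ ≤ c' := fun i j =>
    (Finset.single_le_sum (f := fun j => ‖aeval S (A i j)‖) (fun _ _ => norm_nonneg _)
      (Finset.mem_univ j)).trans
      (Finset.single_le_sum (f := fun i => ∑ j, ‖aeval S (A i j)‖)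
        (fun _ _ => Finset.sum_nonneg fun _ _ => norm_nonneg _) (Finset.mem_univ i))
  have hc'0 : 0 ≤ c' := Finset.sum_nonneg fun _ _ => Finset.sum_nonneg fun _ _ => norm_nonneg _
  refine ⟨c⁻¹ * c', by positivity, fun v i => ?_⟩
  -- On Xⁿ the operator S - M is the characteristic matrix of M with S substituted for the variable.
  -- Multiplying by its adjugate leaves the scalar operator χ_M(S), which is bounded below by the
  -- factorization.
  have hb : ∀ j, S (v j) - ∑ k, M j k • v k = ∑ k, aeval S (M.charmatrix j k) (v k) := by
    intro j
    have : ∀ k, aeval S (M.charmatrix j k) (v k)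
        = (if j = k then S (v k) else 0) - M j k • v k := by
      intro k
      rw [Matrix.charmatrix_apply]
      by_cases hjk : j = k
      · simp [hjk, Algebra.algebraMap_eq_smul_one]
      · simp [hjk, Algebra.algebraMap_eq_smul_one]
    simp_rw [this, Finset.sum_sub_distrib]
    simp
  have hsum : ∑ j, aeval S (A i j) (S (v j) - ∑ k, M j k • v k) = aeval S M.charpoly (v i) := by
    simp_rw [hb, map_sum]
    rw [Finset.sum_comm]
    have h1 : ∀ k, ∑ j, aeval S (A i j) (aeval S (M.charmatrix j k) (v k))
        = aeval S ((A * M.charmatrix) i k) (v k) := by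
      intro k
      rw [Matrix.mul_apply, map_sum, _root_.sum_apply]
      simp
    simp_rw [h1]
    rw [Matrix.adjugate_mul]
    rw [Finset.sum_eq_single i]
    · simp [Matrix.charpoly]
    · intro k _ hk
      simp [Matrix.smul_apply, Matrix.one_apply_ne hk.symm]
    · simp
  have h2 : c * ‖v i‖ ≤ c' * ∑ j, ‖S (v j) - ∑ k, M j k • v k‖ := by
    refine (h (v i)).trans ?_
    rw [← hsum, Finset.mul_sum]
    refine (norm_sum_le _ _).trans (Finset.sum_le_sum fun j _ => ?_)
    exact (aeval S (A i j)).le_of_opNorm_le (hc' i j) _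
  rw [mul_assoc]
  rw [le_inv_mul_iff₀ hc]
  exact h2

/-- The shift on `ℓ²(ℤ)`. -/
lemma exists_shift : ∃ S : lp (fun _ : ℤ => ℂ) 2 →L[ℂ] lp (fun _ : ℤ => ℂ) 2,
    (∀ x k, S x k = x (k + 1)) ∧ ∀ x, ‖S x‖ = ‖x‖ := by
  have hmem : ∀ x : lp (fun _ : ℤ => ℂ) 2, Memℓp (fun k : ℤ => x (k + 1)) 2 := fun x => by
    have h := (memℓp_gen_iff (by norm_num)).1 (lp.memℓp x)
    exact (memℓp_gen_iff (by norm_num)).2 ((Equiv.addRight (1:ℤ)).summable_iff.2 h)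
  have hnorm : ∀ x : lp (fun _ : ℤ => ℂ) 2,
      ‖(⟨_, hmem x⟩ : lp (fun _ : ℤ => ℂ) 2)‖ = ‖x‖ := fun x => by
    have h2 : (0:ℝ) < (2 : ENNReal).toReal := by norm_num
    rw [lp.norm_eq_tsum_rpow h2, lp.norm_eq_tsum_rpow h2]
    congr 1
    exact (Equiv.addRight (1:ℤ)).tsum_eq fun k => ‖x k‖ ^ (2 : ENNReal).toReal
  let S₀ : lp (fun _ : ℤ => ℂ) 2 →ₗ[ℂ] lp (fun _ : ℤ => ℂ) 2 :=
    { toFun := fun x => ⟨_, hmem x⟩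
      map_add' := fun x y => rfl
      map_smul' := fun c x => rfl }
  exact ⟨S₀.mkContinuous 1 fun x => by rw [one_mul]; exact (hnorm x).le, fun x k => rfl, hnorm⟩

variable {V : Type*} [NormedAddCommGroup V] [InnerProductSpace ℝ V] [FiniteDimensional ℝ V]

/-- A hyperbolic linear recursion is uniquely solvable in `ℓ²`, with an estimate. -/
lemma exists_tsum_norm_sq_le (M : V →L[ℝ] V)
    (hM : ∀ r : ℂ, ((M : V →ₗ[ℝ] V).charpoly.map (algebraMap ℝ ℂ)).IsRoot r → ‖r‖ ≠ 1) :
    ∃ c : ℝ, 0 ≤ c ∧ ∀ v : ℤ → V, Summable (fun k => ‖v k‖ ^ 2) →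
      Summable (fun k => ‖v (k + 1) - M (v k)‖ ^ 2) →
      ∑' k, ‖v k‖ ^ 2 ≤ c * ∑' k, ‖v (k + 1) - M (v k)‖ ^ 2 := by
  classical
  obtain ⟨S, hSa, hSn⟩ := exists_shift
  set e := stdOrthonormalBasis ℝ V
  set Mr := LinearMap.toMatrix e.toBasis e.toBasis (M : V →ₗ[ℝ] V)
  obtain ⟨c, hc, h⟩ := exists_norm_le_mul_sum_norm_sub hSn (Mr.map (algebraMap ℝ ℂ)) (by
    intro r hr
    rw [Matrix.charpoly_map, LinearMap.charpoly_toMatrix] at hr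
    exact hM r hr)
  set n : ℝ := (Module.finrank ℝ V : ℝ)
  -- The inner n bounds the sum over the coordinates of the error, the outer one sums over the
  -- coordinates of v.
  refine ⟨n * (c * n) ^ 2, by positivity, fun v hv hb => ?_⟩
  have hcoord : ∀ (u : ℤ → V), Summable (fun k => ‖u k‖ ^ 2) → ∀ i,
      Summable fun k => ‖((inner ℝ (e i) (u k) : ℝ) : ℂ)‖ ^ 2 := fun u hu i =>
    hu.of_nonneg_of_le (fun k => by positivity) fun k => by
      rw [Complex.norm_real]
      gcongr
      simpa using norm_inner_le_norm (𝕜 := ℝ) (e i) (u k)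
  have hmem : ∀ (u : ℤ → V), Summable (fun k => ‖u k‖ ^ 2) → ∀ i,
      Memℓp (fun k => ((inner ℝ (e i) (u k) : ℝ) : ℂ)) 2 := fun u hu i =>
    (memℓp_gen_iff (by norm_num)).2 (by simpa using hcoord u hu i)
  have hnorm : ∀ (u : ℤ → V) (hu : Summable fun k => ‖u k‖ ^ 2) (i),
      ‖(⟨_, hmem u hu i⟩ : lp (fun _ : ℤ => ℂ) 2)‖ ^ 2 = ∑' k, ‖(inner ℝ (e i) (u k) : ℝ)‖ ^ 2 := by
    intro u hu i
    have h2 : (0:ℝ) < (2 : ENNReal).toReal := by norm_num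
    have := lp.norm_rpow_eq_tsum h2 (⟨_, hmem u hu i⟩ : lp (fun _ : ℤ => ℂ) 2)
    simpa using this
  set b : ℤ → V := fun k => v (k + 1) - M (v k)
  set Q := ∑' k, ‖b k‖ ^ 2
  have hQ : 0 ≤ Q := tsum_nonneg fun k => by positivity
  let x : Fin (Module.finrank ℝ V) → lp (fun _ : ℤ => ℂ) 2 := fun i => ⟨_, hmem v hv i⟩
  -- Coordinates in an orthonormal basis, complexified, turn v into a vector of elements of ℓ²(ℤ, ℂ)
  -- on which the recursion error is S - M.
  have hx : ∀ j, S (x j) - ∑ k, (Mr.map (algebraMap ℝ ℂ)) j k • x k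
      = ⟨_, hmem b hb j⟩ := by
    intro j
    ext k
    have h1 : inner ℝ (e j) (M (v k)) = ∑ i, Mr j i * inner ℝ (e i) (v k) := by
      have := congrFun (LinearMap.toMatrix_mulVec_repr e.toBasis e.toBasis (M : V →ₗ[ℝ] V) (v k)) j
      simp [Matrix.mulVec, dotProduct, OrthonormalBasis.repr_apply_apply] at this
      exact this.symm
    have h2 : (∑ i, (Mr.map (algebraMap ℝ ℂ)) j i • x i : lp (fun _ : ℤ => ℂ) 2) k
        = ((∑ i, Mr j i * inner ℝ (e i) (v k) : ℝ) : ℂ) := by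
      rw [lp.coeFn_sum, Finset.sum_apply, Complex.ofReal_sum]
      refine Finset.sum_congr rfl fun i _ => ?_
      rw [Complex.ofReal_mul]
      rfl
    rw [lp.coeFn_sub, Pi.sub_apply, hSa, h2, ← h1]
    simp [x, b, inner_sub_right]
  have hbn : ∀ j, ‖(⟨_, hmem b hb j⟩ : lp (fun _ : ℤ => ℂ) 2)‖ ≤ √Q := by
    intro j
    refine Real.le_sqrt_of_sq_le ?_
    rw [hnorm b hb j]
    refine Summable.tsum_le_tsum (fun k => ?_) (by simpa using hcoord b hb j) hb
    gcongr
    simpa using norm_inner_le_norm (𝕜 := ℝ) (e j) (b k)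
  have hxn : ∀ i, ‖x i‖ ^ 2 ≤ (c * n) ^ 2 * Q := by
    intro i
    have h1 := h x i
    have h2 : ∑ j, ‖S (x j) - ∑ k, (Mr.map (algebraMap ℝ ℂ)) j k • x k‖ ≤ n * √Q := by
      refine (Finset.sum_le_card_nsmul _ _ (√Q) fun j _ => ?_).trans (by simp [n])
      rw [hx j]
      exact hbn j
    have h3 : ‖x i‖ ≤ c * (n * √Q) := h1.trans (mul_le_mul_of_nonneg_left h2 hc)
    calc ‖x i‖ ^ 2 ≤ (c * (n * √Q)) ^ 2 := by gcongr
      _ = (c * n) ^ 2 * √Q ^ 2 := by ring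
      _ = _ := by rw [Real.sq_sqrt hQ]
  have hvsum : ∑' k, ‖v k‖ ^ 2 = ∑ i, ‖x i‖ ^ 2 := by
    simp_rw [x, hnorm v hv]
    rw [← Summable.tsum_finsetSum fun i _ => by simpa using hcoord v hv i]
    exact tsum_congr fun k => (e.sum_sq_norm_inner_right (v k)).symm
  rw [hvsum]
  refine (Finset.sum_le_card_nsmul _ _ ((c * n) ^ 2 * Q) fun i _ => hxn i).trans (le_of_eq ?_)
  simp [n]
  ring

end Shift

/-! ## The coercivity estimate for periodic linear systems -/

section Periodic

variable {V : Type*} [NormedAddCommGroup V] [InnerProductSpace ℝ V] [FiniteDimensional ℝ V]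

/-- On one period, an approximate solution `w` of `w' = B w` differs little from the exact solution
with the same initial value. -/
lemma norm_sub_fundamental_le {B Φ : ℝ → V →L[ℝ] V} (hB : Continuous B) {K T : ℝ}
    (hK : 0 ≤ K) (hBK : ∀ t, ‖B t‖ ≤ K) (hΦ0 : Φ 0 = ContinuousLinearMap.id ℝ V)
    (hΦ : ∀ t, HasDerivAt Φ ((B t).comp (Φ t)) t) {w v : ℝ → V} (h : IsSobolevPair w v) :
    ∀ s ∈ Icc 0 T, ‖w s - Φ s (w 0)‖ ≤
      (∫ t in (0:ℝ)..T, ‖v t - B t (w t)‖) * Real.exp (K * s) := by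
  have hΦc : Continuous Φ := continuous_iff_continuousAt.2 fun t => (hΦ t).continuousAt
  have hwc := h.continuous
  set d : ℝ → V := fun s => w s - Φ s (w 0)
  have hdc : Continuous d := hwc.sub (hΦc.clm_apply continuous_const)
  set η : ℝ → V := fun t => v t - B t (w t)
  have hηi : ∀ a b, IntervalIntegrable η volume a b := fun a b =>
    (h.intervalIntegrable a b).sub ((hB.clm_apply hwc).intervalIntegrable _ _)
  -- The defect d starts at 0 and solves d' = B d + η in integrated form, so Gronwall bounds it by
  -- the L¹ norm of η.
  have hd : ∀ s, d s = ∫ t in (0:ℝ)..s, (B t (d t) + η t) := by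
    intro s
    have h1 : ∫ t in (0:ℝ)..s, B t (Φ t (w 0)) = Φ s (w 0) - w 0 := by
      have := intervalIntegral.integral_eq_sub_of_hasDerivAt (a := 0) (b := s)
        (f := fun t => Φ t (w 0)) (f' := fun t => B t (Φ t (w 0)))
        (fun t _ => by simpa using (hΦ t).clm_apply (hasDerivAt_const t (w 0)))
        ((hB.clm_apply (hΦc.clm_apply continuous_const)).intervalIntegrable _ _)
      rw [this, hΦ0]; simp
    have h2 : ∀ t, B t (d t) + η t = v t - B t (Φ t (w 0)) := fun t => by
      simp [d, η]
    simp_rw [h2]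
    rw [intervalIntegral.integral_sub (h.intervalIntegrable _ _)
      ((hB.clm_apply (hΦc.clm_apply continuous_const)).intervalIntegrable _ _), h1, ← h.sub_eq]
    simp [d]
  refine le_mul_exp_of_le_add_integral hdc.norm hK (fun s => norm_nonneg _) fun s hs => ?_
  rw [hd s]
  have hdi : IntervalIntegrable (fun t => ‖d t‖) volume 0 s := hdc.norm.intervalIntegrable _ _
  calc ‖∫ t in (0:ℝ)..s, (B t (d t) + η t)‖ ≤ ∫ t in (0:ℝ)..s, (‖η t‖ + K * ‖d t‖) := by
        refine intervalIntegral.norm_integral_le_of_norm_le hs.1 (.of_forall fun t _ => ?_)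
          ((hηi 0 s).norm.add (hdi.const_mul K))
        rw [add_comm]
        exact (norm_add_le _ _).trans (add_le_add le_rfl ((B t).le_of_opNorm_le (hBK t) _))
    _ = (∫ t in (0:ℝ)..s, ‖η t‖) + K * ∫ t in (0:ℝ)..s, ‖d t‖ := by
        rw [intervalIntegral.integral_add (hηi 0 s).norm (hdi.const_mul K),
          intervalIntegral.integral_const_mul]
    _ ≤ _ := by
        gcongr
        exact intervalIntegral.integral_mono_interval le_rfl hs.1 hs.2
          (.of_forall fun t => norm_nonneg _) (hηi 0 T).norm

lemma memLp_clm_apply {B : ℝ → V →L[ℝ] V} (hB : Continuous B) {K : ℝ}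
    (hBK : ∀ t, ‖B t‖ ≤ K) {w : ℝ → V} (hw : MemLp w 2 volume) :
    MemLp (fun t => B t (w t)) 2 volume := by
  refine hw.of_le_mul (c := K) ?_ (.of_forall fun t => (B t).le_of_opNorm_le (hBK t) _)
  exact (ContinuousLinearMap.apply ℝ V).flip.aestronglyMeasurable_comp₂
    hB.aestronglyMeasurable hw.aestronglyMeasurable

lemma exists_bound_of_periodic {B : ℝ → V →L[ℝ] V} (hB : Continuous B) {T : ℝ} (hT : 0 < T)
    (hper : ∀ t, B (t + T) = B t) : ∃ K, 0 < K ∧ ∀ t, ‖B t‖ ≤ K := by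
  have hp : Function.Periodic B T := hper
  obtain ⟨K, hK⟩ := (hp.isBounded_of_continuous hT.ne' hB).exists_norm_le
  exact ⟨max K 1, by positivity, fun t => (hK _ (mem_range_self t)).trans (le_max_left _ _)⟩

/-- If the monodromy operator of the `T`-periodic system `w' = B(t) w` has no eigenvalue on the
unit circle, then `w ↦ w' - B w` is bounded below. -/
lemma exists_coercive_of_monodromy {B Φ : ℝ → V →L[ℝ] V} (hB : Continuous B) {T : ℝ}
    (hT : 0 < T) (hper : ∀ t, B (t + T) = B t) (hΦ0 : Φ 0 = ContinuousLinearMap.id ℝ V)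
    (hΦ : ∀ t, HasDerivAt Φ ((B t).comp (Φ t)) t)
    (hM : ∀ r : ℂ, ((Φ T : V →ₗ[ℝ] V).charpoly.map (algebraMap ℝ ℂ)).IsRoot r → ‖r‖ ≠ 1) :
    ∃ c : ℝ, 0 ≤ c ∧ ∀ w v : ℝ → V, IsSobolevPair w v →
      lpNorm w 2 volume ≤ c * lpNorm (fun t => v t - B t (w t)) 2 volume := by
  obtain ⟨K, hK, hBK⟩ := exists_bound_of_periodic hB hT hper
  obtain ⟨c, hc, hcM⟩ := exists_tsum_norm_sq_le (Φ T) hM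
  have hΦc : Continuous Φ := continuous_iff_continuousAt.2 fun t => (hΦ t).continuousAt
  obtain ⟨P, hP⟩ := isCompact_Icc.exists_bound_of_continuousOn (s := Icc 0 T) hΦc.continuousOn
  set q := Real.exp (K * T)
  -- On one period ‖w‖² is at most twice the square of the exact solution, bounded through P, plus
  -- twice the square of the Gronwall defect, bounded through q; integration over the period gives
  -- a₁ and a₂.
  set a₁ : ℝ := 2 * T * P ^ 2
  set a₂ : ℝ := 2 * T * q ^ 2 * T
  set C : ℝ := a₁ * (c * (q ^ 2 * T)) + a₂
  have hC : 0 ≤ C := by positivity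
  refine ⟨√C, Real.sqrt_nonneg _, fun w v h => ?_⟩
  have hBper : ∀ (k : ℤ) t, B (t + k * T) = B t := fun k t => by
    have hp : Function.Periodic B T := hper
    exact hp.int_mul k t
  set η : ℝ → V := fun t => v t - B t (w t)
  have hη : MemLp η 2 volume := h.memLp_deriv.sub (memLp_clm_apply hB hBK h.memLp)
  set E : ℤ → ℝ := fun k => ∫ t in (k * T)..(k * T + T), ‖η t‖ ^ 2
  have hE : HasSum E (lpNorm η 2 volume ^ 2) := by
    rw [lpNorm_two_sq hη]
    exact hasSum_integral_periods (integrable_sq_norm hη) hT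
  set W : ℤ → ℝ := fun k => ∫ t in (k * T)..(k * T + T), ‖w t‖ ^ 2
  have hW : HasSum W (lpNorm w 2 volume ^ 2) := by
    rw [lpNorm_two_sq h.memLp]
    exact hasSum_integral_periods (integrable_sq_norm h.memLp) hT
  set u : ℤ → V := fun k => w (k * T)
  have hsol : ∀ (k : ℤ), ∀ s ∈ Icc 0 T, ‖w (s + k * T) - Φ s (u k)‖ ^ 2 ≤ q ^ 2 * (T * E k) := by
    intro k s hs
    have h1 := norm_sub_fundamental_le hB hK.le hBK hΦ0 hΦ (h.translate (k * T)) s hs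
    simp only [zero_add] at h1
    have h2 : ∫ t in (0:ℝ)..T, ‖v (t + k * T) - B t (w (t + k * T))‖
        = ∫ t in (k * T)..(k * T + T), ‖η t‖ := by
      have := intervalIntegral.integral_comp_add_right (a := 0) (b := T) (fun t => ‖η t‖) (k * T)
      rw [zero_add, add_comm T] at this
      rw [← this]
      refine intervalIntegral.integral_congr fun t _ => ?_
      simp only [η, hBper k t]
    rw [h2] at h1
    have h3 : (∫ t in (k * T)..(k * T + T), ‖η t‖) ^ 2 ≤ T * E k := by
      simpa using sq_integral_norm_le hη (by linarith : (k : ℝ) * T ≤ k * T + T)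
    have h4 : 0 ≤ ∫ t in (k * T)..(k * T + T), ‖η t‖ :=
      intervalIntegral.integral_nonneg (by linarith) fun t _ => norm_nonneg _
    have h5 : Real.exp (K * s) ≤ q := Real.exp_le_exp.2 (by nlinarith [hs.2])
    calc ‖w (s + k * T) - Φ s (u k)‖ ^ 2
        ≤ ((∫ t in (k * T)..(k * T + T), ‖η t‖) * q) ^ 2 := by
          gcongr
          exact h1.trans (mul_le_mul_of_nonneg_left h5 h4)
      _ = q ^ 2 * (∫ t in (k * T)..(k * T + T), ‖η t‖) ^ 2 := by ring
      _ ≤ _ := by gcongr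
  have hb : ∀ k, ‖u (k + 1) - Φ T (u k)‖ ^ 2 ≤ q ^ 2 * T * E k := by
    intro k
    have := hsol k T ⟨hT.le, le_rfl⟩
    have e : u (k + 1) = w (T + k * T) := by simp [u, add_mul, add_comm]
    rw [e, mul_assoc]
    exact this
  have hbs : Summable fun k => ‖u (k + 1) - Φ T (u k)‖ ^ 2 :=
    (hE.summable.mul_left (q ^ 2 * T)).of_nonneg_of_le (fun k => by positivity) hb
  -- Samples of an H¹ function are square summable by the window bound over each period; the ℓ²
  -- estimate is only available for such sequences.
  have hus : Summable fun k => ‖u k‖ ^ 2 := by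
    have hV := hasSum_integral_periods (integrable_sq_norm h.memLp_deriv) hT
    refine ((hW.summable.mul_left (2 / T)).add (hV.summable.mul_left (2 * T))).of_nonneg_of_le
      (fun k => by positivity) fun k => h.norm_sq_le_window hT _
  have hbt : ∑' k, ‖u (k + 1) - Φ T (u k)‖ ^ 2 ≤ q ^ 2 * T * lpNorm η 2 volume ^ 2 := by
    rw [← hE.tsum_eq, ← tsum_mul_left]
    exact hbs.tsum_le_tsum hb (hE.summable.mul_left _)
  have hut : ∑' k, ‖u k‖ ^ 2 ≤ c * (q ^ 2 * T * lpNorm η 2 volume ^ 2) :=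
    (hcM u hus hbs).trans (mul_le_mul_of_nonneg_left hbt hc)
  have hWk : ∀ k, W k ≤ a₁ * ‖u k‖ ^ 2 + a₂ * E k := by
    intro k
    have e : W k = ∫ s in (0:ℝ)..T, ‖w (s + k * T)‖ ^ 2 := by
      have := intervalIntegral.integral_comp_add_right (a := 0) (b := T)
        (fun t => ‖w t‖ ^ 2) (k * T)
      rw [zero_add, add_comm T] at this
      exact this.symm
    have hi : IntervalIntegrable (fun s => ‖w (s + k * T)‖ ^ 2) volume 0 T :=
      (integrable_sq_norm (h.translate (k * T)).memLp).intervalIntegrable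
    rw [e]
    have hle : ∀ s ∈ Icc 0 T, ‖w (s + k * T)‖ ^ 2
        ≤ 2 * P ^ 2 * ‖u k‖ ^ 2 + 2 * q ^ 2 * T * E k := by
      intro s hs
      have h1 : ‖w (s + k * T)‖ ≤ ‖Φ s (u k)‖ + ‖w (s + k * T) - Φ s (u k)‖ := by
        have := norm_add_le (Φ s (u k)) (w (s + k * T) - Φ s (u k))
        rwa [add_sub_cancel] at this
      have h2 : ‖Φ s (u k)‖ ≤ P * ‖u k‖ := (Φ s).le_of_opNorm_le (hP s hs) _
      have h3 := hsol k s hs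
      have h4 : ‖w (s + k * T)‖ ^ 2 ≤ (‖Φ s (u k)‖ + ‖w (s + k * T) - Φ s (u k)‖) ^ 2 := by
        gcongr
      have h5 : ‖Φ s (u k)‖ ^ 2 ≤ (P * ‖u k‖) ^ 2 := by gcongr
      nlinarith [sq_nonneg (‖Φ s (u k)‖ - ‖w (s + k * T) - Φ s (u k)‖)]
    have := intervalIntegral.integral_mono_on hT.le hi (by simp) hle
    refine this.trans (le_of_eq ?_)
    rw [intervalIntegral.integral_const]
    simp [a₁, a₂]
    ring
  have hfin : lpNorm w 2 volume ^ 2 ≤ C * lpNorm η 2 volume ^ 2 := by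
    rw [← hW.tsum_eq]
    calc ∑' k, W k ≤ ∑' k, (a₁ * ‖u k‖ ^ 2 + a₂ * E k) :=
          hW.summable.tsum_le_tsum hWk ((hus.mul_left _).add (hE.summable.mul_left _))
      _ = a₁ * ∑' k, ‖u k‖ ^ 2 + a₂ * lpNorm η 2 volume ^ 2 := by
          rw [(hus.mul_left _).tsum_add (hE.summable.mul_left _), tsum_mul_left, tsum_mul_left,
            hE.tsum_eq]
      _ ≤ a₁ * (c * (q ^ 2 * T * lpNorm η 2 volume ^ 2)) + a₂ * lpNorm η 2 volume ^ 2 := by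
          have : 0 ≤ a₁ := by positivity
          gcongr
      _ = C * lpNorm η 2 volume ^ 2 := by simp only [C]; ring
  have h0 : 0 ≤ lpNorm η 2 volume := lpNorm_nonneg
  refine le_of_sq_le_sq ?_ (by positivity)
  rw [mul_pow, Real.sq_sqrt hC]
  exact hfin

end Periodic

/-! ## Compactness of bounded sequences of approximate homoclinic solutions -/

section Compactness

variable {V : Type*} [NormedAddCommGroup V] [InnerProductSpace ℝ V] [FiniteDimensional ℝ V]

/-- A continuous right-hand side vanishing at `0`, Lipschitz on bounded sets uniformly in `t`. -/
structure IsLocallyLipschitzField (F : ℝ → V → V) : Prop where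
  continuous : Continuous fun p : ℝ × V => F p.1 p.2
  zero : ∀ t, F t 0 = 0
  lipschitz : ∀ R : ℝ, ∃ K : ℝ, 0 ≤ K ∧ ∀ t ξ η, ‖ξ‖ ≤ R → ‖η‖ ≤ R →
    ‖F t ξ - F t η‖ ≤ K * ‖ξ - η‖

/-- At the end `e` of the real line, `F` is asymptotic to a periodic field `G` without homoclinic
solutions, and its linearization at `0` is asymptotic to a coercive linear system. -/
structure IsHyperbolicEnd (F : ℝ → V → V) (e : Filter ℝ) (G : ℝ → V → V) (B : ℝ → V →L[ℝ] V)
    (T : ℝ) : Prop where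
  period_pos : 0 < T
  continuous : Continuous fun p : ℝ × V => G p.1 p.2
  periodic : ∀ t ξ, G (t + T) ξ = G t ξ
  limit : ∀ R ε : ℝ, 0 < ε → ∀ᶠ t in e, ∀ ξ, ‖ξ‖ ≤ R → ‖F t ξ - G t ξ‖ ≤ ε
  linear : ∀ ε : ℝ, 0 < ε → ∃ δ : ℝ, 0 < δ ∧ ∀ᶠ t in e, ∀ ξ η, ‖ξ‖ ≤ δ → ‖η‖ ≤ δ →
    ‖F t ξ - F t η - B t (ξ - η)‖ ≤ ε * ‖ξ - η‖
  coercive : ∃ c : ℝ, 0 ≤ c ∧ ∀ w v : ℝ → V, IsSobolevPair w v →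
    lpNorm w 2 volume ≤ c * lpNorm (fun t => v t - B t (w t)) 2 volume
  no_homoclinic : ∀ z : ℝ → V, IsSobolevPair z (fun t => G t (z t)) → ∀ t, z t = 0

lemma IsLocallyLipschitzField.norm_le {F : ℝ → V → V} (hF : IsLocallyLipschitzField F) (R : ℝ) :
    ∃ K : ℝ, 0 ≤ K ∧ ∀ t ξ, ‖ξ‖ ≤ R → ‖F t ξ‖ ≤ K * ‖ξ‖ := by
  obtain ⟨K, hK, h⟩ := hF.lipschitz R
  refine ⟨K, hK, fun t ξ hξ => ?_⟩
  have := h t ξ 0 hξ (by simpa using (norm_nonneg ξ).trans hξ)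
  simpa [hF.zero] using this

/-- Bounded sequences in `H¹` have locally uniformly convergent subsequences. -/
lemma exists_subseq_tendstoUniformlyOn {x v : ℕ → ℝ → V} (h : ∀ n, IsSobolevPair (x n) (v n))
    {A : ℝ} (hx : ∀ n, lpNorm (x n) 2 volume ≤ A) (hv : ∀ n, lpNorm (v n) 2 volume ≤ A) :
    ∃ φ : ℕ → ℕ, StrictMono φ ∧ ∃ z : ℝ → V, Continuous z ∧
      ∀ K, IsCompact K → TendstoUniformlyOn (fun n => x (φ n)) z atTop K := by
  -- The bound 4A is the sup-norm embedding 2(A + A), and the Hölder-1/2 modulus comes from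
  -- Cauchy–Schwarz applied to v.
  set S : Set C(ℝ, V) := {f | (∀ t, ‖f t‖ ≤ 4 * A) ∧ ∀ s t, dist (f s) (f t) ≤ √|s - t| * A}
  have hS : IsCompact S := by
    refine ArzelaAscoli.isCompact_of_equicontinuous S ?_ ?_
    -- As a set of plain functions, S is pointwise closed inside a product of compact balls, because
    -- the modulus already forces continuity.
    · have e : ContinuousMap.toFun '' S = {f : ℝ → V | (∀ t, ‖f t‖ ≤ 4 * A) ∧
          ∀ s t, dist (f s) (f t) ≤ √|s - t| * A} := by
        ext f
        constructor
        · rintro ⟨g, hg, rfl⟩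
          exact hg
        · intro hf
          refine ⟨⟨f, ?_⟩, hf, rfl⟩
          refine continuous_iff_continuousAt.2 fun t => tendsto_iff_dist_tendsto_zero.2 ?_
          refine squeeze_zero (fun _ => dist_nonneg) (fun s => hf.2 s t) ?_
          have : Continuous fun s : ℝ => √|s - t| * A := by fun_prop
          simpa using this.tendsto t
      rw [e]
      refine IsCompact.of_isClosed_subset
        (isCompact_univ_pi fun _ : ℝ => isCompact_closedBall (0 : V) (4 * A)) ?_
        fun f hf t _ => by simpa using hf.1 t
      simp only [ofPred_and, ofPred_forall]
      refine IsClosed.inter (isClosed_iInter fun t => ?_)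
        (isClosed_iInter fun s => isClosed_iInter fun t => ?_)
      · exact isClosed_le (continuous_apply t).norm continuous_const
      · exact isClosed_le ((continuous_apply s).dist (continuous_apply t)) continuous_const
    · refine Metric.equicontinuous_of_continuity_modulus (fun r => √r * A) ?_ _ ?_
      · have : Continuous fun r : ℝ => √r * A := by fun_prop
        simpa using this.tendsto 0
      · intro s t f
        rw [Real.dist_eq]
        exact f.2.2 s t
  set X : ℕ → C(ℝ, V) := fun n => ⟨x n, (h n).continuous⟩
  have hX : ∀ n, X n ∈ S := fun n => by
    refine ⟨fun t => ((h n).norm_le t).trans (by linarith [hx n, hv n]), fun s t => ?_⟩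
    exact ((h n).dist_le s t).trans (mul_le_mul_of_nonneg_left (hv n) (Real.sqrt_nonneg _))
  obtain ⟨z, -, φ, hφ, hz⟩ := hS.tendsto_subseq hX
  refine ⟨φ, hφ, z, z.continuous, fun K hK => ?_⟩
  exact ContinuousMap.tendsto_iff_forall_isCompact_tendstoUniformlyOn.1 hz K hK

/-- Fatou's lemma: the L² norm is lower semicontinuous under pointwise convergence. -/
lemma memLp_of_tendsto_of_lpNorm_le {x : ℕ → ℝ → V} (hx : ∀ n, MemLp (x n) 2 volume) {A : ℝ}
    (hA : ∀ n, lpNorm (x n) 2 volume ≤ A) {z : ℝ → V} (hz : Continuous z)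
    (hlim : ∀ t, Tendsto (fun n => x n t) atTop (𝓝 (z t))) : MemLp z 2 volume := by
  refine ⟨hz.aestronglyMeasurable, ?_⟩
  refine (Lp.eLpNorm_lim_le_liminf_eLpNorm (fun n => (hx n).aestronglyMeasurable) z
    (.of_forall hlim)).trans_lt ?_
  refine lt_of_le_of_lt (b := ENNReal.ofReal A) ?_ ENNReal.ofReal_lt_top
  refine liminf_le_of_le (by isBoundedDefault) fun b hb => ?_
  obtain ⟨n, hn⟩ := hb.exists
  refine hn.trans ?_
  rw [← ofReal_lpNorm (hx n)]
  exact ENNReal.ofReal_le_ofReal (hA n)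

/-- An integral equation passes to the limit when v n → u in L¹ on every bounded interval. Closeness
is expressed by a majorant p so that residual, forcing and field errors can be estimated separately.
-/
lemma primitive_of_tendsto {x v : ℕ → ℝ → V} (h : ∀ n, IsSobolevPair (x n) (v n))
    {z u : ℝ → V} (hz : ∀ t, Tendsto (fun n => x n t) atTop (𝓝 (z t)))
    (hu : LocallyIntegrable u)
    (hvu : ∀ a b, a ≤ b → ∀ ε : ℝ, 0 < ε → ∀ᶠ n in atTop, ∃ p : ℝ → ℝ,
      IntervalIntegrable p volume a b ∧ (∀ t ∈ Icc a b, ‖v n t - u t‖ ≤ p t) ∧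
      ∫ t in a..b, p t ≤ ε) (a b : ℝ) :
    z b - z a = ∫ t in a..b, u t := by
  wlog hab : a ≤ b generalizing a b
  · rw [intervalIntegral.integral_symm, ← this b a (le_of_not_ge hab), neg_sub]
  have h1 : Tendsto (fun n => x n b - x n a - ∫ t in a..b, u t) atTop
      (𝓝 (z b - z a - ∫ t in a..b, u t)) := ((hz b).sub (hz a)).sub tendsto_const_nhds
  refine sub_eq_zero.1 (norm_le_zero_iff.1 (le_of_forall_pos_le_add fun ε hε => ?_))
  rw [zero_add]
  refine le_of_tendsto h1.norm ?_
  filter_upwards [hvu a b hab ε hε] with n ⟨p, hp, hle, hpε⟩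
  rw [(h n).sub_eq, ← intervalIntegral.integral_sub ((h n).intervalIntegrable _ _)
    (intervalIntegrable_of_locallyIntegrable hu _ _)]
  exact (intervalIntegral.norm_integral_le_of_norm_le hab
    (.of_forall fun t ht => hle t ⟨ht.1.le, ht.2⟩) hp).trans hpε

/-- A fixed square integrable forcing y disappears locally when it is translated to infinity. -/
lemma tendsto_integral_norm_translate {y : ℝ → V} (hy : MemLp y 2 volume) {e : Filter ℝ}
    (he : e = atTop ∨ e = atBot) {a b : ℝ} (hab : a ≤ b) :
    Tendsto (fun τ => ∫ t in a..b, ‖y (t + τ)‖) e (𝓝 0) := by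
  have he' : Tendsto (fun τ => a + τ) e e := by
    rcases he with rfl | rfl
    · exact tendsto_atTop_add_const_left _ a tendsto_id
    · exact tendsto_atBot_add_const_left _ a tendsto_id
  have h1 := ((tendsto_integral_window (integrable_sq_norm hy) (b - a) he).comp he').const_mul
    (b - a)
  rw [mul_zero] at h1
  have h2 : Tendsto (fun τ => (∫ t in a..b, ‖y (t + τ)‖) ^ 2) e (𝓝 0) := by
    refine squeeze_zero (fun τ => by positivity) (fun τ => ?_) h1
    rw [intervalIntegral.integral_comp_add_right (fun t => ‖y t‖)]
    have := sq_integral_norm_le hy (by linarith : a + τ ≤ b + τ)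
    have e1 : a + τ + (b - a) = b + τ := by ring
    simpa [e1] using this
  have h3 := (Real.continuous_sqrt.tendsto 0).comp h2
  rw [Real.sqrt_zero] at h3
  refine h3.congr fun τ => ?_
  exact Real.sqrt_sq (intervalIntegral.integral_nonneg hab fun t _ => norm_nonneg _)

lemma eventually_window {e : Filter ℝ} (he : e = atTop ∨ e = atBot) {P : ℝ → Prop}
    (hP : ∀ᶠ s in e, P s) (a b : ℝ) : ∀ᶠ τ in e, ∀ t ∈ Icc a b, P (t + τ) := by
  rcases he with rfl | rfl
  · obtain ⟨R, hR⟩ := eventually_atTop.1 hP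
    filter_upwards [eventually_ge_atTop (R - a)] with τ hτ t ht
    exact hR _ (by linarith [ht.1])
  · obtain ⟨R, hR⟩ := eventually_atBot.1 hP
    filter_upwards [eventually_le_atBot (R - b)] with τ hτ t ht
    exact hR _ (by linarith [ht.2])

lemma lpNorm_comp_add_right {f : ℝ → V} (hf : AEStronglyMeasurable f volume) (c : ℝ) :
    lpNorm (fun t => f (t + c)) 2 volume = lpNorm f 2 volume := by
  have hmp := measurePreserving_add_right (volume : Measure ℝ) c
  have h1 := eLpNorm_comp_measurePreserving (p := 2) hf hmp
  rw [← toReal_eLpNorm hf, ← h1, toReal_eLpNorm (hf.comp_measurePreserving hmp)]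
  rfl

lemma continuous_field_comp {F : ℝ → V → V} (hF : Continuous fun p : ℝ × V => F p.1 p.2)
    {y : ℝ → V} (hy : Continuous y) : Continuous fun t => F t (y t) :=
  hF.comp (continuous_id.prodMk hy)

lemma IsLocallyLipschitzField.memLp {F : ℝ → V → V} (hF : IsLocallyLipschitzField F)
    {y : ℝ → V} (hy : Continuous y) (hy2 : MemLp y 2 volume) {R : ℝ} (hR : ∀ t, ‖y t‖ ≤ R) :
    MemLp (fun t => F t (y t)) 2 volume := by
  obtain ⟨K, -, hK⟩ := hF.norm_le R
  exact hy2.of_le_mul (c := K) (continuous_field_comp hF.continuous hy).aestronglyMeasurable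
    (.of_forall fun t => hK t _ (hR t))

/-- Approximate solutions cannot escape to infinity. -/
lemma eventually_norm_le_of_isHyperbolicEnd {F : ℝ → V → V} (hF : IsLocallyLipschitzField F)
    {e : Filter ℝ} (he : e = atTop ∨ e = atBot) {G : ℝ → V → V} {B : ℝ → V →L[ℝ] V} {T : ℝ}
    (hG : IsHyperbolicEnd F e G B T) {x v : ℕ → ℝ → V} (h : ∀ n, IsSobolevPair (x n) (v n))
    {A : ℝ} (hx : ∀ n, lpNorm (x n) 2 volume ≤ A) (hv : ∀ n, lpNorm (v n) 2 volume ≤ A)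
    {y : ℝ → V} (hy : MemLp y 2 volume)
    (hr : Tendsto (fun n => lpNorm (fun t => v n t - F t (x n t) - y t) 2 volume) atTop (𝓝 0))
    {δ : ℝ} (hδ : 0 < δ) : ∀ᶠ p in atTop ×ˢ e, ‖x p.1 p.2‖ ≤ δ := by
  have hcg : e.IsCountablyGenerated := by rcases he with rfl | rfl <;> infer_instance
  have hT := hG.period_pos
  by_contra hcon
  rw [not_eventually] at hcon
  -- A sequence of pairs (index, time) along which the index tends to infinity, the time tends to e,
  -- and the value stays larger than δ.
  obtain ⟨p, hp, hpδ⟩ := exists_seq_forall_of_frequently hcon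
  have hp1 : Tendsto (fun j => (p j).1) atTop atTop := tendsto_fst.comp hp
  have hp2 : Tendsto (fun j => (p j).2) atTop e := tendsto_snd.comp hp
  -- The largest multiple of T below the bad time: translation by it leaves G invariant and moves
  -- the bad time into the fixed compact interval [0, T].
  set τ : ℕ → ℝ := fun j => ⌊(p j).2 / T⌋ * T
  have hτ1 : ∀ j, τ j ≤ (p j).2 := fun j => by
    have := Int.floor_le ((p j).2 / T)
    rwa [le_div_iff₀ hT] at this
  have hτ2 : ∀ j, (p j).2 - T ≤ τ j := fun j => by
    have := Int.lt_floor_add_one ((p j).2 / T)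
    rw [div_lt_iff₀ hT] at this
    simp only [τ]
    linarith
  have hτ : Tendsto τ atTop e := by
    rcases he with rfl | rfl
    · exact tendsto_atTop_mono hτ2 (tendsto_atTop_add_const_right _ (-T) hp2)
    · exact tendsto_atBot_mono hτ1 hp2
  have hGper : ∀ j t ξ, G (t + τ j) ξ = G t ξ := fun j t ξ => by
    have hper : Function.Periodic G T := fun t => funext (hG.periodic t)
    exact congrFun (hper.int_mul _ t) ξ
  have hpair : ∀ j, IsSobolevPair (fun t => x (p j).1 (t + τ j)) (fun t => v (p j).1 (t + τ j)) :=
    fun j => (h _).translate _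
  have hxA : ∀ j, lpNorm (fun t => x (p j).1 (t + τ j)) 2 volume ≤ A := fun j => by
    rw [lpNorm_comp_add_right (h _).memLp.aestronglyMeasurable]; exact hx _
  have hvA : ∀ j, lpNorm (fun t => v (p j).1 (t + τ j)) 2 volume ≤ A := fun j => by
    rw [lpNorm_comp_add_right (h _).memLp_deriv.aestronglyMeasurable]; exact hv _
  obtain ⟨φ, hφ, z, hzc, hz⟩ := exists_subseq_tendstoUniformlyOn hpair hxA hvA
  have hφt := hφ.tendsto_atTop
  have hzlim : ∀ t, Tendsto (fun n => x (p (φ n)).1 (t + τ (φ n))) atTop (𝓝 (z t)) := fun t =>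
    (hz {t} isCompact_singleton).tendsto_at rfl
  have hxb : ∀ n t, ‖x n t‖ ≤ 4 * A := fun n t =>
    ((h n).norm_le t).trans (by linarith [hx n, hv n])
  have hzb : ∀ t, ‖z t‖ ≤ 4 * A := fun t =>
    le_of_tendsto (hzlim t).norm (.of_forall fun n => hxb _ _)
  have hz2 : MemLp z 2 volume := memLp_of_tendsto_of_lpNorm_le (fun n => (hpair (φ n)).memLp)
    (fun n => hxA (φ n)) hzc hzlim
  obtain ⟨K, hK, hFK⟩ := hF.lipschitz (4 * A)
  have hτφ : Tendsto (fun n => τ (φ n)) atTop e := hτ.comp hφt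
  have hFG : ∀ ε : ℝ, 0 < ε → ∀ a b, ∀ᶠ n in atTop, ∀ t ∈ Icc a b, ∀ ξ, ‖ξ‖ ≤ 4 * A →
      ‖F (t + τ (φ n)) ξ - G t ξ‖ ≤ ε := by
    intro ε hε a b
    filter_upwards [hτφ.eventually (eventually_window he (hG.limit (4 * A) ε hε) a b)]
      with n hn t ht ξ hξ
    have := hn t ht ξ hξ
    rwa [hGper] at this
  -- The linear bound of F survives in its translated limit G; it puts G(·, z) in L².
  have hGn : ∀ t ξ, ‖ξ‖ ≤ 4 * A → ‖G t ξ‖ ≤ K * ‖ξ‖ := by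
    intro t ξ hξ
    refine le_of_forall_pos_le_add fun ε hε => ?_
    obtain ⟨n, hn⟩ := (hFG ε hε t t).exists
    have h1 := hn t ⟨le_rfl, le_rfl⟩ ξ hξ
    have h2 := hFK (t + τ (φ n)) ξ 0 hξ (by simpa using (norm_nonneg ξ).trans hξ)
    rw [hF.zero, sub_zero, sub_zero] at h2
    have h3 := norm_sub_norm_le (G t ξ) (F (t + τ (φ n)) ξ)
    rw [norm_sub_rev] at h3
    linarith
  have hGz : MemLp (fun t => G t (z t)) 2 volume :=
    hz2.of_le_mul (c := K) (continuous_field_comp hG.continuous hzc).aestronglyMeasurable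
      (.of_forall fun t => hGn t _ (hzb t))
  have hr2 : ∀ n, MemLp (fun t => v n t - F t (x n t) - y t) 2 volume := fun n =>
    ((h n).memLp_deriv.sub (hF.memLp (h n).continuous (h n).memLp (hxb n))).sub hy
  have hzprim : ∀ a b, z b - z a = ∫ t in a..b, G t (z t) := by
    refine primitive_of_tendsto (fun n => hpair (φ n)) hzlim
      (hGz.locallyIntegrable (by norm_num)) fun a b hab => ?_
    intro ε hε
    -- The field error (K + 1) ε' integrates to at most ε / 3; residual and translated forcing take
    -- the other two thirds.
    set ε' : ℝ := ε / (3 * (K + 1) * (b - a + 1))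
    have hba : 0 ≤ b - a := by linarith
    have hε' : 0 < ε' := by positivity
    have h1 : ∀ᶠ n in atTop, √(b - a) *
        lpNorm (fun t => v (p (φ n)).1 t - F t (x (p (φ n)).1 t) - y t) 2 volume < ε / 3 := by
      have := (hr.comp (hp1.comp hφt)).const_mul (√(b - a))
      rw [mul_zero] at this
      exact this.eventually_lt_const (by positivity)
    have h2 : ∀ᶠ n in atTop, ∫ t in a..b, ‖y (t + τ (φ n))‖ < ε / 3 :=
      ((tendsto_integral_norm_translate hy he hab).comp hτφ).eventually_lt_const (by positivity)
    filter_upwards [h1, h2, hFG ε' hε' a b,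
      Metric.tendstoUniformlyOn_iff.1 (hz (Icc a b) isCompact_Icc) ε' hε'] with n h1 h2 h3 h4
    set r : ℝ → V := fun t => v (p (φ n)).1 t - F t (x (p (φ n)).1 t) - y t
    have hri : MemLp (fun t => r (t + τ (φ n))) 2 volume :=
      (hr2 _).comp_measurePreserving (measurePreserving_add_right volume _)
    have hyi : MemLp (fun t => y (t + τ (φ n))) 2 volume :=
      hy.comp_measurePreserving (measurePreserving_add_right volume _)
    have hri' := (intervalIntegrable_of_memLp_two hri a b).norm
    have hyi' := (intervalIntegrable_of_memLp_two hyi a b).norm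
    refine ⟨fun t => ‖r (t + τ (φ n))‖ + ‖y (t + τ (φ n))‖ + (K + 1) * ε',
      (hri'.add hyi').add (by simp), fun t ht => ?_, ?_⟩
    · have e1 : v (p (φ n)).1 (t + τ (φ n)) - G t (z t) = r (t + τ (φ n)) + y (t + τ (φ n))
          + ((F (t + τ (φ n)) (x (p (φ n)).1 (t + τ (φ n))) - F (t + τ (φ n)) (z t))
          + (F (t + τ (φ n)) (z t) - G t (z t))) := by
        simp only [r]; abel
      rw [e1]
      refine (norm_add_le _ _).trans (add_le_add (norm_add_le _ _) ((norm_add_le _ _).trans ?_))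
      rw [add_mul, one_mul]
      refine add_le_add ((hFK _ _ _ (hxb _ _) (hzb t)).trans ?_) (h3 t ht _ (hzb t))
      have := (h4 t ht).le
      rw [dist_comm, dist_eq_norm] at this
      exact mul_le_mul_of_nonneg_left this hK
    · rw [intervalIntegral.integral_add (hri'.add hyi') (by simp),
        intervalIntegral.integral_add hri' hyi', intervalIntegral.integral_const, smul_eq_mul]
      have h5 : ∫ t in a..b, ‖r (t + τ (φ n))‖ < ε / 3 := by
        refine (integral_norm_le_sqrt_mul_lpNorm hri hab).trans_lt ?_
        rwa [lpNorm_comp_add_right (hr2 _).aestronglyMeasurable]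
      have h6 : (b - a) * ((K + 1) * ε') ≤ ε / 3 := by
        have e2 : ε / 3 = (b - a + 1) * ((K + 1) * ε') := by
          simp only [ε']; field_simp
        rw [e2]
        gcongr
        linarith
      linarith
  have hz0 := hG.no_homoclinic z ⟨hz2, hGz, hzprim⟩
  -- The limit is zero, so uniform convergence on [0, T] contradicts the size of the values at the
  -- translated bad times.
  have hunif := Metric.tendstoUniformlyOn_iff.1 (hz (Icc 0 T) isCompact_Icc) δ hδ
  obtain ⟨n, hn⟩ := hunif.exists
  have h1 := hn ((p (φ n)).2 - τ (φ n)) ⟨by linarith [hτ1 (φ n)], by linarith [hτ2 (φ n)]⟩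
  rw [hz0, dist_zero_left, sub_add_cancel] at h1
  exact hpδ (φ n) h1.le

/-- A shifted, and for -∞ reflected, smooth step. The compact support of χ' is what lets local
uniform convergence control the commutator of χ with d/dt. -/
lemma exists_cutoff {e : Filter ℝ} (he : e = atTop ∨ e = atBot) {P : ℝ → Prop}
    (hP : ∀ᶠ t in e, P t) : ∃ χ χ' : ℝ → ℝ, Continuous χ' ∧ HasCompactSupport χ' ∧
      (∀ t, HasDerivAt χ (χ' t) t) ∧ (∀ t, 0 ≤ χ t) ∧ (∀ t, χ t ≤ 1) ∧
      (∀ t, χ t ≠ 0 → P t) ∧ ∀ᶠ t in e, χ t = 1 := by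
  have hd : ContDiff ℝ 1 Real.smoothTransition := Real.smoothTransition.contDiff (n := 1)
  have hdc : Continuous (deriv Real.smoothTransition) := hd.continuous_deriv le_rfl
  have hder : ∀ t, HasDerivAt Real.smoothTransition (deriv Real.smoothTransition t) t := fun t =>
    ((hd.differentiable one_ne_zero) t).hasDerivAt
  have hsupp : ∀ t, t ∉ Icc (0:ℝ) 1 → deriv Real.smoothTransition t = 0 := by
    intro t ht
    rcases lt_or_ge t 0 with h | h
    · have : Real.smoothTransition =ᶠ[𝓝 t] fun _ => 0 := by
        filter_upwards [Iio_mem_nhds h] with s hs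
        exact Real.smoothTransition.zero_of_nonpos (le_of_lt hs)
      rw [this.deriv_eq, deriv_const]
    · have h1 : 1 < t := by
        by_contra h'
        exact ht ⟨h, not_lt.1 h'⟩
      have : Real.smoothTransition =ᶠ[𝓝 t] fun _ => 1 := by
        filter_upwards [Ioi_mem_nhds h1] with s hs
        exact Real.smoothTransition.one_of_one_le (le_of_lt hs)
      rw [this.deriv_eq, deriv_const]
  rcases he with rfl | rfl
  · obtain ⟨R, hR⟩ := eventually_atTop.1 hP
    refine ⟨fun t => Real.smoothTransition (t - R), fun t => deriv Real.smoothTransition (t - R),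
      hdc.comp (by fun_prop), ?_, fun t => ?_, fun t => Real.smoothTransition.nonneg _,
      fun t => Real.smoothTransition.le_one _, fun t ht => ?_, ?_⟩
    · refine HasCompactSupport.intro (isCompact_Icc (a := R) (b := R + 1)) fun t ht => hsupp _ ?_
      exact fun h => ht ⟨by linarith [h.1], by linarith [h.2]⟩
    · exact (hder (t - R)).comp_sub_const t R
    · refine hR t (le_of_not_gt fun h => ht ?_)
      exact Real.smoothTransition.zero_of_nonpos (by linarith)
    · filter_upwards [eventually_ge_atTop (R + 1)] with t ht
      exact Real.smoothTransition.one_of_one_le (by linarith)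
  · obtain ⟨R, hR⟩ := eventually_atBot.1 hP
    refine ⟨fun t => Real.smoothTransition (R - t), fun t => -deriv Real.smoothTransition (R - t),
      (hdc.comp (by fun_prop)).neg, ?_, fun t => ?_, fun t => Real.smoothTransition.nonneg _,
      fun t => Real.smoothTransition.le_one _, fun t ht => ?_, ?_⟩
    · refine HasCompactSupport.intro (isCompact_Icc (a := R - 1) (b := R)) fun t ht => ?_
      rw [hsupp, neg_zero]
      exact fun h => ht ⟨by linarith [h.2], by linarith [h.1]⟩
    · exact (hder (R - t)).comp_const_sub R t
    · refine hR t (le_of_not_gt fun h => ht ?_)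
      exact Real.smoothTransition.zero_of_nonpos (by linarith)
    · filter_upwards [eventually_le_atBot (R - 1)] with t ht
      exact Real.smoothTransition.one_of_one_le (by linarith)

lemma IsSobolevPair.cutoff {w v : ℝ → V} (h : IsSobolevPair w v) {χ χ' : ℝ → ℝ}
    (hχ : ∀ t, HasDerivAt χ (χ' t) t) (hχ'c : Continuous χ') (hχ's : HasCompactSupport χ')
    (h0 : ∀ t, 0 ≤ χ t) (h1 : ∀ t, χ t ≤ 1) :
    IsSobolevPair (fun t => χ t • w t) (fun t => χ' t • w t + χ t • v t) := by
  have hχc : Continuous χ := continuous_iff_continuousAt.2 fun t => (hχ t).continuousAt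
  have hmul : ∀ {f : ℝ → V}, MemLp f 2 volume → MemLp (fun t => χ t • f t) 2 volume := fun hf =>
    hf.mono (hχc.aestronglyMeasurable.smul hf.aestronglyMeasurable) (.of_forall fun t => by
      rw [norm_smul, Real.norm_of_nonneg (h0 t)]
      exact mul_le_of_le_one_left (norm_nonneg _) (h1 t))
  obtain ⟨D, hD⟩ := hχ'c.bounded_above_of_compact_support hχ's
  refine ⟨hmul h.memLp, MemLp.add ?_ (hmul h.memLp_deriv), fun a b => ?_⟩
  · refine h.memLp.of_le_mul (c := D)
      (hχ'c.aestronglyMeasurable.smul h.memLp.aestronglyMeasurable) (.of_forall fun t => ?_)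
    rw [norm_smul]
    exact mul_le_mul_of_nonneg_right (hD t) (norm_nonneg _)
  · refine smul_sub_smul_eq_integral hχ'c.locallyIntegrable (fun a b => ?_)
      (h.memLp_deriv.locallyIntegrable (by norm_num)) h.sub_eq a b
    exact (intervalIntegral.integral_eq_sub_of_hasDerivAt (fun t _ => hχ t)
      (hχ'c.intervalIntegrable _ _)).symm

lemma lpNorm_le_of_norm_le_on_Icc {f : ℝ → V} {a b c : ℝ} (hf : ∀ t ∈ Icc a b, ‖f t‖ ≤ c)
    (h0 : ∀ t, t ∉ Icc a b → f t = 0) (hc : 0 ≤ c) (hab : a ≤ b) :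
    lpNorm f 2 volume ≤ c * √(b - a) := by
  set g : ℝ → ℝ := (Icc a b).indicator fun _ => c
  have hg : MemLp g 2 volume := memLp_indicator_const 2 measurableSet_Icc c (by simp)
  have h1 : lpNorm f 2 volume ≤ lpNorm g 2 volume := by
    refine lpNorm_mono_ae hg (.of_forall fun t => ?_)
    by_cases ht : t ∈ Icc a b
    · simp only [g, indicator_of_mem ht]
      exact (hf t ht).trans (le_abs_self _)
    · simp [g, h0 t ht, indicator_of_notMem ht]
  refine h1.trans (le_of_sq_le_sq ?_ (by positivity))
  rw [lpNorm_two_sq hg, mul_pow, Real.sq_sqrt (by linarith)]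
  have e : (fun t => ‖g t‖ ^ 2) = (Icc a b).indicator fun _ => c ^ 2 := by
    ext t
    by_cases ht : t ∈ Icc a b
    · simp [g, indicator_of_mem ht]
    · simp [g, indicator_of_notMem ht]
  rw [e, integral_indicator measurableSet_Icc]
  simp [hab, mul_comm]

lemma tendsto_lpNorm_of_tendstoUniformlyOn {f : ℕ → ℝ → V} {a b : ℝ} (hab : a ≤ b)
    (h : TendstoUniformlyOn f 0 atTop (Icc a b)) (h0 : ∀ n t, t ∉ Icc a b → f n t = 0) :
    Tendsto (fun n => lpNorm (f n) 2 volume) atTop (𝓝 0) := by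
  rw [Metric.tendsto_nhds]
  intro ε hε
  have hc : 0 < ε / (√(b - a) + 1) := by positivity
  filter_upwards [Metric.tendstoUniformlyOn_iff.1 h _ hc] with n hn
  rw [Real.dist_0_eq_abs, abs_of_nonneg lpNorm_nonneg]
  refine (lpNorm_le_of_norm_le_on_Icc (fun t ht => ?_) (h0 n) hc.le hab).trans_lt ?_
  · have := (hn t ht).le
    rwa [Pi.zero_apply, dist_zero_left] at this
  · rw [div_mul_eq_mul_div, div_lt_iff₀ (by positivity)]
    nlinarith [Real.sqrt_nonneg (b - a)]

/-- Near a hyperbolic end, locally uniform convergence of approximate solutions improves to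
convergence in `L²`. -/
lemma exists_cutoff_tendsto_lpNorm {F : ℝ → V → V} {e : Filter ℝ} (he : e = atTop ∨ e = atBot)
    {G : ℝ → V → V} {B : ℝ → V →L[ℝ] V} {T : ℝ} (hG : IsHyperbolicEnd F e G B T)
    {x v : ℕ → ℝ → V} (h : ∀ n, IsSobolevPair (x n) (v n)) {y z : ℝ → V}
    (hz : IsSobolevPair z fun t => F t (z t) + y t)
    (hrm : ∀ n, MemLp (fun t => v n t - F t (x n t) - y t) 2 volume)
    (hr : Tendsto (fun n => lpNorm (fun t => v n t - F t (x n t) - y t) 2 volume) atTop (𝓝 0))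
    (hxz : ∀ K, IsCompact K → TendstoUniformlyOn x z atTop K)
    (hdecay : ∀ δ : ℝ, 0 < δ → ∀ᶠ p in atTop ×ˢ e, ‖x p.1 p.2‖ ≤ δ) :
    ∃ χ : ℝ → ℝ, (∀ᶠ t in e, χ t = 1) ∧ (∀ n, MemLp (fun t => χ t • (x n t - z t)) 2 volume) ∧
      Tendsto (fun n => lpNorm (fun t => χ t • (x n t - z t)) 2 volume) atTop (𝓝 0) := by
  obtain ⟨c, hc, hcoer⟩ := hG.coercive
  -- Chosen so that c ε ≤ 1/2: the linearization error can then be absorbed in the coercivity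
  -- estimate.
  set ε : ℝ := 1 / (2 * (c + 1))
  have hε : 0 < ε := by positivity
  obtain ⟨δ, hδ, hlin⟩ := hG.linear ε hε
  obtain ⟨P₁, hP₁, P₂, hP₂, hP⟩ := eventually_prod_iff.1 (hdecay δ hδ)
  have hzδ : ∀ᶠ t in e, ‖z t‖ ≤ δ := by
    have := (hz.tendsto_zero he).norm
    rw [norm_zero] at this
    exact (this.eventually_lt_const hδ).mono fun t ht => le_of_lt ht
  obtain ⟨χ, χ', hχ'c, hχ's, hχ, h0, h1, hχP, hχe⟩ :=
    exists_cutoff he ((hP₂.and hzδ).and hlin)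
  set w : ℕ → ℝ → V := fun n t => x n t - z t
  have hw : ∀ n, IsSobolevPair (w n) (fun t => v n t - (F t (z t) + y t)) := fun n =>
    (h n).sub hz
  have hχw := fun n => (hw n).cutoff hχ hχ'c hχ's h0 h1
  refine ⟨χ, hχe, fun n => (hχw n).memLp, ?_⟩
  set r : ℕ → ℝ → V := fun n t => v n t - F t (x n t) - y t
  set q : ℕ → ℝ → V := fun n t => χ' t • w n t
  obtain ⟨D, hD⟩ := hχ'c.bounded_above_of_compact_support hχ's
  have hqm : ∀ n, MemLp (q n) 2 volume := fun n => by
    refine (hw n).memLp.of_le_mul (c := D)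
      (hχ'c.aestronglyMeasurable.smul (hw n).memLp.aestronglyMeasurable) (.of_forall fun t => ?_)
    rw [norm_smul]
    exact mul_le_mul_of_nonneg_right (hD t) (norm_nonneg _)
  -- The commutator term χ' w lives on a compact set, where w → 0 uniformly.
  have hq : Tendsto (fun n => lpNorm (q n) 2 volume) atTop (𝓝 0) := by
    obtain ⟨R, hR, hsupp⟩ := exists_support_subset_Ioc hχ's
    refine tendsto_lpNorm_of_tendstoUniformlyOn (a := -R) (b := R) (by linarith) ?_ fun n t ht => ?_
    · rw [Metric.tendstoUniformlyOn_iff]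
      intro η hη
      filter_upwards [Metric.tendstoUniformlyOn_iff.1 (hxz _ isCompact_Icc) (η / (|D| + 1))
        (by positivity)] with n hn t ht
      have h2 := hn t ht
      rw [dist_comm, dist_eq_norm, lt_div_iff₀ (by positivity)] at h2
      rw [Pi.zero_apply, dist_zero_left, norm_smul]
      have h3 : ‖χ' t‖ * ‖w n t‖ ≤ (|D| + 1) * ‖w n t‖ := by
        gcongr
        linarith [hD t, le_abs_self D]
      linarith
    · have : χ' t = 0 := image_eq_zero_of_notMem_tsupport fun h' =>
        ht (Ioo_subset_Icc_self (hsupp h'))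
      simp [q, this]
  have hlim : Tendsto (fun n => 2 * c * (lpNorm (q n) 2 volume + lpNorm (r n) 2 volume)) atTop
      (𝓝 0) := by simpa using (hq.add hr).const_mul (2 * c)
  refine squeeze_zero' (.of_forall fun n => lpNorm_nonneg) ?_ hlim
  filter_upwards [hP₁] with n hn
  set W : ℝ → V := fun t => χ t • w n t
  -- The linear operator applied to χ w splits into the commutator, the residual, and the deviation
  -- of F from its linearization. The last is small on the support of χ, where both x n and z are at
  -- most δ.
  have hbound : lpNorm (fun t => (χ' t • w n t + χ t • (v n t - (F t (z t) + y t))) - B t (W t)) 2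
      volume ≤ lpNorm (q n) 2 volume + lpNorm (r n) 2 volume + ε * lpNorm W 2 volume := by
    have hWm : MemLp W 2 volume := (hχw n).memLp
    have hg1 := (hqm n).norm
    have hg2 := (hrm n).norm
    have hg3 := hWm.norm.const_smul ε
    refine (lpNorm_mono_ae ((hg1.add hg2).add hg3) (.of_forall fun t => ?_)).trans ?_
    · have e1 : (χ' t • w n t + χ t • (v n t - (F t (z t) + y t))) - B t (W t)
          = q n t + χ t • r n t + χ t • (F t (x n t) - F t (z t) - B t (x n t - z t)) := by
        simp only [W, q, r, map_smul, w, smul_sub, smul_add, map_sub]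
        abel
      rw [e1]
      refine le_trans ?_ (le_abs_self _)
      refine (norm_add_le _ _).trans (add_le_add ((norm_add_le _ _).trans (add_le_add le_rfl ?_)) ?_)
      · rw [norm_smul, Real.norm_of_nonneg (h0 t)]
        exact mul_le_of_le_one_left (norm_nonneg _) (h1 t)
      · by_cases hχt : χ t = 0
        · simp [hχt, W]
        · obtain ⟨⟨ha, hb⟩, hl⟩ := hχP t hχt
          have h3 := hl (x n t) (z t) (hP hn ha) hb
          simp only [Pi.smul_apply, smul_eq_mul, W, w, norm_smul, Real.norm_of_nonneg (h0 t)]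
          calc _ ≤ χ t * (ε * ‖x n t - z t‖) := mul_le_mul_of_nonneg_left h3 (h0 t)
            _ = _ := by ring
    · refine (lpNorm_add_le (hg1.add hg2) (by norm_num)).trans (add_le_add
        ((lpNorm_add_le hg1 (by norm_num)).trans (le_of_eq ?_)) (le_of_eq ?_))
      · rw [lpNorm_norm (hqm n).aestronglyMeasurable, lpNorm_norm (hrm n).aestronglyMeasurable]
      · rw [lpNorm_const_smul, lpNorm_norm hWm.aestronglyMeasurable, coe_nnnorm,
          Real.norm_of_nonneg hε.le]
  have h4 := (hcoer _ _ (hχw n)).trans (mul_le_mul_of_nonneg_left hbound hc)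
  have hN : 0 ≤ lpNorm W 2 volume := lpNorm_nonneg
  have h5 : c * ε ≤ 1 / 2 := by
    have : c * ε = c / (2 * (c + 1)) := by simp only [ε]; ring
    rw [this, div_le_div_iff₀ (by positivity) (by positivity)]
    linarith
  have h6 : c * (ε * lpNorm W 2 volume) ≤ 1 / 2 * lpNorm W 2 volume := by
    rw [← mul_assoc]; gcongr
  change lpNorm W 2 volume ≤ _
  linarith

/-- A bounded sequence `xₙ` in `H¹` such that `xₙ' - F(·, xₙ)` converges in `L²` has a subsequence
converging in `H¹`. -/
theorem exists_subseq_tendsto_of_isHyperbolicEnd {F : ℝ → V → V} (hF : IsLocallyLipschitzField F)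
    {Gp Gm : ℝ → V → V} {Bp Bm : ℝ → V →L[ℝ] V} {Tp Tm : ℝ}
    (hp : IsHyperbolicEnd F atTop Gp Bp Tp) (hm : IsHyperbolicEnd F atBot Gm Bm Tm)
    {x v : ℕ → ℝ → V} (h : ∀ n, IsSobolevPair (x n) (v n))
    {A : ℝ} (hx : ∀ n, lpNorm (x n) 2 volume ≤ A) (hv : ∀ n, lpNorm (v n) 2 volume ≤ A)
    {y : ℝ → V} (hy : MemLp y 2 volume)
    (hr : Tendsto (fun n => lpNorm (fun t => v n t - F t (x n t) - y t) 2 volume) atTop (𝓝 0)) :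
    ∃ φ : ℕ → ℕ, StrictMono φ ∧ ∃ z u : ℝ → V, IsSobolevPair z u ∧
      Tendsto (fun n => lpNorm (fun t => x (φ n) t - z t) 2 volume) atTop (𝓝 0) ∧
      Tendsto (fun n => lpNorm (fun t => v (φ n) t - u t) 2 volume) atTop (𝓝 0) := by
  obtain ⟨φ, hφ, z, hzc, hxz⟩ := exists_subseq_tendstoUniformlyOn h hx hv
  have hφt := hφ.tendsto_atTop
  have hzlim : ∀ t, Tendsto (fun n => x (φ n) t) atTop (𝓝 (z t)) := fun t =>
    (hxz {t} isCompact_singleton).tendsto_at rfl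
  have hxb : ∀ n t, ‖x n t‖ ≤ 4 * A := fun n t =>
    ((h n).norm_le t).trans (by linarith [hx n, hv n])
  have hzb : ∀ t, ‖z t‖ ≤ 4 * A := fun t =>
    le_of_tendsto (hzlim t).norm (.of_forall fun n => hxb _ _)
  have hz2 : MemLp z 2 volume := memLp_of_tendsto_of_lpNorm_le (fun n => (h (φ n)).memLp)
    (fun n => hx (φ n)) hzc hzlim
  have hrm : ∀ n, MemLp (fun t => v n t - F t (x n t) - y t) 2 volume := fun n =>
    ((h n).memLp_deriv.sub (hF.memLp (h n).continuous (h n).memLp (hxb n))).sub hy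
  have hu2 : MemLp (fun t => F t (z t) + y t) 2 volume := (hF.memLp hzc hz2 hzb).add hy
  obtain ⟨K, hK, hFK⟩ := hF.lipschitz (4 * A)
  have hz : IsSobolevPair z fun t => F t (z t) + y t := by
    refine ⟨hz2, hu2, primitive_of_tendsto (fun n => h (φ n)) hzlim
      (hu2.locallyIntegrable (by norm_num)) fun a b hab ε hε => ?_⟩
    -- Half of ε is for the residual, half for the Lipschitz error of the field.
    set ε' : ℝ := ε / (2 * (K + 1) * (b - a + 1))
    have hba : 0 ≤ b - a := by linarith
    have hε' : 0 < ε' := by positivity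
    have h1 : ∀ᶠ n in atTop, √(b - a) *
        lpNorm (fun t => v (φ n) t - F t (x (φ n) t) - y t) 2 volume < ε / 2 := by
      have := (hr.comp hφt).const_mul (√(b - a))
      rw [mul_zero] at this
      exact this.eventually_lt_const (by positivity)
    filter_upwards [h1, Metric.tendstoUniformlyOn_iff.1 (hxz (Icc a b) isCompact_Icc) ε' hε']
      with n h1 h4
    have hri' := (intervalIntegrable_of_memLp_two (hrm (φ n)) a b).norm
    refine ⟨fun t => ‖v (φ n) t - F t (x (φ n) t) - y t‖ + K * ε', hri'.add (by simp),
      fun t ht => ?_, ?_⟩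
    · have e1 : v (φ n) t - (F t (z t) + y t) = (v (φ n) t - F t (x (φ n) t) - y t)
          + (F t (x (φ n) t) - F t (z t)) := by abel
      rw [e1]
      refine (norm_add_le _ _).trans (add_le_add le_rfl ((hFK _ _ _ (hxb _ _) (hzb t)).trans ?_))
      have := (h4 t ht).le
      rw [dist_comm, dist_eq_norm] at this
      exact mul_le_mul_of_nonneg_left this hK
    · rw [intervalIntegral.integral_add hri' (by simp), intervalIntegral.integral_const,
        smul_eq_mul]
      have h5 := (integral_norm_le_sqrt_mul_lpNorm (hrm (φ n)) hab).trans_lt h1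
      have h6 : (b - a) * (K * ε') ≤ ε / 2 := by
        have e2 : ε / 2 = (b - a + 1) * ((K + 1) * ε') := by
          simp only [ε']; field_simp
        rw [e2]
        gcongr <;> linarith
      linarith
  have hdecay : ∀ e : Filter ℝ, (∀ δ : ℝ, 0 < δ → ∀ᶠ p in atTop ×ˢ e, ‖x p.1 p.2‖ ≤ δ) →
      ∀ δ : ℝ, 0 < δ → ∀ᶠ p in atTop ×ˢ e, ‖x (φ p.1) p.2‖ ≤ δ := fun e H δ hδ =>
    (hφt.prodMap tendsto_id).eventually (H δ hδ)
  obtain ⟨χp, hχp, hχpm, hχpt⟩ := exists_cutoff_tendsto_lpNorm (.inl rfl) hp (fun n => h (φ n)) hz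
    (fun n => hrm (φ n)) (hr.comp hφt) hxz (hdecay _ fun δ hδ =>
      eventually_norm_le_of_isHyperbolicEnd hF (.inl rfl) hp h hx hv hy hr hδ)
  obtain ⟨χm, hχm, hχmm, hχmt⟩ := exists_cutoff_tendsto_lpNorm (.inr rfl) hm (fun n => h (φ n)) hz
    (fun n => hrm (φ n)) (hr.comp hφt) hxz (hdecay _ fun δ hδ =>
      eventually_norm_le_of_isHyperbolicEnd hF (.inr rfl) hm h hx hv hy hr hδ)
  obtain ⟨b, hb⟩ := eventually_atTop.1 hχp
  obtain ⟨a, ha⟩ := eventually_atBot.1 hχm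
  set R := max |a| |b|
  have hRb : b ≤ R := (le_abs_self b).trans (le_max_right _ _)
  have hRa : -R ≤ a := by
    have := (neg_le_abs a).trans (le_max_left |a| |b|)
    linarith
  have hR0 : 0 ≤ R := (abs_nonneg a).trans (le_max_left _ _)
  -- Outside [-R, R] one of the two cutoffs equals 1, so the difference is dominated by its middle
  -- part plus the two cut-off tails.
  set m : ℕ → ℝ → V := fun n => (Icc (-R) R).indicator fun t => x (φ n) t - z t
  have hwm : ∀ n, MemLp (fun t => x (φ n) t - z t) 2 volume := fun n => (h (φ n)).memLp.sub hz2
  have hmm : ∀ n, MemLp (m n) 2 volume := fun n => (hwm n).indicator measurableSet_Icc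
  have hmt : Tendsto (fun n => lpNorm (m n) 2 volume) atTop (𝓝 0) := by
    refine tendsto_lpNorm_of_tendstoUniformlyOn (a := -R) (b := R) (by linarith) ?_
      fun n t ht => indicator_of_notMem ht _
    rw [Metric.tendstoUniformlyOn_iff]
    intro η hη
    filter_upwards [Metric.tendstoUniformlyOn_iff.1 (hxz _ isCompact_Icc) η hη] with n hn t ht
    simpa [m, indicator_of_mem ht] using hn t ht
  have hxt : Tendsto (fun n => lpNorm (fun t => x (φ n) t - z t) 2 volume) atTop (𝓝 0) := by
    have hlim := (hmt.add hχpt).add hχmt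
    simp only [add_zero] at hlim
    refine squeeze_zero (fun n => lpNorm_nonneg) (fun n => ?_) hlim
    have hg1 := (hmm n).norm
    have hg2 := (hχpm n).norm
    have hg3 := (hχmm n).norm
    refine (lpNorm_mono_ae ((hg1.add hg2).add hg3) (.of_forall fun t => ?_)).trans ?_
    · refine le_trans ?_ (le_abs_self _)
      simp only [Pi.add_apply]
      by_cases ht : t ∈ Icc (-R) R
      · have : m n t = x (φ n) t - z t := indicator_of_mem ht _
        rw [this]
        linarith [norm_nonneg (χp t • (x (φ n) t - z t)), norm_nonneg (χm t • (x (φ n) t - z t))]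
      · rcases lt_or_ge t (-R) with h' | h'
        · rw [ha t (by linarith), one_smul]
          linarith [norm_nonneg (χp t • (x (φ n) t - z t)), norm_nonneg (m n t)]
        · have : R < t := by
            by_contra h''
            exact ht ⟨h', not_lt.1 h''⟩
          rw [hb t (by linarith), one_smul]
          linarith [norm_nonneg (χm t • (x (φ n) t - z t)), norm_nonneg (m n t)]
    · refine (lpNorm_add_le (hg1.add hg2) (by norm_num)).trans (add_le_add
        ((lpNorm_add_le hg1 (by norm_num)).trans (le_of_eq ?_)) (le_of_eq ?_))
      · rw [lpNorm_norm (hmm n).aestronglyMeasurable, lpNorm_norm (hχpm n).aestronglyMeasurable]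
      · rw [lpNorm_norm (hχmm n).aestronglyMeasurable]
  refine ⟨φ, hφ, z, _, hz, hxt, ?_⟩
  -- The equation expresses the derivatives through the residual and the Lipschitz field, so their
  -- convergence follows from that of the functions.
  have hlim := (hr.comp hφt).add (hxt.const_mul K)
  simp only [mul_zero, add_zero] at hlim
  refine squeeze_zero (fun n => lpNorm_nonneg) (fun n => ?_) hlim
  have hg1 := (hrm (φ n)).norm
  have hg2 := (hwm n).norm.const_smul K
  refine (lpNorm_mono_ae (hg1.add hg2) (.of_forall fun t => ?_)).trans ?_
  · refine le_trans ?_ (le_abs_self _)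
    have e1 : v (φ n) t - (F t (z t) + y t) = (v (φ n) t - F t (x (φ n) t) - y t)
          + (F t (x (φ n) t) - F t (z t)) := by abel
    rw [e1]
    exact (norm_add_le _ _).trans (add_le_add le_rfl (hFK _ _ _ (hxb _ _) (hzb t)))
  · refine (lpNorm_add_le hg1 (by norm_num)).trans (add_le_add (le_of_eq ?_) (le_of_eq ?_))
    · rw [lpNorm_norm (hrm (φ n)).aestronglyMeasurable]; rfl
    · rw [lpNorm_const_smul, lpNorm_norm (hwm n).aestronglyMeasurable, coe_nnnorm,
        Real.norm_of_nonneg hK]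

end Compactness

/-! ## Equicontinuous families -/

section Equicontinuity

variable {ι Q W : Type*} [NormedAddCommGroup Q] [NormedSpace ℝ Q] [FiniteDimensional ℝ Q]
  [NormedAddCommGroup W]

/-- The points at which the family is bounded form a clopen set, hence everything by connectedness;
compactness of balls then makes the bound uniform. -/
lemma exists_bound_of_equicontinuous {f : ι → Q → W} (hf : Equicontinuous f) {q₀ : Q}
    (h0 : ∃ C, ∀ t, ‖f t q₀‖ ≤ C) (R : ℝ) :
    ∃ C, 0 ≤ C ∧ ∀ t q, ‖q‖ ≤ R → ‖f t q‖ ≤ C := by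
  have hnear : ∀ q, ∀ᶠ q' in 𝓝 q, ∀ t, dist (f t q) (f t q') < 1 := fun q =>
    Metric.equicontinuousAt_iff_right.1 (hf q) 1 one_pos
  set S : Set Q := {q | ∃ C, ∀ t, ‖f t q‖ ≤ C}
  have hS : IsClopen S := by
    refine ⟨⟨isOpen_iff_mem_nhds.2 fun q hq => ?_⟩, isOpen_iff_mem_nhds.2 fun q ⟨C, hC⟩ => ?_⟩
    · filter_upwards [hnear q] with q' hq' ⟨C, hC⟩
      refine hq ⟨C + 1, fun t => ?_⟩
      have h1 := norm_le_norm_add_norm_sub' (f t q) (f t q')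
      have h2 := hq' t
      rw [dist_eq_norm] at h2
      linarith [hC t]
    · filter_upwards [hnear q] with q' hq'
      refine ⟨C + 1, fun t => ?_⟩
      have h1 := norm_le_norm_add_norm_sub' (f t q') (f t q)
      have h2 := hq' t
      rw [dist_comm, dist_eq_norm] at h2
      linarith [hC t]
  have hSu : S = univ := hS.eq_univ ⟨q₀, h0⟩
  have hK : ∃ C, ∀ t, ∀ q ∈ Metric.closedBall (0 : Q) R, ‖f t q‖ ≤ C := by
    refine (isCompact_closedBall (0 : Q) R).induction_on
      (p := fun s => ∃ C, ∀ t, ∀ q ∈ s, ‖f t q‖ ≤ C) ⟨0, by simp⟩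
      (fun s t hst ⟨C, hC⟩ => ⟨C, fun r q hq => hC r q (hst hq)⟩)
      (fun s t ⟨C, hC⟩ ⟨D, hD⟩ => ⟨max C D, fun r q hq => hq.elim
        (fun h => (hC r q h).trans (le_max_left _ _))
        (fun h => (hD r q h).trans (le_max_right _ _))⟩) fun q _ => ?_
    obtain ⟨C, hC⟩ : q ∈ S := hSu ▸ mem_univ q
    refine ⟨_, mem_nhdsWithin_of_mem_nhds (hnear q), C + 1, fun t q' hq' => ?_⟩
    have h1 := norm_le_norm_add_norm_sub' (f t q') (f t q)
    have h2 := hq' t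
    rw [dist_comm, dist_eq_norm] at h2
    linarith [hC t]
  obtain ⟨C, hC⟩ := hK
  exact ⟨max C 0, le_max_right _ _, fun t q hq =>
    (hC t q (by simpa using hq)).trans (le_max_left _ _)⟩

lemma exists_modulus_of_equicontinuous {f : ι → Q → W} (hf : Equicontinuous f) (R : ℝ) {ε : ℝ}
    (hε : 0 < ε) : ∃ δ, 0 < δ ∧ ∀ t q q', ‖q‖ ≤ R → ‖q'‖ ≤ R → ‖q - q'‖ ≤ δ →
      ‖f t q - f t q'‖ ≤ ε := by
  have : CompactSpace (Metric.closedBall (0 : Q) R) :=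
    isCompact_iff_compactSpace.1 (isCompact_closedBall _ _)
  have h1 : Equicontinuous fun t (q : Metric.closedBall (0 : Q) R) => f t q := by
    intro q U hU
    exact continuous_subtype_val.continuousAt.eventually (hf q U hU)
  have h2 := CompactSpace.uniformEquicontinuous_of_equicontinuous h1
  obtain ⟨δ, hδ, h⟩ := Metric.uniformEquicontinuous_iff.1 h2 ε hε
  refine ⟨δ / 2, by positivity, fun t q q' hq hq' hqq => ?_⟩
  have := h ⟨q, by simpa using hq⟩ ⟨q', by simpa using hq'⟩ (by
    rw [Subtype.dist_eq, dist_eq_norm]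
    change ‖q - q'‖ < δ
    linarith) t
  rw [dist_eq_norm] at this
  exact this.le

end Equicontinuity

/-! ## Fields with uniformly controlled derivatives -/

section SmoothField

variable {V : Type*} [NormedAddCommGroup V] [NormedSpace ℝ V]

/-- A function `D(t, ξ, l)` that is bounded and uniformly continuous in `(ξ, l)` on bounded sets,
uniformly in `t`. -/
structure IsTame {W : Type*} [NormedAddCommGroup W] (D : ℝ → V → ℝ → W) : Prop where
  continuous : Continuous fun p : ℝ × V × ℝ => D p.1 p.2.1 p.2.2
  bound : ∀ R : ℝ, ∃ C, 0 ≤ C ∧ ∀ t ξ l, ‖ξ‖ ≤ R → |l| ≤ R → ‖D t ξ l‖ ≤ C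
  modulus : ∀ R ε : ℝ, 0 < ε → ∃ δ, 0 < δ ∧ ∀ t ξ η l m, ‖ξ‖ ≤ R → ‖η‖ ≤ R → |l| ≤ R → |m| ≤ R →
    ‖ξ - η‖ ≤ δ → |l - m| ≤ δ → ‖D t ξ l - D t η m‖ ≤ ε

/-- A field `f(t, ξ, l)` vanishing at `ξ = 0`, with tame derivatives `D = D_ξ f` and
`D' = D_l D_ξ f = D_ξ D_l f`. -/
structure IsSmoothField (f : ℝ → V → ℝ → V) (D : ℝ → V → ℝ → V →L[ℝ] V) (f' : ℝ → V → ℝ → V)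
    (D' : ℝ → V → ℝ → V →L[ℝ] V) : Prop where
  zero : ∀ t l, f t 0 l = 0
  continuous : Continuous fun p : ℝ × V × ℝ => f p.1 p.2.1 p.2.2
  continuous' : Continuous fun p : ℝ × V × ℝ => f' p.1 p.2.1 p.2.2
  hasFDerivAt : ∀ t ξ l, HasFDerivAt (fun η => f t η l) (D t ξ l) ξ
  hasDerivAt : ∀ t ξ l, HasDerivAt (fun m => f t ξ m) (f' t ξ l) l
  hasFDerivAt' : ∀ t ξ l, HasFDerivAt (fun η => f' t η l) (D' t ξ l) ξ
  tame : IsTame D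
  tame' : IsTame D'

namespace IsSmoothField

variable {f : ℝ → V → ℝ → V} {D : ℝ → V → ℝ → V →L[ℝ] V} {f' : ℝ → V → ℝ → V}
  {D' : ℝ → V → ℝ → V →L[ℝ] V}

lemma zero' (h : IsSmoothField f D f' D') (t l : ℝ) : f' t 0 l = 0 := by
  have h1 := h.hasDerivAt t 0 l
  simp only [h.zero] at h1
  exact h1.unique (hasDerivAt_const l 0)

lemma lipschitz (h : IsSmoothField f D f' D') (R : ℝ) : ∃ K, 0 ≤ K ∧ ∀ t ξ η l, ‖ξ‖ ≤ R →
    ‖η‖ ≤ R → |l| ≤ R → ‖f t ξ l - f t η l‖ ≤ K * ‖ξ - η‖ := by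
  obtain ⟨C, hC, hD⟩ := h.tame.bound R
  refine ⟨C, hC, fun t ξ η l hξ hη hl => ?_⟩
  exact Convex.norm_image_sub_le_of_norm_hasFDerivWithin_le (s := Metric.closedBall 0 R)
    (fun ζ _ => (h.hasFDerivAt t ζ l).hasFDerivWithinAt)
    (fun ζ hζ => hD t ζ l (by simpa using hζ) hl) (convex_closedBall _ _) (by simpa using hη)
    (by simpa using hξ)

lemma lipschitz' (h : IsSmoothField f D f' D') (R : ℝ) : ∃ K, 0 ≤ K ∧ ∀ t ξ η l, ‖ξ‖ ≤ R →
    ‖η‖ ≤ R → |l| ≤ R → ‖f' t ξ l - f' t η l‖ ≤ K * ‖ξ - η‖ := by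
  obtain ⟨C, hC, hD⟩ := h.tame'.bound R
  refine ⟨C, hC, fun t ξ η l hξ hη hl => ?_⟩
  exact Convex.norm_image_sub_le_of_norm_hasFDerivWithin_le (s := Metric.closedBall 0 R)
    (fun ζ _ => (h.hasFDerivAt' t ζ l).hasFDerivWithinAt)
    (fun ζ hζ => hD t ζ l (by simpa using hζ) hl) (convex_closedBall _ _) (by simpa using hη)
    (by simpa using hξ)

/-- First order expansion in `ξ`. -/
lemma expand_fst (h : IsSmoothField f D f' D') (R ε : ℝ) (hε : 0 < ε) : ∃ δ, 0 < δ ∧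
    ∀ t ξ η l, ‖ξ‖ ≤ R → ‖η‖ ≤ R → |l| ≤ R → ‖η - ξ‖ ≤ δ →
      ‖f t η l - f t ξ l - D t ξ l (η - ξ)‖ ≤ ε * ‖η - ξ‖ := by
  obtain ⟨δ, hδ, hD⟩ := h.tame.modulus R ε hε
  refine ⟨δ, hδ, fun t ξ η l hξ hη hl hd => ?_⟩
  refine Convex.norm_image_sub_le_of_norm_hasFDerivWithin_le' (f' := fun ζ => D t ζ l)
    (s := Metric.closedBall 0 R ∩ Metric.closedBall ξ δ)
    (fun ζ _ => (h.hasFDerivAt t ζ l).hasFDerivWithinAt)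
    (fun ζ hζ => hD t ζ ξ l l (by simpa using hζ.1) hξ hl hl
      (by simpa [dist_eq_norm] using hζ.2) (by simpa using hδ.le))
    ((convex_closedBall _ _).inter (convex_closedBall _ _)) ⟨by simpa using hξ, by simpa using hδ.le⟩
    ⟨by simpa using hη, by simpa [dist_eq_norm] using hd⟩

/-- Modulus of continuity of `D_l f` in `l`. -/
lemma modulus_snd' (h : IsSmoothField f D f' D') (R ε : ℝ) (hε : 0 < ε) : ∃ δ, 0 < δ ∧
    ∀ t ξ l m, ‖ξ‖ ≤ R → |l| ≤ R → |m| ≤ R → |m - l| ≤ δ →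
      ‖f' t ξ m - f' t ξ l‖ ≤ ε * ‖ξ‖ := by
  obtain ⟨δ, hδ, hD⟩ := h.tame'.modulus R ε hε
  refine ⟨δ, hδ, fun t ξ l m hξ hl hm hd => ?_⟩
  -- The difference vanishes at ξ = 0, so the mean value inequality starting there yields the factor
  -- ‖ξ‖, which is what becomes an L² norm later.
  have h1 := Convex.norm_image_sub_le_of_norm_hasFDerivWithin_le (C := ε) (x := 0) (y := ξ)
    (f := fun η => f' t η m - f' t η l) (f' := fun ζ => D' t ζ m - D' t ζ l)
    (s := Metric.closedBall 0 R)
    (fun ζ _ => ((h.hasFDerivAt' t ζ m).sub (h.hasFDerivAt' t ζ l)).hasFDerivWithinAt)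
    (fun ζ hζ => hD t ζ ζ m l (by simpa using hζ) (by simpa using hζ) hm hl (by simpa using hδ.le)
      hd) (convex_closedBall _ _) (by simpa using (norm_nonneg ξ).trans hξ) (by simpa using hξ)
  simpa [h.zero'] using h1

/-- First order expansion in `l`. -/
lemma expand_snd (h : IsSmoothField f D f' D') (R ε : ℝ) (hε : 0 < ε) : ∃ δ, 0 < δ ∧
    ∀ t ξ l m, ‖ξ‖ ≤ R → |l| ≤ R → |m| ≤ R → |m - l| ≤ δ →
      ‖f t ξ m - f t ξ l - (m - l) • f' t ξ l‖ ≤ ε * |m - l| * ‖ξ‖ := by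
  obtain ⟨δ, hδ, hD⟩ := h.modulus_snd' R ε hε
  refine ⟨δ, hδ, fun t ξ l m hξ hl hm hd => ?_⟩
  have h1 := Convex.norm_image_sub_le_of_norm_hasDerivWithin_le (C := ε * ‖ξ‖) (x := l) (y := m)
    (f := fun k => f t ξ k - (k - l) • f' t ξ l) (f' := fun k => f' t ξ k - (1 : ℝ) • f' t ξ l)
    (s := Metric.closedBall 0 R ∩ Metric.closedBall l δ)
    (fun k _ => ((h.hasDerivAt t ξ k).sub
      (((hasDerivAt_id k).sub_const l).smul_const _)).hasDerivWithinAt)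
    (fun k hk => by
      rw [one_smul]
      exact hD t ξ l k hξ hl (by simpa using hk.1) (by simpa [Real.dist_eq] using hk.2))
    ((convex_closedBall _ _).inter (convex_closedBall _ _)) ⟨by simpa using hl, by simpa using hδ.le⟩
    ⟨by simpa using hm, by simpa [Real.dist_eq] using hd⟩
  rw [sub_self, zero_smul, sub_zero, Real.norm_eq_abs] at h1
  calc _ = ‖f t ξ m - (m - l) • f' t ξ l - f t ξ l‖ := by congr 1; abel
    _ ≤ _ := h1
    _ = _ := by ring

end IsSmoothField

end SmoothField

/-! ### The Hamiltonian gradient is a smooth field -/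

section Hamiltonian

variable {N : ℕ} {H : ℝ → PhaseSpace N → ℝ → ℝ}

lemma IsTame.of_equicontinuous {W : Type*} [NormedAddCommGroup W]
    {D : ℝ → PhaseSpace N → ℝ → W}
    (hc : Continuous fun p : ℝ × PhaseSpace N × ℝ => D p.1 p.2.1 p.2.2)
    (he : Equicontinuous fun (t : ℝ) (q : PhaseSpace N × ℝ) => D t q.1 q.2)
    (hb : ∃ C, ∀ t, ‖D t 0 0‖ ≤ C) : IsTame D where
  continuous := hc
  bound R := by
    obtain ⟨C, hC, h⟩ := exists_bound_of_equicontinuous he (q₀ := 0) hb R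
    exact ⟨C, hC, fun t ξ l hξ hl => h t (ξ, l) (max_le hξ hl)⟩
  modulus R ε hε := by
    obtain ⟨δ, hδ, h⟩ := exists_modulus_of_equicontinuous he R hε
    exact ⟨δ, hδ, fun t ξ η l m hξ hη hl hm h1 h2 =>
      h t (ξ, l) (η, m) (max_le hξ hl) (max_le hη hm) (max_le h1 h2)⟩

/-- The set where the essential bound holds is closed by continuity and dense because its complement
is null. -/
lemma exists_bound_of_memLp_top {W : Type*} [NormedAddCommGroup W] {a : ℝ → W}
    (hc : Continuous a) (ha : MemLp a ⊤ volume) : ∃ C, ∀ t, ‖a t‖ ≤ C := by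
  refine ⟨lpNorm a ⊤ volume, fun t => ?_⟩
  have h1 := ae_le_lpNorm_exponent_top ha
  have h2 : IsClosed {t | ‖a t‖ ≤ lpNorm a ⊤ volume} := isClosed_le hc.norm continuous_const
  have h3 : Dense {t | ‖a t‖ ≤ lpNorm a ⊤ volume} := Measure.dense_of_ae h1
  have := h2.closure_eq ▸ h3.closure_eq
  exact (this ▸ mem_univ t : t ∈ {t | ‖a t‖ ≤ lpNorm a ⊤ volume})

lemma HamiltonianHyp.hasFDerivAt_DxH (hH : HamiltonianHyp H) (t : ℝ) (ξ : PhaseSpace N) (l : ℝ) :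
    HasFDerivAt (fun η => DxH H t η l) (DxxH H t ξ l) ξ :=
  ((hH.bundle_DxH l).2.1 t ξ).hasFDerivAt

lemma HamiltonianHyp.hasDerivAt_DxxH (hH : HamiltonianHyp H) (t : ℝ) (ξ : PhaseSpace N) (l : ℝ) :
    HasDerivAt (fun m => DxxH H t ξ m) (DlDxxH H t ξ l) l :=
  (hH.exists_DlDxxH t ξ l).hasDerivAt

/-- The mixed derivatives `D_ξ D_l D_ξ H` and `D_l D_ξ² H` agree. -/
lemma HamiltonianHyp.hasFDerivAt_DlDxH (hH : HamiltonianHyp H) (t : ℝ) (ξ : PhaseSpace N)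
    (l : ℝ) : HasFDerivAt (fun η => DlDxH H t η l) (DlDxxH H t ξ l) ξ := by
  -- Difference quotients in l converge pointwise to D_l D_ξ H, and their ξ-derivatives converge
  -- uniformly near ξ by joint continuity of D_l D_ξ² H; limit and ξ-derivative may be exchanged.
  refine hasFDerivAt_of_tendstoUniformlyOnFilter (l := 𝓝[≠] (0 : ℝ))
    (f := fun h η => h⁻¹ • (DxH H t η (l + h) - DxH H t η l))
    (f' := fun h η => h⁻¹ • (DxxH H t η (l + h) - DxxH H t η l))
    (g' := fun η => DlDxxH H t η l) ?_ (.of_forall fun p => ?_) (.of_forall fun η => ?_)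
  · rw [Metric.tendstoUniformlyOnFilter_iff]
    intro ε hε
    have hcont : Continuous fun p : ℝ × PhaseSpace N => DlDxxH H t p.2 (l + p.1) :=
      hH.continuous_DlDxxH.comp (f := fun p : ℝ × PhaseSpace N => (t, p.2, l + p.1)) (by fun_prop)
    obtain ⟨δ, hδ, hb⟩ := Metric.continuousAt_iff.1 (hcont.continuousAt (x := (0, ξ))) (ε / 3)
      (by positivity)
    have ha : ∀ᶠ h in 𝓝[≠] (0:ℝ), h ∈ Metric.ball (0:ℝ) δ :=
      mem_nhdsWithin_of_mem_nhds (Metric.ball_mem_nhds _ hδ)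
    have h1 : ∀ᶠ h in 𝓝[≠] (0:ℝ), h ∈ Metric.ball (0:ℝ) δ ∧ h ≠ 0 :=
      ha.and self_mem_nhdsWithin
    filter_upwards [h1.prod_mk (Metric.ball_mem_nhds ξ hδ)] with p ⟨⟨hp1, hp0⟩, hp2⟩
    obtain ⟨h, η⟩ := p
    simp only at hp1 hp0 hp2 ⊢
    have hnear : ∀ k ∈ Metric.ball (0:ℝ) δ,
        dist (DlDxxH H t η (l + k)) (DlDxxH H t ξ (l + 0)) < ε / 3 := fun k hk =>
      hb (x := (k, η)) (max_lt hk hp2)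
    have h2 : ∀ k ∈ Metric.ball (0:ℝ) δ,
        ‖DlDxxH H t η (l + k) - (1 : ℝ) • DlDxxH H t η l‖ ≤ 2 * ε / 3 := by
      intro k hk
      have e1 := hnear k hk
      have e2 := hnear 0 (Metric.mem_ball_self hδ)
      simp only [add_zero] at e1 e2
      rw [one_smul, ← dist_eq_norm]
      have := dist_triangle_right (DlDxxH H t η (l + k)) (DlDxxH H t η l) (DlDxxH H t ξ l)
      linarith
    have h3 := Convex.norm_image_sub_le_of_norm_hasDerivWithin_le (C := 2 * ε / 3) (x := 0) (y := h)
      (f := fun k => DxxH H t η (l + k) - k • DlDxxH H t η l)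
      (f' := fun k => DlDxxH H t η (l + k) - (1 : ℝ) • DlDxxH H t η l)
      (s := Metric.ball (0:ℝ) δ)
      (fun k _ => (((hH.hasDerivAt_DxxH t η (l + k)).comp_const_add l k).sub
        ((hasDerivAt_id k).smul_const _)).hasDerivWithinAt) h2 (convex_ball _ _)
        (Metric.mem_ball_self hδ) hp1
    have h30 : DxxH H t η (l + 0) - (0 : ℝ) • DlDxxH H t η l = DxxH H t η l := by
      ext1 w
      rw [add_zero, sub_apply, smul_apply, zero_smul,
        sub_zero]
    rw [h30, sub_zero] at h3
    rw [dist_comm, dist_eq_norm]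
    have e3 : h⁻¹ • (DxxH H t η (l + h) - DxxH H t η l) - DlDxxH H t η l
        = h⁻¹ • (DxxH H t η (l + h) - h • DlDxxH H t η l - DxxH H t η l) := by
      rw [sub_right_comm, smul_sub _ _ (h • _), inv_smul_smul₀ hp0]
    rw [e3, norm_smul, norm_inv, inv_mul_lt_iff₀ (norm_pos_iff.2 hp0)]
    have : 0 < ‖h‖ := norm_pos_iff.2 hp0
    nlinarith
  · exact ((hH.hasFDerivAt_DxH t p.2 (l + p.1)).sub
      (hH.hasFDerivAt_DxH t p.2 l)).const_smul p.1⁻¹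
  · exact hasDerivAt_iff_tendsto_slope_zero.1 (hH.exists_DlDxH t η l).hasDerivAt

lemma HamiltonianHyp.isTame_DlDxxH (hH : HamiltonianHyp H) : IsTame (DlDxxH H) :=
  .of_equicontinuous hH.continuous_DlDxxH hH.bundle_DlDxxH.2
    (exists_bound_of_memLp_top (hH.continuous_DlDxxH.comp
      (f := fun t : ℝ => ((t, 0, 0) : ℝ × PhaseSpace N × ℝ)) (by fun_prop)) hH.bounded_DlDxxH)

/-- Equicontinuity in ξ is assumed for each fixed l only; the locally uniform bound on D_l D_ξ² H
adds Lipschitz dependence on l and makes it joint. -/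
lemma HamiltonianHyp.isTame_DxxH (hH : HamiltonianHyp H) : IsTame (DxxH H) := by
  refine .of_equicontinuous hH.continuous_DxxH ?_
    (exists_bound_of_memLp_top (hH.continuous_DxxH.comp
      (f := fun t : ℝ => ((t, 0, 0) : ℝ × PhaseSpace N × ℝ)) (by fun_prop)) hH.bounded_DxxH)
  rintro ⟨ξ, l⟩
  rw [Metric.equicontinuousAt_iff_right]
  intro ε hε
  obtain ⟨C, hC, hb⟩ := hH.isTame_DlDxxH.bound (max (‖ξ‖ + 1) (|l| + 1))
  have h1 : ∀ᶠ η in 𝓝 ξ, ∀ t, dist (DxxH H t ξ l) (DxxH H t η l) < ε / 2 :=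
    Metric.equicontinuousAt_iff_right.1 ((hH.bundle_DxH l).2.2.2 ξ) (ε / 2) (by positivity)
  have h2 : ∀ᶠ m in 𝓝 l, |m - l| < min 1 (ε / (2 * (C + 1))) := by
    have := Metric.ball_mem_nhds l (ε := min 1 (ε / (2 * (C + 1)))) (by positivity)
    filter_upwards [this] with m hm
    simpa [Real.dist_eq] using hm
  rw [nhds_prod_eq]
  filter_upwards [(h1.and (Metric.ball_mem_nhds ξ one_pos)).prod_mk h2] with p ⟨⟨hp1, hp2⟩, hp3⟩ t
  obtain ⟨η, m⟩ := p
  simp only at hp1 hp2 hp3 ⊢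
  have hη : ‖η‖ ≤ max (‖ξ‖ + 1) (|l| + 1) := by
    refine le_trans ?_ (le_max_left _ _)
    have := norm_le_norm_add_norm_sub' η ξ
    rw [dist_eq_norm] at hp2
    linarith
  have h4 := Convex.norm_image_sub_le_of_norm_hasDerivWithin_le (C := C) (x := l) (y := m)
    (f := fun k => DxxH H t η k) (f' := fun k => DlDxxH H t η k)
    (s := Metric.closedBall l 1) (fun k _ => (hH.hasDerivAt_DxxH t η k).hasDerivWithinAt)
    (fun k hk => hb t η k hη (by
      refine le_trans ?_ (le_max_right _ _)
      rw [Metric.mem_closedBall, Real.dist_eq] at hk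
      have := abs_sub_abs_le_abs_sub k l
      linarith)) (convex_closedBall _ _) (by simp) (by
      rw [Metric.mem_closedBall, Real.dist_eq]
      exact hp3.le.trans (min_le_left _ _))
  have h5 : ‖DxxH H t η m - DxxH H t η l‖ < ε / 2 := by
    refine h4.trans_lt ?_
    rw [Real.norm_eq_abs]
    have h6 := hp3.trans_le (min_le_right _ _)
    rw [lt_div_iff₀ (by positivity)] at h6
    nlinarith [abs_nonneg (m - l)]
  calc dist (DxxH H t ξ l) (DxxH H t η m)
      ≤ dist (DxxH H t ξ l) (DxxH H t η l) + dist (DxxH H t η l) (DxxH H t η m) :=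
        dist_triangle _ _ _
    _ < ε / 2 + ε / 2 := by
        refine add_lt_add (hp1 t) ?_
        rw [dist_comm, dist_eq_norm]
        exact h5
    _ = ε := by ring

lemma HamiltonianHyp.isSmoothField (hH : HamiltonianHyp H) :
    IsSmoothField (DxH H) (DxxH H) (DlDxH H) (DlDxxH H) where
  zero := hH.DxH_zero
  continuous := hH.continuous_DxH
  continuous' := hH.continuous_DlDxH
  hasFDerivAt := hH.hasFDerivAt_DxH
  hasDerivAt t ξ l := (hH.exists_DlDxH t ξ l).hasDerivAt
  hasFDerivAt' := hH.hasFDerivAt_DlDxH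
  tame := hH.isTame_DxxH
  tame' := hH.isTame_DlDxxH

/-- Symmetry of the Hessian of H; the self-adjointness behind index zero comes from here. -/
lemma HamiltonianHyp.inner_DxxH_comm (hH : HamiltonianHyp H) (t : ℝ) (ξ : PhaseSpace N) (l : ℝ)
    (u v : PhaseSpace N) :
    inner ℝ (DxxH H t ξ l u) v = inner ℝ u (DxxH H t ξ l v) := by
  set h : PhaseSpace N → ℝ := fun η => H t η l
  have hh : ContDiff ℝ 2 h := hH.contDiff t l
  have hsymm := hh.contDiffAt (x := ξ) |>.isSymmSndFDerivAt (by simp)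
  have hd : DifferentiableAt ℝ (fderiv ℝ h) ξ :=
    ((hh.fderiv_right (m := 1) (by norm_num)).differentiable one_ne_zero) ξ
  have e : ∀ w z, inner ℝ (DxxH H t ξ l w) z = fderiv ℝ (fderiv ℝ h) ξ w z := by
    intro w z
    have h0 : ∀ η, inner ℝ (DxH H t η l) z = fderiv ℝ h η z := fun η => by
      rw [DxH, gradient, InnerProductSpace.toDual_symm_apply]
    have h1 := (hH.hasFDerivAt_DxH t ξ l).inner ℝ (hasFDerivAt_const z ξ)
    have h2 := hd.hasFDerivAt.clm_apply (hasFDerivAt_const z ξ)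
    simp only [h0] at h1
    have h3 := congrArg (fun L => L w) (h1.unique h2)
    simpa using h3
  rw [e u v, real_inner_comm, e v u]
  exact hsymm u v

end Hamiltonian

/-! ## Nemytskii operators on `H¹` -/

section Representatives

variable {N : ℕ}

lemma H1.norm_toL2_le (u : H1 N) : ‖u.toL2‖ ≤ ‖u‖ := by
  refine abs_le_of_sq_le_sq' ?_ (norm_nonneg _) |>.2
  rw [u.norm_sq]
  nlinarith [sq_nonneg ‖u.weakDeriv‖]

lemma H1.norm_weakDeriv_le (u : H1 N) : ‖u.weakDeriv‖ ≤ ‖u‖ := by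
  refine abs_le_of_sq_le_sq' ?_ (norm_nonneg _) |>.2
  rw [u.norm_sq]
  nlinarith [sq_nonneg ‖u.toL2‖]

lemma H1.norm_le_add (u : H1 N) : ‖u‖ ≤ ‖u.toL2‖ + ‖u.weakDeriv‖ := by
  refine abs_le_of_sq_le_sq' ?_ (by positivity) |>.2
  rw [u.norm_sq]
  nlinarith [mul_nonneg (norm_nonneg u.toL2) (norm_nonneg u.weakDeriv)]

lemma H1.lpNorm_rep (u : H1 N) : lpNorm u.rep 2 volume = ‖u.toL2‖ := by
  rw [lp_norm_eq_lpNorm]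
  exact (lpNorm_congr_ae u.toL2_ae_eq).symm

lemma H1.norm_rep_le (u : H1 N) (t : ℝ) : ‖u.rep t‖ ≤ 4 * ‖u‖ := by
  have h1 := u.isSobolevPair.norm_le t
  rw [u.lpNorm_rep, ← lp_norm_eq_lpNorm] at h1
  linarith [u.norm_toL2_le, u.norm_weakDeriv_le]

/-- Representatives are chosen, but continuous functions that agree almost everywhere agree
everywhere. -/
lemma H1.rep_sub (u v : H1 N) (t : ℝ) : (u - v).rep t = u.rep t - v.rep t := by
  have h : (u - v).rep =ᵐ[volume] fun t => u.rep t - v.rep t := by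
    have h1 : (u - v).toL2 = u.toL2 - v.toL2 := rfl
    have h2 := (u - v).toL2_ae_eq
    rw [h1] at h2
    filter_upwards [h2, u.toL2_ae_eq, v.toL2_ae_eq, Lp.coeFn_sub u.toL2 v.toL2]
      with t e1 e2 e3 e4
    rw [← e1, e4, Pi.sub_apply, e2, e3]
  exact congrFun ((u - v).isSobolevPair.continuous.ae_eq_iff_eq volume
    (u.isSobolevPair.continuous.sub v.isSobolevPair.continuous) |>.1 h) t

end Representatives

/-! ### Multiplication operators on L² -/

section Multiplication

variable {V : Type*} [NormedAddCommGroup V] [NormedSpace ℝ V]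

lemma memLp_bcf_apply (a : BoundedContinuousFunction ℝ (V →L[ℝ] V)) (w : Lp V 2 (volume : Measure ℝ)) :
    MemLp (fun t => a t (w t)) 2 volume := by
  refine (Lp.memLp w).of_le_mul (c := ‖a‖) ?_ (.of_forall fun t => ?_)
  · exact isBoundedBilinearMap_apply.continuous.comp_aestronglyMeasurable
      (a.continuous.aestronglyMeasurable.prodMk (Lp.aestronglyMeasurable w))
  · exact (a t).le_of_opNorm_le (a.norm_coe_le_norm t) _

/-- Multiplication of `L²` functions by bounded continuous families of operators. -/
def mulL : BoundedContinuousFunction ℝ (V →L[ℝ] V) →L[ℝ]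
    Lp V 2 (volume : Measure ℝ) →L[ℝ] Lp V 2 (volume : Measure ℝ) :=
  LinearMap.mkContinuous₂ (LinearMap.mk₂ ℝ
    (fun (a : BoundedContinuousFunction ℝ (V →L[ℝ] V)) (w : Lp V 2 (volume : Measure ℝ)) =>
      (memLp_bcf_apply a w).toLp _)
    (fun a b w => by
      rw [← MemLp.toLp_add]
      exact MemLp.toLp_congr _ _ (.of_forall fun t => rfl))
    (fun c a w => by
      rw [← MemLp.toLp_const_smul]
      exact MemLp.toLp_congr _ _ (.of_forall fun t => rfl))
    (fun a w z => by
      rw [← MemLp.toLp_add]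
      refine MemLp.toLp_congr _ _ ?_
      filter_upwards [Lp.coeFn_add w z] with t ht
      rw [ht, Pi.add_apply, map_add, Pi.add_apply])
    (fun c a w => by
      rw [← MemLp.toLp_const_smul]
      refine MemLp.toLp_congr _ _ ?_
      filter_upwards [Lp.coeFn_smul c w] with t ht
      rw [ht, Pi.smul_apply, map_smul, Pi.smul_apply])) 1 fun a w => by
    rw [one_mul]
    refine Lp.norm_le_mul_norm_of_ae_le_mul ?_
    filter_upwards [(memLp_bcf_apply a w).coeFn_toLp] with t ht
    rw [LinearMap.mk₂_apply, ht]
    exact (a t).le_of_opNorm_le (a.norm_coe_le_norm t) _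

lemma coeFn_mulL (a : BoundedContinuousFunction ℝ (V →L[ℝ] V)) (w : Lp V 2 (volume : Measure ℝ)) :
    mulL a w =ᵐ[volume] fun t => a t (w t) :=
  (memLp_bcf_apply a w).coeFn_toLp

end Multiplication

/-! ### Continuous differentiability of the superposition operator -/

namespace IsSmoothField

variable {N : ℕ} {f : ℝ → PhaseSpace N → ℝ → PhaseSpace N}
  {D : ℝ → PhaseSpace N → ℝ → PhaseSpace N →L[ℝ] PhaseSpace N}
  {f' : ℝ → PhaseSpace N → ℝ → PhaseSpace N}
  {D' : ℝ → PhaseSpace N → ℝ → PhaseSpace N →L[ℝ] PhaseSpace N}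

lemma memLp (h : IsSmoothField f D f' D') (l : ℝ) (u : H1 N) :
    MemLp (fun t => f t (u.rep t) l) 2 volume := by
  obtain ⟨K, hK, hl⟩ := h.lipschitz (4 * ‖u‖ + |l|)
  have hc := u.isSobolevPair.continuous
  refine u.isSobolevPair.memLp.of_le_mul (c := K) (h.continuous.comp
    (f := fun t : ℝ => (t, u.rep t, l)) (by fun_prop)).aestronglyMeasurable (.of_forall fun t => ?_)
  have := hl t (u.rep t) 0 l (by linarith [u.norm_rep_le t, abs_nonneg l])
    (by rw [norm_zero]; positivity) (by linarith [norm_nonneg u])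
  simpa [h.zero] using this

lemma memLp' (h : IsSmoothField f D f' D') (l : ℝ) (u : H1 N) :
    MemLp (fun t => f' t (u.rep t) l) 2 volume := by
  obtain ⟨K, hK, hl⟩ := h.lipschitz' (4 * ‖u‖ + |l|)
  have hc := u.isSobolevPair.continuous
  refine u.isSobolevPair.memLp.of_le_mul (c := K) (h.continuous'.comp
    (f := fun t : ℝ => (t, u.rep t, l)) (by fun_prop)).aestronglyMeasurable (.of_forall fun t => ?_)
  have := hl t (u.rep t) 0 l (by linarith [u.norm_rep_le t, abs_nonneg l])
    (by rw [norm_zero]; positivity) (by linarith [norm_nonneg u])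
  simpa [h.zero'] using this

lemma exists_bound_comp (h : IsSmoothField f D f' D') (l : ℝ) (u : H1 N) :
    ∃ C, ∀ t, ‖D t (u.rep t) l‖ ≤ C := by
  obtain ⟨C, hC, hb⟩ := h.tame.bound (4 * ‖u‖ + |l|)
  exact ⟨C, fun t => hb t _ l (by linarith [u.norm_rep_le t, abs_nonneg l])
    (by linarith [norm_nonneg u])⟩

lemma continuous_comp (h : IsSmoothField f D f' D') (l : ℝ) (u : H1 N) :
    Continuous fun t => D t (u.rep t) l := by
  have hc := u.isSobolevPair.continuous
  exact h.tame.continuous.comp (f := fun t : ℝ => (t, u.rep t, l)) (by fun_prop)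

/-- The class of `f(·, u(·), l)` in `L²`. -/
def toL2 (h : IsSmoothField f D f' D') (l : ℝ) (u : H1 N) : L2 N := (h.memLp l u).toLp _

/-- The class of `D_l f(·, u(·), l)` in `L²`. -/
def toL2' (h : IsSmoothField f D f' D') (l : ℝ) (u : H1 N) : L2 N := (h.memLp' l u).toLp _

/-- The bounded continuous function `D_ξ f(·, u(·), l)`. -/
def derivBCF (h : IsSmoothField f D f' D') (l : ℝ) (u : H1 N) :
    BoundedContinuousFunction ℝ (PhaseSpace N →L[ℝ] PhaseSpace N) :=
  .ofNormedAddCommGroup (fun t => D t (u.rep t) l) (h.continuous_comp l u) _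
    (h.exists_bound_comp l u).choose_spec

lemma coeFn_toL2 (h : IsSmoothField f D f' D') (l : ℝ) (u : H1 N) :
    h.toL2 l u =ᵐ[volume] fun t => f t (u.rep t) l := (h.memLp l u).coeFn_toLp

lemma coeFn_toL2' (h : IsSmoothField f D f' D') (l : ℝ) (u : H1 N) :
    h.toL2' l u =ᵐ[volume] fun t => f' t (u.rep t) l := (h.memLp' l u).coeFn_toLp

lemma hasFDerivAt_toL2 (h : IsSmoothField f D f' D') (l : ℝ) (u : H1 N) :
    HasFDerivAt (h.toL2 l) ((mulL (h.derivBCF l u)).comp (H1.toL2L N)) u := by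
  refine .of_isLittleO (Asymptotics.isLittleO_iff.2 fun ε hε => ?_)
  set R := 4 * (‖u‖ + 1) + |l|
  obtain ⟨δ, hδ, he⟩ := h.expand_fst R ε hε
  -- The 4 is the constant of the sup-norm embedding: within this radius the functions differ
  -- pointwise by at most δ, and the Taylor estimate, uniform in t, can be integrated.
  filter_upwards [Metric.ball_mem_nhds u (ε := min 1 (δ / 4)) (by positivity)] with v hv
  rw [Metric.mem_ball, dist_eq_norm, lt_min_iff] at hv
  refine le_trans ?_ (mul_le_mul_of_nonneg_left (v - u).norm_toL2_le hε.le)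
  refine Lp.norm_le_mul_norm_of_ae_le_mul ?_
  have hvn : ‖v‖ ≤ ‖u‖ + 1 := by linarith [norm_le_norm_add_norm_sub' v u, hv.1]
  filter_upwards [Lp.coeFn_sub (h.toL2 l v - h.toL2 l u) (mulL (h.derivBCF l u) (v - u).toL2),
    Lp.coeFn_sub (h.toL2 l v) (h.toL2 l u), h.coeFn_toL2 l v, h.coeFn_toL2 l u,
    coeFn_mulL (h.derivBCF l u) (v - u).toL2, (v - u).toL2_ae_eq] with t e1 e2 e3 e4 e5 e6
  change ‖(h.toL2 l v - h.toL2 l u - mulL (h.derivBCF l u) (v - u).toL2 : L2 N) t‖ ≤ _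
  rw [e1, Pi.sub_apply, e2, Pi.sub_apply, e3, e4, e5, e6, H1.rep_sub]
  refine he t _ _ l ?_ ?_ ?_ ?_
  · linarith [u.norm_rep_le t, abs_nonneg l]
  · linarith [v.norm_rep_le t, abs_nonneg l]
  · linarith [norm_nonneg u]
  · rw [← H1.rep_sub]
    linarith [(v - u).norm_rep_le t, hv.2]

lemma hasDerivAt_toL2 (h : IsSmoothField f D f' D') (l : ℝ) (u : H1 N) :
    HasDerivAt (fun m => h.toL2 m u) (h.toL2' l u) l := by
  rw [hasDerivAt_iff_isLittleO, Asymptotics.isLittleO_iff]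
  intro ε hε
  set R := 4 * ‖u‖ + |l| + 1
  obtain ⟨δ, hδ, he⟩ := h.expand_snd R (ε / (‖u‖ + 1)) (by positivity)
  filter_upwards [Metric.ball_mem_nhds l (ε := min 1 δ) (by positivity)] with m hm
  rw [Metric.mem_ball, Real.dist_eq, lt_min_iff] at hm
  have hm1 : |m| ≤ |l| + 1 := by linarith [abs_sub_abs_le_abs_sub m l, hm.1]
  have h1 : ‖h.toL2 m u - h.toL2 l u - (m - l) • h.toL2' l u‖
      ≤ (ε / (‖u‖ + 1) * |m - l|) * ‖u.toL2‖ := by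
    refine Lp.norm_le_mul_norm_of_ae_le_mul ?_
    filter_upwards [Lp.coeFn_sub (h.toL2 m u - h.toL2 l u) ((m - l) • h.toL2' l u),
      Lp.coeFn_sub (h.toL2 m u) (h.toL2 l u), Lp.coeFn_smul (m - l) (h.toL2' l u),
      h.coeFn_toL2 m u, h.coeFn_toL2 l u, h.coeFn_toL2' l u, u.toL2_ae_eq]
      with t e1 e2 e3 e4 e5 e6 e7
    rw [e1, Pi.sub_apply, e2, Pi.sub_apply, e3, Pi.smul_apply, e4, e5, e6, e7]
    refine he t _ l m ?_ ?_ ?_ hm.2.le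
    · linarith [u.norm_rep_le t, abs_nonneg l]
    · linarith [norm_nonneg u]
    · linarith [norm_nonneg u]
  refine h1.trans ?_
  rw [Real.norm_eq_abs]
  have h2 : ‖u.toL2‖ ≤ ‖u‖ + 1 := by linarith [u.norm_toL2_le]
  calc ε / (‖u‖ + 1) * |m - l| * ‖u.toL2‖ ≤ ε / (‖u‖ + 1) * |m - l| * (‖u‖ + 1) := by gcongr
    _ = ε * |m - l| := by field_simp

/-- Convergence in H¹ is uniform convergence on ℝ, and the modulus of D is uniform in t; hence
continuity in the sup norm, which dominates the operator norm of the multiplication. -/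
lemma continuous_derivBCF (h : IsSmoothField f D f' D') :
    Continuous fun p : ℝ × H1 N => h.derivBCF p.1 p.2 := by
  rw [continuous_iff_continuousAt]
  rintro ⟨l, u⟩
  rw [Metric.continuousAt_iff']
  intro ε hε
  set R := 4 * (‖u‖ + 1) + |l| + 1
  obtain ⟨δ, hδ, he⟩ := h.tame.modulus R (ε / 2) (by positivity)
  filter_upwards [Metric.ball_mem_nhds (l, u) (ε := min 1 (δ / 4)) (by positivity)] with p hp
  obtain ⟨m, v⟩ := p
  have hm : dist m l < min 1 (δ / 4) := lt_of_le_of_lt (le_max_left _ _) hp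
  have hv : dist v u < min 1 (δ / 4) := lt_of_le_of_lt (le_max_right _ _) hp
  rw [dist_eq_norm, lt_min_iff] at hv
  rw [Real.dist_eq, lt_min_iff] at hm
  have hvn : ‖v‖ ≤ ‖u‖ + 1 := by linarith [norm_le_norm_add_norm_sub' v u, hv.1]
  refine lt_of_le_of_lt ((BoundedContinuousFunction.dist_le (C := ε / 2) (by positivity)).2
    fun t => ?_) (half_lt_self hε)
  rw [dist_eq_norm]
  refine he t _ _ m l ?_ ?_ ?_ ?_ ?_ ?_
  · linarith [v.norm_rep_le t, abs_nonneg l]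
  · linarith [u.norm_rep_le t, abs_nonneg l]
  · linarith [norm_nonneg u, abs_sub_abs_le_abs_sub m l, hm.1]
  · linarith [norm_nonneg u]
  · rw [← H1.rep_sub]
    linarith [(v - u).norm_rep_le t, hv.2]
  · linarith [hm.2]

lemma continuous_toL2' (h : IsSmoothField f D f' D') :
    Continuous fun p : ℝ × H1 N => h.toL2' p.1 p.2 := by
  rw [continuous_iff_continuousAt]
  rintro ⟨l, u⟩
  rw [Metric.continuousAt_iff']
  intro ε hε
  set R := 4 * (‖u‖ + 1) + |l| + 1
  obtain ⟨δ, hδ, he⟩ := h.modulus_snd' R (ε / (4 * (‖u‖ + 1))) (by positivity)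
  obtain ⟨K, hK, hlip⟩ := h.lipschitz' R
  filter_upwards [Metric.ball_mem_nhds (l, u) (ε := min 1 (min δ (ε / (4 * (K + 1)))))
    (by positivity)] with p hp
  obtain ⟨m, v⟩ := p
  have hm : dist m l < _ := lt_of_le_of_lt (le_max_left _ _) hp
  have hv : dist v u < _ := lt_of_le_of_lt (le_max_right _ _) hp
  rw [dist_eq_norm, lt_min_iff, lt_min_iff] at hv
  rw [Real.dist_eq, lt_min_iff, lt_min_iff] at hm
  have hvn : ‖v‖ ≤ ‖u‖ + 1 := by linarith [norm_le_norm_add_norm_sub' v u, hv.1]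
  have hmn : |m| ≤ |l| + 1 := by linarith [abs_sub_abs_le_abs_sub m l, hm.1]
  have h1 : ‖h.toL2' m v - h.toL2' m u‖ ≤ K * ‖(v - u).toL2‖ := by
    refine Lp.norm_le_mul_norm_of_ae_le_mul ?_
    filter_upwards [Lp.coeFn_sub (h.toL2' m v) (h.toL2' m u), h.coeFn_toL2' m v,
      h.coeFn_toL2' m u, (v - u).toL2_ae_eq] with t e1 e2 e3 e4
    rw [e1, Pi.sub_apply, e2, e3, e4, H1.rep_sub]
    refine hlip t _ _ m ?_ ?_ ?_
    · linarith [v.norm_rep_le t, abs_nonneg l]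
    · linarith [u.norm_rep_le t, abs_nonneg l]
    · linarith [norm_nonneg u]
  have h2 : ‖h.toL2' m u - h.toL2' l u‖ ≤ ε / (4 * (‖u‖ + 1)) * ‖u.toL2‖ := by
    refine Lp.norm_le_mul_norm_of_ae_le_mul ?_
    filter_upwards [Lp.coeFn_sub (h.toL2' m u) (h.toL2' l u), h.coeFn_toL2' m u,
      h.coeFn_toL2' l u, u.toL2_ae_eq] with t e1 e2 e3 e4
    rw [e1, Pi.sub_apply, e2, e3, e4]
    refine he t _ l m ?_ ?_ ?_ hm.2.1.le
    · linarith [u.norm_rep_le t, abs_nonneg l]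
    · linarith [norm_nonneg u]
    · linarith [norm_nonneg u]
  have h3 : K * ‖(v - u).toL2‖ ≤ ε / 4 := by
    have e1 : ‖(v - u).toL2‖ ≤ ε / (4 * (K + 1)) := (v - u).norm_toL2_le.trans hv.2.2.le
    calc K * ‖(v - u).toL2‖ ≤ (K + 1) * (ε / (4 * (K + 1))) := by gcongr; linarith
      _ = ε / 4 := by field_simp
  have h4 : ε / (4 * (‖u‖ + 1)) * ‖u.toL2‖ ≤ ε / 4 := by
    have e1 : ‖u.toL2‖ ≤ ‖u‖ + 1 := by linarith [u.norm_toL2_le]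
    calc _ ≤ ε / (4 * (‖u‖ + 1)) * (‖u‖ + 1) := by gcongr
      _ = ε / 4 := by field_simp
  calc dist (h.toL2' m v) (h.toL2' l u) ≤ ‖h.toL2' m v - h.toL2' m u‖
        + ‖h.toL2' m u - h.toL2' l u‖ := by
        rw [dist_eq_norm]; exact norm_sub_le_norm_sub_add_norm_sub _ _ _
    _ < ε := by linarith

/-- A map whose partial derivatives exist and are jointly continuous is C¹. -/
lemma contDiff_toL2 (h : IsSmoothField f D f' D') :
    ContDiff ℝ 1 fun p : ℝ × H1 N => h.toL2 p.1 p.2 := by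
  set f₁ : ℝ → H1 N → ℝ →L[ℝ] L2 N := fun l u =>
    ContinuousLinearMap.toSpanSingleton ℝ (h.toL2' l u)
  set f₂ : ℝ → H1 N → H1 N →L[ℝ] L2 N := fun l u =>
    (mulL (h.derivBCF l u)).comp (H1.toL2L N)
  have hc₁ : Continuous fun p : ℝ × H1 N => f₁ p.1 p.2 :=
    (ContinuousLinearMap.toSpanSingletonCLE (𝕜 := ℝ) (E := L2 N)).continuous.comp
      h.continuous_toL2'
  have hc₂ : Continuous fun p : ℝ × H1 N => f₂ p.1 p.2 :=
    (mulL.continuous.comp h.continuous_derivBCF).clm_comp continuous_const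
  rw [contDiff_one_iff_hasFDerivAt]
  refine ⟨fun p => (f₁ p.1 p.2).coprod (f₂ p.1 p.2), ?_, fun p => ?_⟩
  · have := (ContinuousLinearMap.coprodEquivL (S := ℝ) (𝕜 := ℝ) (E := ℝ) (F := H1 N)
      (G := L2 N)).continuous.comp (hc₁.prodMk hc₂)
    exact this
  · exact (hasStrictFDerivAt_uncurry_coprod (f := h.toL2) (f₁ := f₁) (f₂ := f₂) (u := p)
      (.of_forall fun q => (h.hasDerivAt_toL2 q.1 q.2).hasFDerivAt)
      (.of_forall fun q => h.hasFDerivAt_toL2 q.1 q.2) hc₁.continuousAt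
      hc₂.continuousAt).hasFDerivAt

end IsSmoothField

/-! ### The map F and its partial derivative -/

section Map

variable {N : ℕ} {H : ℝ → PhaseSpace N → ℝ → ℝ}

lemma HamiltonianHyp.memLp_DxH (hH : HamiltonianHyp H) (l : ℝ) (u : H1 N) :
    MemLp (fun t => DxH H t (u.toL2 t) l) 2 (volume : Measure ℝ) := by
  refine (hH.isSmoothField.memLp l u).ae_eq ?_
  filter_upwards [u.toL2_ae_eq] with t ht
  rw [ht]

/-- The default branch of `nemytskii` is never taken, so F is a bounded linear map minus a C¹
superposition operator. -/
lemma HamiltonianHyp.hamiltonianMap_eq (hH : HamiltonianHyp H) (J : Mat N) (p : ℝ × H1 N) :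
    hamiltonianMap J H p = ((matOp J).compLpL 2 volume).comp (H1.derivL N) p.2
      - hH.isSmoothField.toL2 p.1 p.2 := by
  rw [hamiltonianMap, nemytskii, dif_pos (hH.memLp_DxH p.1 p.2)]
  congr 1
  refine MemLp.toLp_congr _ _ ?_
  filter_upwards [p.2.toL2_ae_eq] with t ht
  rw [ht]

lemma HamiltonianHyp.contDiff_hamiltonianMap (hH : HamiltonianHyp H) (J : Mat N) :
    ContDiff ℝ 1 (hamiltonianMap J H) := by
  rw [show hamiltonianMap J H = _ from funext (hH.hamiltonianMap_eq J)]
  exact ((((matOp J).compLpL 2 volume).comp (H1.derivL N)).contDiff.comp contDiff_snd).sub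
    hH.isSmoothField.contDiff_toL2

lemma HamiltonianHyp.fderiv_hamiltonianMap (hH : HamiltonianHyp H) (J : Mat N) (l : ℝ)
    (u : H1 N) : fderiv ℝ (fun v => hamiltonianMap J H (l, v)) u =
      ((matOp J).compLpL 2 volume).comp (H1.derivL N) -
        (mulL (hH.isSmoothField.derivBCF l u)).comp (H1.toL2L N) := by
  simp only [hH.hamiltonianMap_eq J]
  exact ((ContinuousLinearMap.hasFDerivAt _).sub
    (hH.isSmoothField.hasFDerivAt_toL2 l u)).fderiv

end Map

/-! ## A criterion for the Fredholm property -/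

section Abstract

variable {X Y : Type*} [NormedAddCommGroup X] [InnerProductSpace ℝ X]
  [NormedAddCommGroup Y] [InnerProductSpace ℝ Y] {L : X →L[ℝ] Y}

/-- The hypothesis makes the unit ball of the kernel compact, and Riesz's theorem applies. -/
lemma finiteDimensional_ker_of_subseq
    (hL : ∀ (u : ℕ → X) (A : ℝ), (∀ n, ‖u n‖ ≤ A) → ∀ y, Tendsto (fun n => L (u n)) atTop (𝓝 y) →
      ∃ φ : ℕ → ℕ, StrictMono φ ∧ ∃ z, Tendsto (u ∘ φ) atTop (𝓝 z)) :
    FiniteDimensional ℝ L.ker := by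
  refine FiniteDimensional.of_isCompact_closedBall ℝ one_pos (c := 0) ?_
  rw [isCompact_iff_isSeqCompact]
  intro u hu
  have h0 : ∀ n, L (u n) = 0 := fun n => (u n).2
  obtain ⟨φ, hφ, z, hz⟩ := hL (fun n => (u n : X)) 1 (fun n => by simpa using hu n) 0
    (by simp [h0])
  have hLz : L z = 0 := by
    have h1 := (L.continuous.tendsto z).comp hz
    have h2 : L ∘ ((fun n => (u n : X)) ∘ φ) = fun _ => 0 := funext fun n => h0 _
    rw [h2] at h1
    exact tendsto_nhds_unique h1 tendsto_const_nhds |>.symm ▸ rfl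
  have h3 : Tendsto (u ∘ φ) atTop (𝓝 ⟨z, hLz⟩) := tendsto_subtype_rng.2 hz
  exact ⟨_, Metric.isClosed_closedBall.mem_of_tendsto h3 (.of_forall fun n => hu _), φ, hφ, h3⟩

/-- Otherwise unit vectors orthogonal to the kernel with images tending to 0 would have a limit that
is a unit vector both in the kernel and orthogonal to it. -/
lemma exists_bound_orthogonal_of_subseq
    (hL : ∀ (u : ℕ → X) (A : ℝ), (∀ n, ‖u n‖ ≤ A) → ∀ y, Tendsto (fun n => L (u n)) atTop (𝓝 y) →
      ∃ φ : ℕ → ℕ, StrictMono φ ∧ ∃ z, Tendsto (u ∘ φ) atTop (𝓝 z)) :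
    ∃ K : NNReal, ∀ u ∈ L.kerᗮ, ‖u‖ ≤ K * ‖L u‖ := by
  by_contra! hcon
  have h1 : ∀ n : ℕ, ∃ u ∈ L.kerᗮ, ‖u‖ = 1 ∧ ‖L u‖ ≤ 1 / ((n : ℝ) + 1) := by
    intro n
    obtain ⟨u, hu, hlt⟩ := hcon ((n : NNReal) + 1)
    have hu0 : 0 < ‖u‖ := lt_of_le_of_lt (by positivity) hlt
    refine ⟨‖u‖⁻¹ • u, Submodule.smul_mem _ _ hu, ?_, ?_⟩
    · rw [norm_smul, norm_inv, norm_norm, inv_mul_cancel₀ hu0.ne']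
    · rw [map_smul, norm_smul, norm_inv, norm_norm, inv_mul_le_iff₀ hu0, mul_one_div,
        le_div_iff₀ (by positivity)]
      push_cast at hlt
      linarith
  choose u hu hn hLu using h1
  have h2 : Tendsto (fun n => L (u n)) atTop (𝓝 0) :=
    squeeze_zero_norm hLu tendsto_one_div_add_atTop_nhds_zero_nat
  obtain ⟨φ, hφ, z, hz⟩ := hL u 1 (fun n => (hn n).le) 0 h2
  have h3 : L z = 0 :=
    tendsto_nhds_unique ((L.continuous.tendsto z).comp hz) (h2.comp hφ.tendsto_atTop)
  have h4 : z ∈ L.kerᗮ :=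
    (Submodule.isClosed_orthogonal _).mem_of_tendsto hz (.of_forall fun n => hu _)
  have h5 : ‖z‖ = 1 := by
    refine tendsto_nhds_unique hz.norm ?_
    simp [hn]
  have h6 : z = 0 := by
    have := (Submodule.mem_orthogonal _ _).1 h4 z h3
    exact inner_self_eq_zero.1 this
  simp [h6] at h5

lemma isClosed_range_of_bound [CompleteSpace X] [FiniteDimensional ℝ L.ker] {K : NNReal}
    (hK : ∀ u ∈ L.kerᗮ, ‖u‖ ≤ K * ‖L u‖) : IsClosed (L.range : Set Y) := by
  set M := L.comp L.kerᗮ.subtypeL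
  have h1 : AntilipschitzWith K M := M.antilipschitz_of_bound fun u => hK u u.2
  have h2 : (L.range : Set Y) = Set.range M := by
    ext y
    constructor
    · rintro ⟨u, rfl⟩
      obtain ⟨a, ha, b, hb, rfl⟩ := Submodule.exists_add_mem_mem_orthogonal (K := L.ker) u
      refine ⟨⟨b, hb⟩, ?_⟩
      have : L a = 0 := ha
      simp [M, this]
    · rintro ⟨u, rfl⟩
      exact ⟨u, rfl⟩
  rw [h2]
  exact h1.isClosed_range M.uniformContinuous

/-- The map e identifies the kernel with the orthogonal complement of the range, which for a closed
range is a copy of the cokernel. -/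
lemma isFredholmIndexZero_of_subseq [CompleteSpace X] [CompleteSpace Y]
    (hL : ∀ (u : ℕ → X) (A : ℝ), (∀ n, ‖u n‖ ≤ A) → ∀ y, Tendsto (fun n => L (u n)) atTop (𝓝 y) →
      ∃ φ : ℕ → ℕ, StrictMono φ ∧ ∃ z, Tendsto (u ∘ φ) atTop (𝓝 z))
    (e : X →ₗ[ℝ] Y) (he : Function.Injective e) (hker : ∀ u, L u = 0 → e u ∈ L.rangeᗮ)
    (hcoker : ∀ z ∈ L.rangeᗮ, ∃ u, L u = 0 ∧ e u = z) : IsFredholmIndexZero L := by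
  have hfin := finiteDimensional_ker_of_subseq hL
  obtain ⟨K, hK⟩ := exists_bound_orthogonal_of_subseq hL
  have hcl := isClosed_range_of_bound hK
  have hcomp : CompleteSpace L.range := hcl.completeSpace_coe
  set E : L.ker ≃ₗ[ℝ] L.rangeᗮ := LinearEquiv.ofBijective
    ((e.comp L.ker.subtype).codRestrict L.rangeᗮ fun u => hker u u.2)
    ⟨fun u v huv => Subtype.ext (he (congrArg Subtype.val huv)), fun z => by
      obtain ⟨u, hu, hz⟩ := hcoker z z.2
      exact ⟨⟨u, hu⟩, Subtype.ext hz⟩⟩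
  set Q := Submodule.quotientEquivOfIsCompl L.range L.rangeᗮ L.range.isCompl_orthogonal
  set S : L.ker ≃ₗ[ℝ] (Y ⧸ L.range) := E.trans Q.symm
  refine ⟨⟨?_, hcl, hfin, Module.Finite.equiv S, .of_finiteDimensional _⟩, S.finrank_eq⟩
  -- Strictness is the open mapping theorem for L onto its closed range.
  refine (LinearMap.isStrictMap_iff_isOpenQuotientMap_rangeRestrict (f := (L : X →ₗ[ℝ] Y))).2 ?_
  have hsurj : Function.Surjective L.rangeRestrict := (L : X →ₗ[ℝ] Y).surjective_rangeRestrict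
  exact ⟨hsurj, L.rangeRestrict.continuous, L.rangeRestrict.isOpenMap hsurj⟩

end Abstract

/-! ## Weak derivatives and the inner product of `L²` -/

section WeakDerivative

variable {N : ℕ}

lemma integrable_inner_of_memLp {V : Type*} [NormedAddCommGroup V] [InnerProductSpace ℝ V]
    {f g : ℝ → V} (hf : MemLp f 2 volume) (hg : MemLp g 2 volume) :
    Integrable fun t => inner ℝ (f t) (g t) := by
  refine (L2.integrable_inner (𝕜 := ℝ) (hf.toLp f) (hg.toLp g)).congr ?_
  filter_upwards [hf.coeFn_toLp, hg.coeFn_toLp] with t e1 e2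
  rw [e1, e2]

/-- Integration by parts on [-b, b]; the boundary terms vanish as b → ∞ because H¹ functions decay.
-/
lemma IsSobolevPair.integral_inner_add_inner {V : Type*} [NormedAddCommGroup V]
    [InnerProductSpace ℝ V] [FiniteDimensional ℝ V] {x v y w : ℝ → V} (h : IsSobolevPair x v)
    (k : IsSobolevPair y w) :
    (∫ t, inner ℝ (v t) (y t)) + ∫ t, inner ℝ (x t) (w t) = 0 := by
  have h1 : Integrable fun t => inner ℝ (v t) (y t) := integrable_inner_of_memLp h.memLp_deriv k.memLp
  have h2 : Integrable fun t => inner ℝ (x t) (w t) := integrable_inner_of_memLp h.memLp k.memLp_deriv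
  rw [← integral_add h1 h2]
  have h3 := intervalIntegral_tendsto_integral (h1.add h2) tendsto_neg_atTop_atBot
    (tendsto_id (x := (atTop : Filter ℝ)))
  refine tendsto_nhds_unique h3 ?_
  have h4 : ∀ b : ℝ, ∫ t in (-b)..(id b), ((fun t => inner ℝ (v t) (y t)) + fun t =>
      inner ℝ (x t) (w t)) t = inner ℝ (x b) (y b) - inner ℝ (x (-b)) (y (-b)) := fun b =>
    (inner_sub_inner_eq_integral (h.memLp_deriv.locallyIntegrable (by norm_num)) h.sub_eq
      (k.memLp_deriv.locallyIntegrable (by norm_num)) k.sub_eq (-b) b).symm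
  simp_rw [h4]
  have h5 := (h.tendsto_zero (.inl rfl)).inner (k.tendsto_zero (.inl rfl)) (𝕜 := ℝ)
  have h6 := ((h.tendsto_zero (.inr rfl)).inner (k.tendsto_zero (.inr rfl)) (𝕜 := ℝ)).comp
    tendsto_neg_atTop_atBot
  simpa using h5.sub h6

lemma H1.inner_weakDeriv_add (u w : H1 N) :
    inner ℝ u.weakDeriv w.toL2 + inner ℝ u.toL2 w.weakDeriv = 0 := by
  rw [L2.inner_def, L2.inner_def, ← u.isSobolevPair.integral_inner_add_inner w.isSobolevPair]
  congr 1
  · refine integral_congr_ae ?_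
    filter_upwards [w.toL2_ae_eq] with t ht
    rw [ht]
  · refine integral_congr_ae ?_
    filter_upwards [u.toL2_ae_eq] with t ht
    rw [ht]

lemma isSobolevPair_test {φ : ℝ → ℝ} (hφ : ContDiff ℝ ∞ φ) (hc : HasCompactSupport φ)
    (e : PhaseSpace N) : IsSobolevPair (fun t => φ t • e) (fun t => deriv φ t • e) where
  memLp := (hφ.continuous.smul continuous_const).memLp_of_hasCompactSupport hc.smul_right
  memLp_deriv := ((hφ.continuous_deriv (by simp)).smul continuous_const).memLp_of_hasCompactSupport
    hc.deriv.smul_right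
  sub_eq a b := by
    rw [intervalIntegral.integral_eq_sub_of_hasDerivAt (f := fun t => φ t • e)]
    · exact fun t _ => ((hφ.differentiable (by simp)) t).hasDerivAt.smul_const e
    · exact ((hφ.continuous_deriv (by simp)).smul continuous_const).intervalIntegrable _ _

/-- Test functions may be replaced by all of H¹: d/dt is skew-adjoint with domain exactly H¹. This
gives both the completeness of H¹ and the regularity of cokernel elements. -/
lemma isWeakDeriv_iff (p q : L2 N) : IsWeakDeriv p q ↔
    ∀ w : H1 N, inner ℝ w.weakDeriv p + inner ℝ w.toL2 q = 0 := by
  constructor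
  · exact fun h w => w.inner_weakDeriv_add ⟨WithLp.toLp 2 (p, q), h⟩
  · intro h φ hφ hc
    rw [← sub_eq_zero, sub_neg_eq_add]
    have h1 := integrable_test_smul p (hφ.continuous_deriv (by simp)) hc.deriv
    have h2 := integrable_test_smul q hφ.continuous hc
    refine ext_inner_left ℝ fun e => ?_
    rw [inner_zero_right, inner_add_right, ← integral_inner h1, ← integral_inner h2]
    obtain ⟨w, hw, hw'⟩ := (isSobolevPair_test hφ hc e).exists_H1
    rw [← h w, hw, hw', L2.inner_def, L2.inner_def]
    congr 1
    · refine integral_congr_ae ?_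
      filter_upwards [(isSobolevPair_test hφ hc e).memLp_deriv.coeFn_toLp] with t ht
      rw [ht, inner_smul_left, inner_smul_right]
      rfl
    · refine integral_congr_ae ?_
      filter_upwards [(isSobolevPair_test hφ hc e).memLp.coeFn_toLp] with t ht
      rw [ht, inner_smul_left, inner_smul_right]
      rfl

lemma H1.eq_zero_of_toL2 {u : H1 N} (hu : u.toL2 = 0) : u = 0 := by
  have h1 : ∀ φ : ℝ → ℝ, ContDiff ℝ ∞ φ → HasCompactSupport φ →
      ∫ t, φ t • u.weakDeriv t = 0 := fun φ hφ hc => by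
    have h2 : ∫ t, deriv φ t • u.toL2 t = -∫ t, φ t • u.weakDeriv t := u.2 φ hφ hc
    rw [← neg_eq_zero, ← h2, hu]
    refine integral_eq_zero_of_ae ?_
    filter_upwards [Lp.coeFn_zero (PhaseSpace N) 2 (volume : Measure ℝ)] with t ht
    rw [ht, Pi.zero_apply, smul_zero]
  have h3 : u.weakDeriv = 0 := by
    refine Lp.ext ?_
    filter_upwards [ae_eq_zero_of_integral_contDiff_smul_eq_zero
      ((Lp.memLp u.weakDeriv).locallyIntegrable (by norm_num)) h1,
      Lp.coeFn_zero (PhaseSpace N) 2 (volume : Measure ℝ)] with t e1 e2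
    rw [e1, e2, Pi.zero_apply]
  have h4 := u.norm_le_add
  rw [hu, h3, norm_zero, add_zero] at h4
  exact norm_le_zero_iff.1 h4

/-- H¹ is cut out of L² ⊕ L² by continuous linear conditions, one for each w in H¹, hence is closed.
-/
instance : CompleteSpace (H1 N) := by
  have h : (sobolevSubmodule N : Set (WithLp 2 (L2 N × L2 N))) =
      ⋂ w : H1 N, {p | inner ℝ w.weakDeriv p.fst + inner ℝ w.toL2 p.snd = (0 : ℝ)} := by
    ext p
    rw [mem_iInter]
    exact isWeakDeriv_iff p.fst p.snd
  suffices hcl : IsClosed (sobolevSubmodule N : Set (WithLp 2 (L2 N × L2 N))) from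
    hcl.completeSpace_coe
  rw [h]
  refine isClosed_iInter fun w => isClosed_eq ?_ continuous_const
  have h1 : Continuous fun p : WithLp 2 (L2 N × L2 N) => p.fst :=
    (WithLp.fstL 2 ℝ (L2 N) (L2 N)).continuous
  have h2 : Continuous fun p : WithLp 2 (L2 N × L2 N) => p.snd :=
    (WithLp.sndL 2 ℝ (L2 N) (L2 N)).continuous
  exact (continuous_const.inner h1).add (continuous_const.inner h2)

end WeakDerivative

/-! ## The symplectic matrix -/

section Symplectic

variable {N : ℕ} {J : Mat N}

lemma matOp_matOp (hJ : J * J = -1) (ξ : PhaseSpace N) : matOp J (matOp J ξ) = -ξ := by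
  have h : (matOp J) * (matOp J) = -1 := by
    rw [matOp, ← map_mul, hJ, map_neg, map_one]
  exact congrArg (fun L : PhaseSpace N →L[ℝ] PhaseSpace N => L ξ) h

lemma norm_matOp_le (J : Mat N) {ξ : PhaseSpace N} {ε r : ℝ} (hε : 0 ≤ ε) (hr : 0 ≤ r)
    (h : ‖ξ‖ ≤ ε / (‖matOp J‖ + 1) * r) : ‖matOp J ξ‖ ≤ ε * r :=
  calc ‖matOp J ξ‖ ≤ ‖matOp J‖ * (ε / (‖matOp J‖ + 1) * r) := (matOp J).le_opNorm_of_le h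
    _ ≤ (‖matOp J‖ + 1) * (ε / (‖matOp J‖ + 1) * r) := by gcongr; linarith
    _ = ε * r := by field_simp

lemma inner_matOp (M : Mat N) (ξ η : PhaseSpace N) :
    inner ℝ (matOp M ξ) η = inner ℝ ξ (matOp M.transpose η) := by
  have h : matOp M.transpose = ContinuousLinearMap.adjoint (matOp M) := by
    rw [← ContinuousLinearMap.star_eq_adjoint, matOp, matOp, ← map_star,
      Matrix.star_eq_conjTranspose, Matrix.conjTranspose_eq_transpose_of_trivial]
  rw [h, ContinuousLinearMap.adjoint_inner_right]

lemma inner_matOp_left (hJ : J.transpose = -J) (ξ η : PhaseSpace N) :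
    inner ℝ (matOp J ξ) η = -inner ℝ ξ (matOp J η) := by
  rw [inner_matOp, hJ, matOp, map_neg, ← inner_neg_right]
  rfl

/-- The operator `x ↦ J x` of `L²`. -/
abbrev matL (J : Mat N) : L2 N →L[ℝ] L2 N := (matOp J).compLpL 2 volume

lemma matL_matL (hJ : J * J = -1) (u : L2 N) : matL J (matL J u) = -u := by
  refine Lp.ext ?_
  filter_upwards [(matOp J).coeFn_compLpL (p := 2) (matL J u), (matOp J).coeFn_compLpL (p := 2) u,
    Lp.coeFn_neg u] with t e1 e2 e3
  rw [e1, e2, e3, Pi.neg_apply, matOp_matOp hJ]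

lemma inner_matL (hJ : J.transpose = -J) (u v : L2 N) :
    inner ℝ (matL J u) v = -inner ℝ u (matL J v) := by
  rw [L2.inner_def, L2.inner_def, ← integral_neg]
  refine integral_congr_ae ?_
  filter_upwards [(matOp J).coeFn_compLpL (p := 2) v, (matOp J).coeFn_compLpL (p := 2) u]
    with t e1 e2
  rw [e1, e2, inner_matOp_left hJ]

lemma inner_mulL {a : BoundedContinuousFunction ℝ (PhaseSpace N →L[ℝ] PhaseSpace N)}
    (ha : ∀ t ξ η, inner ℝ (a t ξ) η = inner ℝ ξ (a t η)) (u v : L2 N) :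
    inner ℝ (mulL a u) v = inner ℝ u (mulL a v) := by
  rw [L2.inner_def, L2.inner_def]
  refine integral_congr_ae ?_
  filter_upwards [coeFn_mulL a u, coeFn_mulL a v] with t e1 e2
  rw [e1, e2, ha]

lemma IsWeakDeriv.matL {p q : L2 N} (h : IsWeakDeriv p q) :
    IsWeakDeriv (matL J p) (matL J q) := by
  intro φ hφ hc
  have hd := hφ.continuous_deriv (by simp : (1 : WithTop ℕ∞) ≤ ∞)
  have h1 : ∫ t, deriv φ t • HamiltonianHomoclinic.matL J p t
      = matOp J (∫ t, deriv φ t • p t) := by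
    rw [← (matOp J).integral_comp_comm (integrable_test_smul p hd hc.deriv)]
    refine integral_congr_ae ?_
    filter_upwards [(matOp J).coeFn_compLpL (p := 2) p] with t e
    rw [e, map_smul]
  have h2 : ∫ t, φ t • HamiltonianHomoclinic.matL J q t = matOp J (∫ t, φ t • q t) := by
    rw [← (matOp J).integral_comp_comm (integrable_test_smul q hφ.continuous hc)]
    refine integral_congr_ae ?_
    filter_upwards [(matOp J).coeFn_compLpL (p := 2) q] with t e
    rw [e, map_smul]
  rw [h1, h2, h φ hφ hc, map_neg]

end Symplectic

/-! ## Compactness and the Fredholm property of the linearization -/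

section Fredholm

variable {N : ℕ} {J : Mat N}

/-- Convergent subsequences for the equation `J x' - f(t, x) = y`. -/
lemma exists_subseq_tendsto_H1 (hJ : J * J = -1) {f : ℝ → PhaseSpace N → PhaseSpace N}
    (hF : IsLocallyLipschitzField fun t ξ => -matOp J (f t ξ))
    {Gp Gm : ℝ → PhaseSpace N → PhaseSpace N} {Bp Bm : ℝ → PhaseSpace N →L[ℝ] PhaseSpace N}
    {Tp Tm : ℝ} (hp : IsHyperbolicEnd (fun t ξ => -matOp J (f t ξ)) atTop Gp Bp Tp)
    (hm : IsHyperbolicEnd (fun t ξ => -matOp J (f t ξ)) atBot Gm Bm Tm) {u : ℕ → H1 N} {A : ℝ}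
    (hu : ∀ n, ‖u n‖ ≤ A) {r : ℕ → L2 N} {y : L2 N}
    (hr : ∀ n, r n =ᵐ[volume] fun t => matOp J ((u n).weakDeriv t) - f t ((u n).rep t))
    (hy : Tendsto r atTop (𝓝 y)) :
    ∃ φ : ℕ → ℕ, StrictMono φ ∧ ∃ z, Tendsto (u ∘ φ) atTop (𝓝 z) := by
  have hres : Tendsto (fun n => lpNorm (fun t => (u n).weakDeriv t - -matOp J (f t ((u n).rep t))
      - (-matL J y) t) 2 volume) atTop (𝓝 0) := by
    have h1 : ∀ n, lpNorm (fun t => (u n).weakDeriv t - -matOp J (f t ((u n).rep t))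
        - (-matL J y) t) 2 volume = ‖matL J (y - r n)‖ := fun n => by
      rw [lp_norm_eq_lpNorm]
      refine lpNorm_congr_ae ?_
      filter_upwards [hr n, Lp.coeFn_neg (matL J y), (matOp J).coeFn_compLpL (p := 2) y,
        (matOp J).coeFn_compLpL (p := 2) (y - r n), Lp.coeFn_sub y (r n)] with t e1 e2 e3 e4 e5
      rw [e2, Pi.neg_apply, e3, e4, e5, Pi.sub_apply, e1, map_sub, map_sub, matOp_matOp hJ]
      abel
    simp_rw [h1]
    have h2 : Tendsto (fun n => y - r n) atTop (𝓝 (y - y)) := tendsto_const_nhds.sub hy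
    simpa using (((matL J).continuous.tendsto _).comp h2).norm
  obtain ⟨φ, hφ, z, w, hzw, h1, h2⟩ := exists_subseq_tendsto_of_isHyperbolicEnd hF hp hm
    (fun n => (u n).isSobolevPair) (A := A)
    (fun n => by rw [(u n).lpNorm_rep]; exact (u n).norm_toL2_le.trans (hu n))
    (fun n => by rw [← lp_norm_eq_lpNorm]; exact (u n).norm_weakDeriv_le.trans (hu n))
    (Lp.memLp _) hres
  obtain ⟨v, hv, hv'⟩ := hzw.exists_H1
  refine ⟨φ, hφ, v, ?_⟩
  rw [tendsto_iff_norm_sub_tendsto_zero]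
  refine squeeze_zero (fun n => norm_nonneg _) (fun n => (u (φ n) - v).norm_le_add) ?_
  have e1 : ∀ n, ‖(u (φ n) - v).toL2‖ = lpNorm (fun t => (u (φ n)).rep t - z t) 2 volume :=
    fun n => by
      rw [lp_norm_eq_lpNorm, show (u (φ n) - v).toL2 = (u (φ n)).toL2 - v.toL2 from rfl, hv]
      refine lpNorm_congr_ae ?_
      filter_upwards [Lp.coeFn_sub (u (φ n)).toL2 (hzw.memLp.toLp z), hzw.memLp.coeFn_toLp,
        (u (φ n)).toL2_ae_eq] with t a1 a2 a3
      rw [a1, Pi.sub_apply, a2, a3]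
  have e2 : ∀ n, ‖(u (φ n) - v).weakDeriv‖
      = lpNorm (fun t => (u (φ n)).weakDeriv t - w t) 2 volume := fun n => by
    rw [lp_norm_eq_lpNorm,
      show (u (φ n) - v).weakDeriv = (u (φ n)).weakDeriv - v.weakDeriv from rfl, hv']
    refine lpNorm_congr_ae ?_
    filter_upwards [Lp.coeFn_sub (u (φ n)).weakDeriv (hzw.memLp_deriv.toLp w),
      hzw.memLp_deriv.coeFn_toLp] with t a1 a2
    rw [a1, Pi.sub_apply, a2]
  simp_rw [e1, e2]
  simpa using h1.add h2

/-- Skew-symmetry of J and of d/dt, with symmetry of a, makes J d/dt - a self-adjoint, so the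
inclusion of H¹ in L² maps the kernel onto the orthogonal complement of the range. -/
theorem isFredholmIndexZero_of_isHyperbolicEnd (hJt : J.transpose = -J) (hJ : J * J = -1)
    {a : BoundedContinuousFunction ℝ (PhaseSpace N →L[ℝ] PhaseSpace N)}
    (ha : ∀ t ξ η, inner ℝ (a t ξ) η = inner ℝ ξ (a t η))
    {Gp Gm : ℝ → PhaseSpace N → PhaseSpace N} {Bp Bm : ℝ → PhaseSpace N →L[ℝ] PhaseSpace N}
    {Tp Tm : ℝ} (hp : IsHyperbolicEnd (fun t ξ => -matOp J (a t ξ)) atTop Gp Bp Tp)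
    (hm : IsHyperbolicEnd (fun t ξ => -matOp J (a t ξ)) atBot Gm Bm Tm) :
    IsFredholmIndexZero ((matL J).comp (H1.derivL N) - (mulL a).comp (H1.toL2L N)) := by
  set L := (matL J).comp (H1.derivL N) - (mulL a).comp (H1.toL2L N)
  have hLu : ∀ u : H1 N, L u = matL J u.weakDeriv - mulL a u.toL2 := fun u => rfl
  have hF : IsLocallyLipschitzField fun t ξ => -matOp J (a t ξ) := by
    refine ⟨?_, fun t => by simp, fun R => ⟨‖matOp J‖ * ‖a‖, by positivity, fun t ξ η _ _ => ?_⟩⟩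
    · have h1 : Continuous fun p : ℝ × PhaseSpace N => a p.1 p.2 :=
        (a.continuous.comp continuous_fst).clm_apply continuous_snd
      exact ((matOp J).continuous.comp h1).neg
    · rw [neg_sub_neg, ← map_sub, ← map_sub, mul_assoc, norm_sub_rev ξ]
      exact (matOp J).le_opNorm_of_le ((a t).le_of_opNorm_le (a.norm_coe_le_norm t) _)
  refine isFredholmIndexZero_of_subseq (fun u A hu y hy => ?_) (H1.toL2L N).toLinearMap ?_ ?_ ?_
  · refine exists_subseq_tendsto_H1 hJ hF hp hm hu (fun n => ?_) hy
    rw [hLu]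
    filter_upwards [Lp.coeFn_sub (matL J (u n).weakDeriv) (mulL a (u n).toL2),
      (matOp J).coeFn_compLpL (p := 2) (u n).weakDeriv, coeFn_mulL a (u n).toL2,
      (u n).toL2_ae_eq] with t e1 e2 e3 e4
    rw [e1, Pi.sub_apply, e2, e3, e4]
  · intro u v huv
    exact sub_eq_zero.1 (H1.eq_zero_of_toL2 (sub_eq_zero.2 (show u.toL2 = v.toL2 from huv)))
  · intro u hu
    rw [Submodule.mem_orthogonal]
    rintro _ ⟨w, rfl⟩
    change inner ℝ (L w) u.toL2 = 0
    have h1 : mulL a u.toL2 = matL J u.weakDeriv := (sub_eq_zero.1 (hLu u ▸ hu)).symm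
    have h2 := (isWeakDeriv_iff _ _).1 (IsWeakDeriv.matL (J := J) u.2) w
    rw [hLu, inner_sub_left, inner_matL hJt, inner_mulL ha, h1]
    have h3 : inner ℝ w.weakDeriv (matL J u.toL2) + inner ℝ w.toL2 (matL J u.weakDeriv) = 0 := h2
    linarith
  · intro z hz
    -- Orthogonality to the range says weakly that (J z)' = a z; applying J shows that z is in H¹
    -- with z' = -J a z, hence in the kernel.
    have h1 : IsWeakDeriv (matL J z) (mulL a z) := by
      rw [isWeakDeriv_iff]
      intro w
      have h2 := (Submodule.mem_orthogonal _ _).1 hz (L w) ⟨w, rfl⟩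
      rw [hLu, inner_sub_left, inner_matL hJt, inner_mulL ha] at h2
      linarith
    have h2 : IsWeakDeriv z (-matL J (mulL a z)) := by
      have h3 := (sobolevSubmodule N).neg_mem
        (x := WithLp.toLp 2 (matL J (matL J z), matL J (mulL a z))) (IsWeakDeriv.matL (J := J) h1)
      have h4 : IsWeakDeriv (-matL J (matL J z)) (-matL J (mulL a z)) := h3
      rwa [matL_matL hJ, neg_neg] at h4
    refine ⟨⟨WithLp.toLp 2 (z, -matL J (mulL a z)), h2⟩, ?_, rfl⟩
    change matL J (-matL J (mulL a z)) - mulL a z = 0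
    rw [map_neg, matL_matL hJ, neg_neg, sub_self]

end Fredholm

/-! ## The asymptotic systems -/

section Asymptotic

variable {N : ℕ} {J : Mat N}

lemma IsSobolevPair.hasDerivAt {V : Type*} [NormedAddCommGroup V] [NormedSpace ℝ V]
    [CompleteSpace V] {x v : ℝ → V} (h : IsSobolevPair x v) (hv : Continuous v) (t : ℝ) :
    HasDerivAt x (v t) t := by
  have h1 : x = fun b => x 0 + ∫ s in (0 : ℝ)..b, v s := by
    ext b
    rw [← h.sub_eq]
    abel
  rw [h1]
  exact (intervalIntegral.integral_hasDerivAt_right (hv.intervalIntegrable _ _)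
    (hv.stronglyMeasurableAtFilter _ _) hv.continuousAt).const_add _

/-- A periodic linear system without characteristic multipliers on the unit circle is coercive. -/
lemma exists_coercive_of_characteristicMultiplier (hJ : J * J = -1)
    {A : ℝ → PhaseSpace N →L[ℝ] PhaseSpace N} (hA : Continuous A) {T : ℝ} (hT : 0 < T)
    (hper : ∀ t, A (t + T) = A t)
    (hmult : ∀ ρ : ℂ, IsCharacteristicMultiplier J A T ρ → ‖ρ‖ ≠ 1) :
    ∃ c : ℝ, 0 ≤ c ∧ ∀ w v : ℝ → PhaseSpace N, IsSobolevPair w v →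
      lpNorm w 2 volume ≤ c * lpNorm (fun t => v t - (-(matOp J).comp (A t)) (w t)) 2 volume := by
  set B : ℝ → PhaseSpace N →L[ℝ] PhaseSpace N := fun t => -(matOp J).comp (A t)
  have hB : Continuous B := (continuous_const.clm_comp hA).neg
  have hBper : ∀ t, B (t + T) = B t := fun t => by simp only [B, hper]
  obtain ⟨K, hK, hBK⟩ := exists_bound_of_periodic hB hT hBper
  set C := ContinuousLinearMap.compL ℝ (PhaseSpace N) (PhaseSpace N) (PhaseSpace N)
  -- The fundamental solution is a solution of the linear equation Φ' = B(t) ∘ Φ in the Banach space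
  -- of operators.
  obtain ⟨Φ, hΦ0, hΦ⟩ := exists_forall_hasDerivAt_linear (C := fun t => C (B t))
    (C.continuous.comp hB) hK (fun t => by
      refine ContinuousLinearMap.opNorm_le_bound _ hK.le fun Ψ => ?_
      exact ((B t).opNorm_comp_le Ψ).trans (mul_le_mul_of_nonneg_right (hBK t) (norm_nonneg _)))
    (ContinuousLinearMap.id ℝ (PhaseSpace N))
  refine exists_coercive_of_monodromy hB hT hBper hΦ0 hΦ fun r hr => hmult r
    ⟨Φ, hΦ0, fun t => ⟨(hΦ t).differentiableAt, ?_⟩, hr⟩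
  rw [(hΦ t).deriv]
  ext1 ξ
  change matOp J (-matOp J (A t (Φ t ξ))) - A t (Φ t ξ) = 0
  rw [map_neg, matOp_matOp hJ, neg_neg, sub_self]

/-- A coercive linear system has no homoclinic solutions. -/
lemma eq_zero_of_coercive {V : Type*} [NormedAddCommGroup V] [NormedSpace ℝ V] [CompleteSpace V]
    {B : ℝ → V →L[ℝ] V} (hB : ∃ c : ℝ, 0 ≤ c ∧ ∀ w v : ℝ → V, IsSobolevPair w v →
      lpNorm w 2 volume ≤ c * lpNorm (fun t => v t - B t (w t)) 2 volume) {z : ℝ → V}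
    (hz : IsSobolevPair z fun t => B t (z t)) (t : ℝ) : z t = 0 := by
  obtain ⟨c, -, h⟩ := hB
  have h1 := h _ _ hz
  simp only [sub_self] at h1
  rw [show (fun _ : ℝ => (0 : V)) = 0 from rfl, lpNorm_zero, mul_zero] at h1
  have h2 : z =ᵐ[volume] fun _ => 0 :=
    (lpNorm_eq_zero hz.memLp (by norm_num)).1 (le_antisymm h1 lpNorm_nonneg)
  exact congrFun (hz.continuous.ae_eq_iff_eq volume continuous_const |>.1 h2) t

/-- The form ⟨z, C z⟩ has derivative 2⟨g, J C z⟩ ≥ 0, so it is monotone; tending to 0 at both ends,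
it vanishes identically, and its zero derivative forces z = 0 by strict positivity. -/
lemma no_homoclinic_of_conditionA (hJt : J.transpose = -J)
    {g : ℝ → PhaseSpace N → PhaseSpace N} (hg : Continuous fun p : ℝ × PhaseSpace N => g p.1 p.2)
    (h : ConditionA J g) {z : ℝ → PhaseSpace N}
    (hz : IsSobolevPair z fun t => -matOp J (g t (z t))) (t : ℝ) : z t = 0 := by
  obtain ⟨C, hC, hpos⟩ := h
  have hzc := hz.continuous
  have hd := hz.hasDerivAt (((matOp J).continuous.comp
    (hg.comp (continuous_id.prodMk hzc))).neg)
  have hJC : ∀ ξ, matOp (J * C) ξ = matOp J (matOp C ξ) := fun ξ => by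
    rw [matOp, map_mul]
    rfl
  have hE : ∀ s, HasDerivAt (fun s => inner ℝ (z s) (matOp C (z s)))
      (2 * inner ℝ (g s (z s)) (matOp (J * C) (z s))) s := fun s => by
    have h1 := (hd s).inner ℝ (((matOp C).hasFDerivAt).comp_hasDerivAt s (hd s))
    refine h1.congr_deriv ?_
    have h2 : inner ℝ (z s) (matOp C (-matOp J (g s (z s))))
        = inner ℝ (-matOp J (g s (z s))) (matOp C (z s)) := by
      rw [real_inner_comm, inner_matOp, hC.eq]
    simp only [Function.comp_apply]
    rw [h2, inner_neg_left, inner_matOp_left hJt, neg_neg, hJC]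
    ring
  have hnn : ∀ s, 0 ≤ 2 * inner ℝ (g s (z s)) (matOp (J * C) (z s)) := fun s => by
    rcases eq_or_ne (z s) 0 with h0 | h0
    · simp [h0]
    · have := hpos s _ h0
      positivity
  have hmono : Monotone fun s => inner ℝ (z s) (matOp C (z s)) :=
    monotone_of_deriv_nonneg (fun s => (hE s).differentiableAt) fun s => by
      rw [(hE s).deriv]
      exact hnn s
  have hlim : ∀ e : Filter ℝ, e = atTop ∨ e = atBot →
      Tendsto (fun s => inner ℝ (z s) (matOp C (z s))) e (𝓝 0) := fun e he => by
    have h1 := hz.tendsto_zero he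
    have h2 := h1.inner (((matOp C).continuous.tendsto 0).comp h1) (𝕜 := ℝ)
    simpa using h2
  have hzero : (fun s => inner ℝ (z s) (matOp C (z s))) = fun _ => 0 := funext fun s =>
    le_antisymm (hmono.ge_of_tendsto (hlim _ (.inl rfl)) s)
      (hmono.le_of_tendsto (hlim _ (.inr rfl)) s)
  by_contra h0
  have h1 := hE t
  rw [hzero] at h1
  have h2 := h1.unique (hasDerivAt_const t 0)
  linarith [hpos t _ h0]

/-- The energy G(z) is conserved, since J is skew, and tends to G(0) = 0. As 0 is an isolated zero
of G, the set of times with z = 0 is open as well as closed, and decay makes it nonempty. -/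
lemma no_homoclinic_of_conditionC (hJt : J.transpose = -J)
    {g : ℝ → PhaseSpace N → PhaseSpace N} (hg : Continuous fun p : ℝ × PhaseSpace N => g p.1 p.2)
    (h : ConditionC g) {z : ℝ → PhaseSpace N}
    (hz : IsSobolevPair z fun t => -matOp J (g t (z t))) (t : ℝ) : z t = 0 := by
  obtain ⟨-, G, hG, hG0, hiso⟩ := h
  have hzc := hz.continuous
  have hGc : Continuous G := continuous_iff_continuousAt.2 fun ξ => (hG 0 ξ).continuousAt
  have hd := hz.hasDerivAt (((matOp J).continuous.comp
    (hg.comp (continuous_id.prodMk hzc))).neg)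
  have hskew : ∀ ξ : PhaseSpace N, inner ℝ ξ (matOp J ξ) = 0 := fun ξ => by
    have := inner_matOp_left hJt ξ ξ
    rw [real_inner_comm] at this
    linarith
  have hE : ∀ s, HasDerivAt (fun s => G (z s)) 0 s := fun s => by
    have h1 := ((hG s (z s)).hasFDerivAt).comp_hasDerivAt s (hd s)
    refine h1.congr_deriv ?_
    simp only [InnerProductSpace.toDual_apply_apply]
    rw [inner_neg_right, hskew, neg_zero]
  have hconst : ∀ s, G (z s) = 0 := fun s => by
    have h1 : ∀ r, G (z r) = G (z s) := fun r =>
      is_const_of_deriv_eq_zero (fun r => (hE r).differentiableAt) (fun r => (hE r).deriv) r s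
    have h2 := (hGc.tendsto 0).comp (hz.tendsto_zero (.inl rfl))
    have h3 : G ∘ z = fun _ => G (z s) := funext h1
    rw [h3, hG0] at h2
    exact tendsto_nhds_unique tendsto_const_nhds h2
  rw [eventually_nhdsWithin_iff, Metric.eventually_nhds_iff] at hiso
  obtain ⟨δ, hδ, hiso⟩ := hiso
  have hsmall : ∀ s, dist (z s) 0 < δ → z s = 0 := fun s hs => by
    by_contra h0
    exact hiso hs h0 (hconst s)
  have hclopen : IsClopen {s | z s = 0} := by
    refine ⟨isClosed_eq hzc continuous_const, ?_⟩
    have : {s | z s = 0} = {s | dist (z s) 0 < δ} := by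
      ext s
      exact ⟨fun hs => by rw [mem_ofPred_eq] at hs ⊢; rw [hs, dist_self]; exact hδ, hsmall s⟩
    rw [this]
    exact isOpen_lt (hzc.dist continuous_const) continuous_const
  have hne : {s | z s = 0}.Nonempty := by
    obtain ⟨s, hs⟩ := ((hz.tendsto_zero (.inl rfl)).eventually (Metric.ball_mem_nhds 0 hδ)).exists
    exact ⟨s, hsmall s hs⟩
  exact (hclopen.eq_univ hne ▸ mem_univ t : t ∈ {s | z s = 0})

end Asymptotic

/-! ## The ends of the Hamiltonian system -/

section Ends

variable {N : ℕ} {J : Mat N} {H : ℝ → PhaseSpace N → ℝ → ℝ} {e : Filter ℝ}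
  {g : ℝ → PhaseSpace N → ℝ → PhaseSpace N} {T : ℝ → ℝ}

namespace AsymptoticLimit

lemma continuous_field (hg : AsymptoticLimit H e g T) (l : ℝ) :
    Continuous fun p : ℝ × PhaseSpace N => g p.1 p.2 l := (hg.bundle l).1.1

lemma continuous_linearization (hg : AsymptoticLimit H e g T) (l : ℝ) :
    Continuous fun t => fderiv ℝ (fun ξ => g t ξ l) 0 :=
  (hg.bundle l).2.2.1.comp (f := fun t : ℝ => (t, (0 : PhaseSpace N))) (by fun_prop)

lemma periodic_linearization (hg : AsymptoticLimit H e g T) (l t : ℝ) :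
    fderiv ℝ (fun ξ => g (t + T l) ξ l) 0 = fderiv ℝ (fun ξ => g t ξ l) 0 := by
  simp only [hg.periodic]

lemma eventually_norm_sub_le (hg : AsymptoticLimit H e g T) (l R : ℝ) {ε : ℝ} (hε : 0 < ε) :
    ∀ᶠ t in e, ∀ ξ, ‖ξ‖ ≤ R → ‖DxxH H t ξ l - fderiv ℝ (fun η => g t η l) ξ‖ ≤ ε := by
  filter_upwards [Metric.tendstoUniformlyOn_iff.1
    (hg.limit l _ (Metric.isBounded_closedBall (x := 0) (r := R))) ε hε] with t ht ξ hξ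
  have := ht ξ (by simpa using hξ)
  rw [dist_comm, dist_eq_norm, Pi.zero_apply, sub_zero] at this
  exact this.le

/-- The asymptotic limit gives closeness at ξ = 0, and the modulus of D_ξ² H, uniform in t, extends
it to a neighbourhood of 0. -/
lemma eventually_norm_DxxH_sub_le (hH : HamiltonianHyp H) (hg : AsymptoticLimit H e g T) (l : ℝ)
    {ε : ℝ} (hε : 0 < ε) : ∃ δ : ℝ, 0 < δ ∧ ∀ᶠ t in e, ∀ ξ, ‖ξ‖ ≤ δ →
      ‖DxxH H t ξ l - fderiv ℝ (fun η => g t η l) 0‖ ≤ ε := by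
  obtain ⟨δ, hδ, hm⟩ := hH.isTame_DxxH.modulus (1 + |l|) (ε / 2) (by positivity)
  refine ⟨min δ 1, by positivity, ?_⟩
  filter_upwards [hg.eventually_norm_sub_le l 0 (half_pos hε)] with t ht ξ hξ
  have h1 := ht 0 (by simp)
  have h2 := hm t ξ 0 l l (by linarith [hξ.trans (min_le_right _ _), abs_nonneg l])
    (by rw [norm_zero]; positivity) (by linarith) (by linarith)
    (by simpa using hξ.trans (min_le_left _ _)) (by simpa using hδ.le)
  linarith [norm_sub_le_norm_sub_add_norm_sub (DxxH H t ξ l) (DxxH H t 0 l)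
    (fderiv ℝ (fun η => g t η l) 0)]

lemma coercive (hJ : J * J = -1) (hg : AsymptoticLimit H e g T) {l : ℝ}
    (hmult : ∀ ρ : ℂ, IsCharacteristicMultiplier J (fun t => fderiv ℝ (fun ξ => g t ξ l) 0) (T l) ρ →
      ‖ρ‖ ≠ 1) :
    ∃ c : ℝ, 0 ≤ c ∧ ∀ w v : ℝ → PhaseSpace N, IsSobolevPair w v →
      lpNorm w 2 volume ≤ c * lpNorm (fun t => v t -
        (-(matOp J).comp (fderiv ℝ (fun ξ => g t ξ l) 0)) (w t)) 2 volume :=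
  exists_coercive_of_characteristicMultiplier hJ (hg.continuous_linearization l) (hg.period_pos l)
    (hg.periodic_linearization l) hmult

/-- The end of the linearized system along a function that vanishes at infinity. -/
lemma isHyperbolicEnd_linearization (hJ : J * J = -1) (hH : HamiltonianHyp H)
    (hg : AsymptoticLimit H e g T) {l : ℝ}
    (hmult : ∀ ρ : ℂ, IsCharacteristicMultiplier J (fun t => fderiv ℝ (fun ξ => g t ξ l) 0) (T l) ρ →
      ‖ρ‖ ≠ 1) {u : ℝ → PhaseSpace N} (hu : Tendsto u e (𝓝 0)) :
    IsHyperbolicEnd (fun t ξ => -matOp J (DxxH H t (u t) l ξ)) e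
      (fun t ξ => -matOp J (fderiv ℝ (fun ξ => g t ξ l) 0 ξ))
      (fun t => -(matOp J).comp (fderiv ℝ (fun ξ => g t ξ l) 0)) (T l) := by
  have hsmall : ∀ ε : ℝ, 0 < ε → ∀ᶠ t in e, ∀ ξ,
      ‖-matOp J (DxxH H t (u t) l ξ) - -matOp J (fderiv ℝ (fun ξ => g t ξ l) 0 ξ)‖ ≤ ε * ‖ξ‖ := by
    intro ε hε
    obtain ⟨δ, hδ, h⟩ := hg.eventually_norm_DxxH_sub_le hH l
      (ε := ε / (‖matOp J‖ + 1)) (by positivity)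
    filter_upwards [h, hu.eventually (Metric.closedBall_mem_nhds 0 hδ)] with t ht hut ξ
    have h1 := ht (u t) (by simpa using hut)
    rw [neg_sub_neg, ← map_sub]
    refine norm_matOp_le J hε.le (norm_nonneg ξ) ?_
    rw [norm_sub_rev]
    exact (DxxH H t (u t) l - fderiv ℝ (fun ξ => g t ξ l) 0).le_of_opNorm_le h1 ξ
  -- The field is linear in ξ, so any radius serves in the linearization condition, for instance 1.
  -- Coercivity itself excludes homoclinic solutions.
  refine ⟨hg.period_pos l, ?_, fun t ξ => ?_, fun R ε hε => ?_, fun ε hε => ⟨1, one_pos, ?_⟩,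
    hg.coercive hJ hmult, fun z hz => eq_zero_of_coercive (hg.coercive hJ hmult) hz⟩
  · have h1 : Continuous fun p : ℝ × PhaseSpace N => fderiv ℝ (fun ξ => g p.1 ξ l) 0 p.2 :=
      ((hg.continuous_linearization l).comp continuous_fst).clm_apply continuous_snd
    exact ((matOp J).continuous.comp h1).neg
  · simp only [hg.periodic_linearization]
  · filter_upwards [hsmall (ε / (|R| + 1)) (by positivity)] with t ht ξ hξ
    refine (ht ξ).trans ?_
    calc ε / (|R| + 1) * ‖ξ‖ ≤ ε / (|R| + 1) * (|R| + 1) := by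
          gcongr
          linarith [le_abs_self R]
      _ = ε := by field_simp
  · filter_upwards [hsmall ε hε] with t ht ξ η _ _
    have h1 := ht (ξ - η)
    have h2 : -matOp J (DxxH H t (u t) l ξ) - -matOp J (DxxH H t (u t) l η)
        - (-(matOp J).comp (fderiv ℝ (fun ξ => g t ξ l) 0)) (ξ - η)
        = -matOp J (DxxH H t (u t) l (ξ - η)) - -matOp J (fderiv ℝ (fun ξ => g t ξ l) 0 (ξ - η)) := by
      change _ - -matOp J (fderiv ℝ (fun ξ => g t ξ l) 0 (ξ - η)) = _
      rw [map_sub (DxxH H t (u t) l), map_sub (matOp J)]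
      abel
    rwa [h2]

/-- The end of the nonlinear system. -/
lemma isHyperbolicEnd (hJt : J.transpose = -J) (hJ : J * J = -1) (hH : HamiltonianHyp H)
    (hg : AsymptoticLimit H e g T) {l : ℝ}
    (hmult : ∀ ρ : ℂ, IsCharacteristicMultiplier J (fun t => fderiv ℝ (fun ξ => g t ξ l) 0) (T l) ρ →
      ‖ρ‖ ≠ 1)
    (hcond : ConditionA J (fun t ξ => g t ξ l) ∨ ConditionB (fun t ξ => g t ξ l) ∨
      ConditionC (fun t ξ => g t ξ l)) :
    IsHyperbolicEnd (fun t ξ => -matOp J (DxH H t ξ l)) e (fun t ξ => -matOp J (g t ξ l))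
      (fun t => -(matOp J).comp (fderiv ℝ (fun ξ => g t ξ l) 0)) (T l) := by
  have hgc := hg.continuous_field l
  refine ⟨hg.period_pos l, ((matOp J).continuous.comp hgc).neg, fun t ξ => ?_, fun R ε hε => ?_,
    fun ε hε => ?_, hg.coercive hJ hmult, fun z hz => ?_⟩
  · rw [hg.periodic]
  · filter_upwards [hg.eventually_norm_sub_le l R (ε := ε / (|R| + 1) / (‖matOp J‖ + 1))
      (by positivity)] with t ht ξ hξ
    have hR : 0 ≤ R := (norm_nonneg ξ).trans hξ
    -- Only the derivatives are assumed to be asymptotic; D_ξ H and g both vanish at 0, so the mean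
    -- value inequality from 0 makes the fields asymptotic too.
    have h1 := Convex.norm_image_sub_le_of_norm_hasFDerivWithin_le (x := 0) (y := ξ)
      (f := fun η => DxH H t η l - g t η l) (s := Metric.closedBall 0 R)
      (fun ζ _ => ((hH.hasFDerivAt_DxH t ζ l).sub
        ((hg.bundle l).2.1 t ζ).hasFDerivAt).hasFDerivWithinAt)
      (fun ζ hζ => ht ζ (by simpa using hζ)) (convex_closedBall _ _) (by simpa using hR)
      (by simpa using hξ)
    simp only [hH.DxH_zero, hg.zero, sub_zero] at h1
    rw [neg_sub_neg, ← map_sub]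
    rw [norm_sub_rev] at h1
    refine (norm_matOp_le J (ε := ε / (|R| + 1)) (by positivity) (norm_nonneg ξ) h1).trans ?_
    calc ε / (|R| + 1) * ‖ξ‖ ≤ ε / (|R| + 1) * (|R| + 1) := by
          gcongr
          linarith [le_abs_self R]
      _ = ε := by field_simp
  · obtain ⟨δ, hδ, h⟩ := hg.eventually_norm_DxxH_sub_le hH l
      (ε := ε / (‖matOp J‖ + 1)) (by positivity)
    refine ⟨δ, hδ, ?_⟩
    filter_upwards [h] with t ht ξ η hξ hη
    have h1 := Convex.norm_image_sub_le_of_norm_hasFDerivWithin_le' (x := η) (y := ξ)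
      (f := fun η => DxH H t η l) (s := Metric.closedBall 0 δ)
      (fun ζ _ => (hH.hasFDerivAt_DxH t ζ l).hasFDerivWithinAt)
      (fun ζ hζ => ht ζ (by simpa using hζ)) (convex_closedBall _ _) (by simpa using hη)
      (by simpa using hξ)
    have h2 : -matOp J (DxH H t ξ l) - -matOp J (DxH H t η l)
        - (-(matOp J).comp (fderiv ℝ (fun ξ => g t ξ l) 0)) (ξ - η)
        = -matOp J (DxH H t ξ l - DxH H t η l - fderiv ℝ (fun ξ => g t ξ l) 0 (ξ - η)) := by
      change _ - -matOp J (fderiv ℝ (fun ξ => g t ξ l) 0 (ξ - η)) = _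
      rw [map_sub (matOp J), map_sub (matOp J)]
      abel
    rw [h2, norm_neg]
    exact norm_matOp_le J hε.le (norm_nonneg _) h1
  · rcases hcond with h | h | h
    · exact no_homoclinic_of_conditionA hJt hgc h hz
    · refine eq_zero_of_coercive (hg.coercive hJ hmult) ?_
      have e : (fun t => -matOp J (g t (z t) l)) =
          fun t => (-(matOp J).comp (fderiv ℝ (fun ξ => g t ξ l) 0)) (z t) := funext fun t => by
        change _ = -matOp J (fderiv ℝ (fun ξ => g t ξ l) 0 (z t))
        rw [show g t (z t) l = _ from h t (z t)]
      exact e ▸ hz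
    · exact no_homoclinic_of_conditionC hJt hgc h hz

end AsymptoticLimit

end Ends

/-! ## Properness -/

section Properness

variable {N : ℕ} {J : Mat N} {H : ℝ → PhaseSpace N → ℝ → ℝ}

/-- D_l f vanishes at ξ = 0 and is Lipschitz in ξ, so |D_l f| ≤ K ‖ξ‖. This allows the parameter to
be frozen at its limit. -/
lemma IsSmoothField.norm_toL2_sub_le {f : ℝ → PhaseSpace N → ℝ → PhaseSpace N}
    {D : ℝ → PhaseSpace N → ℝ → PhaseSpace N →L[ℝ] PhaseSpace N}
    {f' : ℝ → PhaseSpace N → ℝ → PhaseSpace N}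
    {D' : ℝ → PhaseSpace N → ℝ → PhaseSpace N →L[ℝ] PhaseSpace N}
    (h : IsSmoothField f D f' D') (R : ℝ) : ∃ C, 0 ≤ C ∧ ∀ l m u, |l| ≤ R → |m| ≤ R → ‖u‖ ≤ R →
      ‖h.toL2 m u - h.toL2 l u‖ ≤ C * |m - l| * ‖u‖ := by
  obtain ⟨K, hK, hlip⟩ := h.lipschitz' (4 * R)
  refine ⟨K, hK, fun l m u hl hm hu => ?_⟩
  have hR : 0 ≤ R := (norm_nonneg u).trans hu
  refine le_trans ?_ (mul_le_mul_of_nonneg_left u.norm_toL2_le (by positivity))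
  refine Lp.norm_le_mul_norm_of_ae_le_mul ?_
  filter_upwards [Lp.coeFn_sub (h.toL2 m u) (h.toL2 l u), h.coeFn_toL2 m u, h.coeFn_toL2 l u,
    u.toL2_ae_eq] with t e1 e2 e3 e4
  rw [e1, Pi.sub_apply, e2, e3, e4]
  have h1 := Convex.norm_image_sub_le_of_norm_hasDerivWithin_le (C := K * ‖u.rep t‖) (x := l)
    (y := m) (f := fun k => f t (u.rep t) k) (s := Metric.closedBall 0 R)
    (fun k _ => (h.hasDerivAt t (u.rep t) k).hasDerivWithinAt)
    (fun k hk => by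
      have h2 := hlip t (u.rep t) 0 k (by linarith [u.norm_rep_le t])
        (by rw [norm_zero]; positivity)
        (by
          have : |k| ≤ R := by simpa using hk
          linarith)
      simpa [h.zero'] using h2)
    (convex_closedBall _ _) (by simpa using hl) (by simpa using hm)
  rw [Real.norm_eq_abs] at h1
  linarith

lemma HamiltonianHyp.isLocallyLipschitzField (hH : HamiltonianHyp H) (J : Mat N) (l : ℝ) :
    IsLocallyLipschitzField fun t ξ => -matOp J (DxH H t ξ l) := by
  refine ⟨?_, fun t => by rw [hH.DxH_zero, map_zero, neg_zero], fun R => ?_⟩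
  · have h1 : Continuous fun p : ℝ × PhaseSpace N => DxH H p.1 p.2 l :=
      hH.continuous_DxH.comp (f := fun p : ℝ × PhaseSpace N => (p.1, p.2, l)) (by fun_prop)
    exact ((matOp J).continuous.comp h1).neg
  · obtain ⟨K, hK, h⟩ := hH.isSmoothField.lipschitz (max R |l|)
    refine ⟨‖matOp J‖ * K, by positivity, fun t ξ η hξ hη => ?_⟩
    rw [neg_sub_neg, ← map_sub, mul_assoc, norm_sub_rev ξ]
    refine (matOp J).le_opNorm_of_le ?_
    exact h t η ξ l (hη.trans (le_max_left _ _)) (hξ.trans (le_max_left _ _)) (le_max_right _ _)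

/-- The strict inequalities place the limit between two points of I, and I is order-connected. -/
lemma mem_of_tendsto_of_sInf_lt {I : Set ℝ} (hI : I.OrdConnected) {S : Set EReal}
    (h1 : sInf ((fun l : ℝ => (l : EReal)) '' I) < sInf S)
    (h2 : sSup S < sSup ((fun l : ℝ => (l : EReal)) '' I)) {k : ℕ → ℝ} {l : ℝ}
    (hk : ∀ n, (k n : EReal) ∈ S) (hl : Tendsto k atTop (𝓝 l)) : l ∈ I := by
  have hl' : Tendsto (fun n => (k n : EReal)) atTop (𝓝 (l : EReal)) :=
    (continuous_coe_real_ereal.tendsto l).comp hl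
  have h3 : sInf S ≤ l := ge_of_tendsto' hl' fun n => sInf_le (hk n)
  have h4 : (l : EReal) ≤ sSup S := le_of_tendsto' hl' fun n => le_sSup (hk n)
  obtain ⟨_, ⟨a, ha, rfl⟩, hal⟩ := sInf_lt_iff.1 (h1.trans_le h3)
  obtain ⟨_, ⟨b, hb, rfl⟩, hlb⟩ := lt_sSup_iff.1 (h4.trans_lt h2)
  exact hI.out ha hb ⟨(EReal.coe_lt_coe_iff.1 hal).le, (EReal.coe_lt_coe_iff.1 hlb).le⟩

/-- Properness of `F` on closed bounded sets over which the limit systems are hyperbolic. -/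
lemma HamiltonianHyp.isCompact_preimage_inter (hJ : J * J = -1) (hH : HamiltonianHyp H)
    {I : Set ℝ}
    (hends : ∀ l ∈ I, ∃ Gp Gm Bp Bm Tp Tm,
      IsHyperbolicEnd (fun t ξ => -matOp J (DxH H t ξ l)) atTop Gp Bp Tp ∧
      IsHyperbolicEnd (fun t ξ => -matOp J (DxH H t ξ l)) atBot Gm Bm Tm)
    {K : Set (L2 N)} (hK : IsCompact K) {W : Set (ℝ × H1 N)} (hW : IsClosed W)
    (hWb : Bornology.IsBounded W)
    (hlim : ∀ (p : ℕ → ℝ × H1 N) (l : ℝ), (∀ n, p n ∈ W) →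
      Tendsto (fun n => (p n).1) atTop (𝓝 l) → l ∈ I) :
    IsCompact (hamiltonianMap J H ⁻¹' K ∩ W) := by
  have hFc : Continuous (hamiltonianMap J H) := (hH.contDiff_hamiltonianMap J).continuous
  rw [isCompact_iff_isSeqCompact]
  intro p hp
  obtain ⟨R, hR⟩ := hWb.exists_norm_le
  have hl : ∀ n, |(p n).1| ≤ R := fun n => (norm_fst_le (p n)).trans (hR _ (hp n).2)
  have hu : ∀ n, ‖(p n).2‖ ≤ R := fun n => (norm_snd_le (p n)).trans (hR _ (hp n).2)
  obtain ⟨l, -, φ, hφ, hφl⟩ := (isCompact_closedBall (0 : ℝ) R).tendsto_subseq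
    (x := fun n => (p n).1) fun n => by simpa using hl n
  obtain ⟨y, hy, ψ, hψ, hψy⟩ := hK.tendsto_subseq (x := fun n => hamiltonianMap J H (p (φ n)))
    fun n => (hp (φ n)).1
  set q : ℕ → ℝ × H1 N := fun n => p (φ (ψ n))
  have hql : Tendsto (fun n => (q n).1) atTop (𝓝 l) := hφl.comp hψ.tendsto_atTop
  have hqy : Tendsto (fun n => hamiltonianMap J H (q n)) atTop (𝓝 y) := hψy
  have hlR : |l| ≤ R := le_of_tendsto' hql.abs fun n => hl _
  obtain ⟨Gp, Gm, Bp, Bm, Tp, Tm, hGp, hGm⟩ := hends l (hlim q l (fun n => (hp _).2) hql)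
  -- Replacing the varying parameter by its limit changes the values by a null sequence, so the
  -- compactness theorem for the single parameter l applies.
  have hr : Tendsto (fun n => hamiltonianMap J H (l, (q n).2)) atTop (𝓝 y) := by
    obtain ⟨C, hC, hCb⟩ := hH.isSmoothField.norm_toL2_sub_le R
    have h1 : Tendsto (fun n => hamiltonianMap J H (l, (q n).2) - hamiltonianMap J H (q n)) atTop
        (𝓝 0) := by
      have h2 : Tendsto (fun n => C * |(q n).1 - l| * R) atTop (𝓝 0) := by
        have := ((tendsto_sub_nhds_zero_iff.2 hql).abs.const_mul C).mul_const R
        simpa using this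
      refine squeeze_zero_norm (fun n => ?_) h2
      have h3 : hamiltonianMap J H (l, (q n).2) - hamiltonianMap J H (q n)
          = hH.isSmoothField.toL2 (q n).1 (q n).2 - hH.isSmoothField.toL2 l (q n).2 := by
        rw [hH.hamiltonianMap_eq, hH.hamiltonianMap_eq]
        abel
      rw [h3]
      exact (hCb l _ _ hlR (hl _) (hu _)).trans
        (mul_le_mul_of_nonneg_left (hu _) (by positivity))
    simpa using h1.add hqy
  obtain ⟨χ, hχ, z, hz⟩ := exists_subseq_tendsto_H1 hJ (hH.isLocallyLipschitzField J l) hGp hGm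
    (u := fun n => (q n).2) (fun n => hu _) (fun n => by
      rw [hH.hamiltonianMap_eq]
      filter_upwards [Lp.coeFn_sub (matL J (q n).2.weakDeriv) (hH.isSmoothField.toL2 l (q n).2),
        (matOp J).coeFn_compLpL (p := 2) (q n).2.weakDeriv,
        hH.isSmoothField.coeFn_toL2 l (q n).2] with t e1 e2 e3
      rw [← e2, ← e3]
      exact e1) hr
  have hlim' : Tendsto (q ∘ χ) atTop (𝓝 (l, z)) :=
    (hql.comp hχ.tendsto_atTop).prodMk_nhds hz
  refine ⟨(l, z), ⟨?_, ?_⟩, φ ∘ ψ ∘ χ, hφ.comp (hψ.comp hχ), hlim'⟩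
  · exact hK.isClosed.mem_of_tendsto ((hFc.tendsto _).comp hlim') (.of_forall fun n => (hp _).1)
  · exact hW.mem_of_tendsto hlim' (.of_forall fun n => (hp _).2)

end Properness

end HamiltonianHomoclinic

end

open HamiltonianHomoclinic
theorem theorem5p4 (N : ℕ) (J : Mat N) (hJt : J.transpose = -J) (hJsq : J * J = -1)
    (H : ℝ → PhaseSpace N → ℝ → ℝ) (hH : HamiltonianHyp H)
    (gp gm : ℝ → PhaseSpace N → ℝ → PhaseSpace N) (Tp Tm : ℝ → ℝ)
    (hgp : AsymptoticLimit H atTop gp Tp) (hgm : AsymptoticLimit H atBot gm Tm)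
    (I : Set ℝ) (hIopen : IsOpen I) (hIint : I.OrdConnected)
    (hmult : ∀ l ∈ I,
      (∀ ρ : ℂ, IsCharacteristicMultiplier J (fun t => fderiv ℝ (fun ξ => gp t ξ l) 0) (Tp l) ρ →
        ‖ρ‖ ≠ 1) ∧
      (∀ ρ : ℂ, IsCharacteristicMultiplier J (fun t => fderiv ℝ (fun ξ => gm t ξ l) 0) (Tm l) ρ →
        ‖ρ‖ ≠ 1))
    (hplus : ∀ l ∈ I, ConditionA J (fun t ξ => gp t ξ l) ∨ ConditionB (fun t ξ => gp t ξ l) ∨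
      ConditionC (fun t ξ => gp t ξ l))
    (hminus : ∀ l ∈ I, ConditionA J (fun t ξ => gm t ξ l) ∨ ConditionB (fun t ξ => gm t ξ l) ∨
      ConditionC (fun t ξ => gm t ξ l)) :
    (∀ (l : ℝ) (x : H1 N), MemLp (fun t => DxH H t (x.toL2 t) l) 2 (volume : Measure ℝ)) ∧
      IsAdmissible (hamiltonianMap J H) I := by
  refine ⟨hH.memLp_DxH, (hH.contDiff_hamiltonianMap J).contDiffOn, fun l hl x => ?_,
    fun K hK W hW hWb h1 _ h2 => ?_⟩
  · rw [hH.fderiv_hamiltonianMap J l x]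
    -- Since x decays, the linearization along x has the same limit systems as the linearization at
    -- 0; the multiplier condition suffices here.
    exact isFredholmIndexZero_of_isHyperbolicEnd hJt hJsq
      (a := hH.isSmoothField.derivBCF l x) (fun t => hH.inner_DxxH_comm t _ l)
      (hgp.isHyperbolicEnd_linearization hJsq hH (hmult l hl).1
        (x.isSobolevPair.tendsto_zero (.inl rfl)))
      (hgm.isHyperbolicEnd_linearization hJsq hH (hmult l hl).2
        (x.isSobolevPair.tendsto_zero (.inr rfl)))
  · refine hH.isCompact_preimage_inter hJsq (I := I) (fun l hl => ?_) hK hW hWb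
      fun p l hp hpl => mem_of_tendsto_of_sInf_lt hIint h1 h2
        (fun n => ⟨p n, hp n, rfl⟩) hpl
    exact ⟨_, _, _, _, _, _,
      hgp.isHyperbolicEnd hJt hJsq hH (hmult l hl).1 (hplus l hl),
      hgm.isHyperbolicEnd hJt hJsq hH (hmult l hl).2 (hminus l hl)⟩
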